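/- Let $k$ be a perfect field of characteristic $p>0$, let $S$ be a regular, locally Noetherian, $F$-finite $k$-scheme, and let $f\colon X\to S$ be a flat morphism of finite type with geometrically normal fibres and $f_*\mathcal O_X=\mathcal O_S$. Assume that the relative tangent sheaf $T_{X/S}$ is flat over $S$ and that for every $s\in S$ the natural map $T_{X/S}\otimes k(s)\to T_{X_s/k(s)}$ is an isomorphism. Let $\mathcal F\subseteq T_{X/S}$ be a coherent subsheaf such that $T_{X/S}/\mathcal F$ is flat over $S$ and such that, for every $s\in S$, the image $\mathcal F_s\subseteq T_{X_s/k(s)}$ of $\mathcal F\otimes k(s)$ is a $1$-foliation of rank $r$: the quotient $T_{X_s/k(s)}/\mathcal F_s$ is torsion-free, $\mathcal F_s$ is closed under Lie brackets and $p$-th powers, and it has rank $r$ at each generic point of $X_s$. Let $X/\mathcal F=(|X|,\mathcal O_X^{\mathcal F})$ be the quotient, where $\mathcal O_X^{\mathcal F}\subseteq\mathcal O_X$ is the subsheaf of sections annihilated by all elements of $\mathcal F$. It is a scheme, and $f$ factors as $X\xrightarrow{q}X/\mathcal F\xrightarrow{g}S$. For $s\in S$ let $(X/\mathcal F)_s$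 be the fibre of $g$ over $s$, let $X_s/\mathcal F_s=(|X_s|,\mathcal O_{X_s}^{\mathcal F_s})$, and let $$\varphi_s\colon X_s/\mathcal F_s\to (X/\mathcal F)_s$$ be the comparison morphism, through which the morphism $X_s\to (X/\mathcal F)_s$ induced by $q$ factors (it exists because sections annihilated by $\mathcal F$ restrict to sections annihilated by $\mathcal F_s$). Then for every $s\in S$: 1. $\varphi_s$ is finite, and it is an isomorphism in codimension one, i.e. it is an isomorphism over an open subset of $(X/\mathcal F)_s$ that contains all points of codimension at most one. 2. For every $z\in X_s$, write $\bar z$ for the image of $z$ in $X_s/\mathcal F_s$. Then $\varphi_s$ is an isomorphism at $\bar z$ (i.e. over an open neighbourhood of $\varphi_s(\bar z)$) if and only if $(X/\mathcal F)_s$ is $S_2$ at $\varphi_s(\bar z)$, i.e. the local ring $R$ of $(X/\mathcal F)_s$ at $\varphi_s(\bar z)$ satisfies Serre's condition $S_2$: $\operatorname{depth}R_{\mathfrak p}\ge\min(2,\dim R_{\mathfrak p})$ for all primes $\mathfrak p$ of $R$. -/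

import Mathlib

open CategoryTheory Limits TopologicalSpace Opposite

universe u

noncomputable section

namespace AlgebraicGeometry

/-- Derivations `D` of `A` and `E` of `B` correspond along a ring map `φ : A → B` when the
square `E ∘ φ = φ ∘ D` commutes. -/
def DerivationCompatible {A B : Type*} [CommRing A] [CommRing B] (φ : A →+* B)
    (D : Derivation ℤ A A) (E : Derivation ℤ B B) : Prop :=
  ∀ a, E (φ a) = φ (D a)

/-- A derivation of a localization is determined by its effect on numerators. -/
lemma derivation_eq_of_isLocalization {A B C : Type*} [CommRing A] [CommRing B] [CommRing C]
    [Algebra A B] (M : Submonoid A) [IsLocalization M B] (ψ : B →+* C)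
    (D : Derivation ℤ B B) (E : Derivation ℤ C C)
    (h : ∀ a, E (ψ (algebraMap A B a)) = ψ (D (algebraMap A B a))) :
    DerivationCompatible ψ D E := by
  intro b
  obtain ⟨⟨a, m⟩, ham⟩ := IsLocalization.surj M b
  simp only at ham
  have hu : IsUnit (ψ (algebraMap A B m)) := (IsLocalization.map_units B m).map ψ
  have h1 := congr_arg (fun c ↦ E (ψ c)) ham
  have h2 := congr_arg (fun c ↦ ψ (D c)) ham
  simp only [map_mul, Derivation.leibniz, smul_eq_mul, map_add, h] at h1 h2
  rw [← hu.mul_right_inj]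
  linear_combination h1 - h2

/-- The ring map `a ↦ φ(a) + φ(D a) ε` into the dual numbers attached to a derivation `D`. -/
def dualNumberHom {A B : Type*} [CommRing A] [CommRing B] (φ : A →+* B) (D : Derivation ℤ A A) :
    A →+* DualNumber B where
  toFun a := TrivSqZeroExt.inl (φ a) + TrivSqZeroExt.inr (φ (D a))
  map_one' := by ext <;> simp
  map_zero' := by ext <;> simp
  map_add' a b := by ext <;> simp
  map_mul' a b := by ext <;> simp [mul_comm, add_comm]

/-- The derivation attached to a section of the dual numbers. -/
def derivationOfDualNumberHom {B : Type*} [CommRing B] (θ : B →+* DualNumber B)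
    (h : ∀ b, (θ b).fst = b) : Derivation ℤ B B :=
  Derivation.mk' (AddMonoidHom.toIntLinearMap
    { toFun := fun b ↦ (θ b).snd
      map_zero' := by simp
      map_add' := fun a b ↦ by simp })
    fun a b ↦ by simp [h, mul_comm]

lemma derivationOfDualNumberHom_apply {B : Type*} [CommRing B] (θ : B →+* DualNumber B)
    (h : ∀ b, (θ b).fst = b) (b : B) : derivationOfDualNumberHom θ h b = (θ b).snd := rfl

/-- Derivations extend to localizations. -/
lemma exists_derivation_of_isLocalization {A B : Type*} [CommRing A] [CommRing B]
    [Algebra A B] (M : Submonoid A) [IsLocalization M B] (D : Derivation ℤ A A) :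
    ∃ E : Derivation ℤ B B, DerivationCompatible (algebraMap A B) D E := by
  have hM (m : M) : IsUnit (dualNumberHom (algebraMap A B) D m) := by
    rw [TrivSqZeroExt.isUnit_iff_isUnit_fst]
    simpa [dualNumberHom] using IsLocalization.map_units B m
  have hid : (TrivSqZeroExt.fstHom B B B).toRingHom.comp (IsLocalization.lift hM) =
      RingHom.id B := by
    apply IsLocalization.ringHom_ext M
    ext a
    simp [dualNumberHom]
  refine ⟨derivationOfDualNumberHom (IsLocalization.lift hM) fun b ↦ ?_, fun a ↦ ?_⟩
  · exact congr($hid b)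
  · rw [derivationOfDualNumberHom_apply, IsLocalization.lift_eq]
    simp [dualNumberHom, Algebra.algebraMap_eq_smul_one]

lemma isIso_of_isLocalization_away {R : Type u} [CommRing R] (r : R) (B C : CommRingCat.{u})
    [Algebra R B] [IsLocalization.Away r B] [Algebra R C] [IsLocalization.Away r C] (g : B ⟶ C)
    (h : CommRingCat.ofHom (algebraMap R B) ≫ g = CommRingCat.ofHom (algebraMap R C)) :
    IsIso g := by
  let e := IsLocalization.algEquiv (Submonoid.powers r) B C
  have h2 : g = CommRingCat.ofHom e.toRingEquiv.toRingHom := by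
    ext : 1
    apply IsLocalization.ringHom_ext (Submonoid.powers r)
    refine (congr_arg CommRingCat.Hom.hom h).trans ?_
    ext a
    exact (e.commutes a).symm
  rw [h2]
  exact (e.toRingEquiv.toCommRingCatIso).isIso_hom

/-- The stalk at `x` of the relative tangent sheaf `T_{X/S}`: the `𝒪_{S,f(x)}`-linear derivations
of `𝒪_{X,x}`, that is, those which vanish on the image of `𝒪_{S,f(x)}`. -/
def tangentStalk {X S : Scheme.{u}} (f : X ⟶ S) (x : X) :
    Submodule (X.presheaf.stalk x)
      (Derivation ℤ (X.presheaf.stalk x) (X.presheaf.stalk x)) where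
  carrier := {D | ∀ a : S.presheaf.stalk (f x), D ((f.stalkMap x).hom a) = 0}
  add_mem' h₁ h₂ a := by simp [h₁ a, h₂ a]
  zero_mem' a := by simp
  smul_mem' c D h a := by simp [h a]

/-- A coherent subsheaf `ℱ ⊆ T_{X/S}`, given by its stalks. Coherence: around each point there are
an affine open `U` and finitely many derivations of `Γ(X, U)` whose germs span every stalk of `ℱ`
over `U`. (Over an affine open `U`, a derivation of the ring `Γ(X, U)` is the same thing as a
derivation of the sheaf `𝒪_U`.) -/
structure TangentSubsheaf {X S : Scheme.{u}} (f : X ⟶ S) where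
  /-- The stalk `ℱ_x`. -/
  stalk (x : X) : Submodule (X.presheaf.stalk x)
    (Derivation ℤ (X.presheaf.stalk x) (X.presheaf.stalk x))
  stalk_le (x : X) : stalk x ≤ tangentStalk f x
  coherent (x : X) : ∃ (U : X.Opens) (_ : IsAffineOpen U) (_ : x ∈ U)
    (G : Set (Derivation ℤ Γ(X, U) Γ(X, U))), G.Finite ∧
      ∀ (y : X) (hy : y ∈ U), stalk y = Submodule.span (X.presheaf.stalk y)
        {E | ∃ D ∈ G, DerivationCompatible (X.presheaf.germ U y hy).hom D E}

namespace TangentSubsheaf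

variable {X S : Scheme.{u}} {f : X ⟶ S} (F : TangentSubsheaf f)

/-- The ring `𝒪_X^ℱ(U)` of sections of `𝒪_X` over `U` that are annihilated by `ℱ`. -/
def constants (U : X.Opens) : Subring Γ(X, U) where
  carrier := {a | ∀ (x : X) (hx : x ∈ U), ∀ D ∈ F.stalk x,
    D ((X.presheaf.germ U x hx).hom a) = 0}
  zero_mem' x hx D hD := by simp
  one_mem' x hx D hD := by simp
  add_mem' h₁ h₂ x hx D hD := by simp [h₁ x hx D hD, h₂ x hx D hD]
  neg_mem' h x hx D hD := by simp [h x hx D hD]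
  mul_mem' h₁ h₂ x hx D hD := by simp [h₁ x hx D hD, h₂ x hx D hD]

lemma mem_constants {U : X.Opens} {a : Γ(X, U)} : a ∈ F.constants U ↔
    ∀ (x : X) (hx : x ∈ U), ∀ D ∈ F.stalk x, D ((X.presheaf.germ U x hx).hom a) = 0 := Iff.rfl

lemma res_mem {U V : X.Opens} (i : V ⟶ U) {a : Γ(X, U)} (ha : a ∈ F.constants U) :
    (X.presheaf.map i.op).hom a ∈ F.constants V := by
  intro x hx D hD
  have := X.presheaf.germ_res_apply i x hx a
  erw [this]
  exact ha x (i.le hx) D hD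

/-- The presheaf of rings `U ↦ 𝒪_X^ℱ(U)`. -/
def quotientPresheaf : TopCat.Presheaf CommRingCat.{u} X.toTopCat where
  obj U := CommRingCat.of (F.constants U.unop)
  map {U V} i := CommRingCat.ofHom
    ((X.presheaf.map i).hom.restrict (F.constants U.unop) (F.constants V.unop)
      fun _ ha ↦ F.res_mem i.unop ha)
  map_id U := by
    ext a
    simp
  map_comp i j := by
    ext a
    simp

/-- The inclusion `𝒪_X^ℱ ⟶ 𝒪_X`. -/
def inclusion : F.quotientPresheaf ⟶ X.presheaf where
  app U := CommRingCat.ofHom (F.constants U.unop).subtype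
  naturality U V i := by ext a; rfl

lemma isSheaf_quotientPresheaf : F.quotientPresheaf.IsSheaf := by
  rw [TopCat.Presheaf.isSheaf_iff_isSheafUniqueGluing]
  intro ι U sf hsf
  have hs := X.IsSheaf.isSheafUniqueGluing U (fun i ↦ (sf i).1) (fun i j ↦ by
    have := congr_arg Subtype.val (hsf i j)
    exact this)
  obtain ⟨s, hs, huniq⟩ := hs
  refine ⟨⟨s, ?_⟩, ?_, ?_⟩
  · intro x hx D hD
    obtain ⟨i, hi⟩ := Opens.mem_iSup.mp hx
    have h1 := (sf i).2 x hi D hD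
    have h2 : (X.presheaf.map (Opens.leSupr U i).op).hom s = (sf i).1 := hs i
    rw [← h2] at h1
    have := X.presheaf.germ_res_apply (Opens.leSupr U i) x hi s
    erw [this] at h1
    exact h1
  · intro i
    exact Subtype.ext (hs i)
  · intro t ht
    exact Subtype.ext (huniq t.1 fun i ↦ congr_arg Subtype.val (ht i))

/-- The ringed space `(|X|, 𝒪_X^ℱ)`. -/
def quotientSheafedSpace : SheafedSpace CommRingCat.{u} where
  carrier := X.toTopCat
  presheaf := F.quotientPresheaf
  IsSheaf := F.isSheaf_quotientPresheaf

/-- The morphism of ringed spaces `(|X|, 𝒪_X) ⟶ (|X|, 𝒪_X^ℱ)` which is the identity on points. -/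
def toQuotientSheafedSpace : X.toSheafedSpace ⟶ F.quotientSheafedSpace :=
  InducedCategory.homMk
    { base := 𝟙 _
      c := F.inclusion }

lemma inv_mem {U : X.Opens} {a b : Γ(X, U)} (ha : a ∈ F.constants U) (hab : a * b = 1) :
    b ∈ F.constants U := by
  intro x hx D hD
  have h1 := congr_arg (fun c ↦ D ((X.presheaf.germ U x hx).hom c)) hab
  simp only [map_mul, map_one, Derivation.leibniz, Derivation.map_one_eq_zero, ha x hx D hD,
    smul_eq_mul, mul_zero, add_zero] at h1
  have h2 : (X.presheaf.germ U x hx).hom b * (X.presheaf.germ U x hx).hom a = 1 := by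
    rw [← map_mul, mul_comm, hab, map_one]
  calc D ((X.presheaf.germ U x hx).hom b)
      = ((X.presheaf.germ U x hx).hom b * (X.presheaf.germ U x hx).hom a) *
        D ((X.presheaf.germ U x hx).hom b) := by rw [h2, one_mul]
    _ = 0 := by rw [mul_assoc, h1, mul_zero]

lemma isUnit_of_isUnit_val {U : X.Opens} (a : F.constants U) (h : IsUnit a.1) : IsUnit a := by
  obtain ⟨b, hb⟩ := h.exists_right_inv
  exact IsUnit.of_mul_eq_one ⟨b, F.inv_mem a.2 hb⟩ (Subtype.ext hb)

lemma isUnit_germ {U : X.Opens} {x : X} (hx : x ∈ U) (a : F.constants U)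
    (h : IsUnit ((X.presheaf.germ U x hx).hom a.1)) :
    IsUnit ((F.quotientPresheaf.germ U x hx).hom a) := by
  have hle : X.basicOpen a.1 ≤ U := X.basicOpen_le a.1
  have hxV : x ∈ X.basicOpen a.1 := (X.mem_basicOpen a.1 x hx).mpr h
  have h1 : IsUnit ((F.quotientPresheaf.map (homOfLE hle).op).hom a) :=
    F.isUnit_of_isUnit_val (U := X.basicOpen a.1) _ (X.toRingedSpace.isUnit_res_basicOpen a.1)
  have h2 := h1.map (F.quotientPresheaf.germ _ x hxV).hom
  have h3 := F.quotientPresheaf.germ_res_apply (homOfLE hle) x hxV a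
  erw [h3] at h2
  exact h2

instance isLocalHom_stalkMap (x : X) :
    IsLocalHom (F.toQuotientSheafedSpace.hom.stalkMap x).hom := by
  constructor
  intro t ht
  obtain ⟨U, hx, a, rfl⟩ := F.quotientPresheaf.exists_germ_eq t
  apply F.isUnit_germ hx a
  have := PresheafedSpace.stalkMap_germ_apply F.toQuotientSheafedSpace.hom U x hx a
  erw [this] at ht
  exact ht

/-- The locally ringed space `(|X|, 𝒪_X^ℱ)`. -/
def quotientLRS : LocallyRingedSpace.{u} where
  toSheafedSpace := F.quotientSheafedSpace
  isLocalRing x :=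
    haveI := F.isLocalHom_stalkMap x
    haveI : IsLocalRing (X.presheaf.stalk x) := X.isLocalRing x
    (F.toQuotientSheafedSpace.hom.stalkMap x).hom.domain_isLocalRing

/-- The morphism of locally ringed spaces `(|X|, 𝒪_X) ⟶ (|X|, 𝒪_X^ℱ)`. -/
def toQuotientLRS : X.toLocallyRingedSpace ⟶ F.quotientLRS :=
  LocallyRingedSpace.homMk F.toQuotientSheafedSpace F.isLocalHom_stalkMap

/-- The generating derivations in the definition of coherence can be found on arbitrarily small
affine neighbourhoods. -/
lemma coherent_of_mem (x : X) (V : X.Opens) (hxV : x ∈ V) :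
    ∃ (U : X.Opens) (_ : IsAffineOpen U) (_ : x ∈ U) (_ : U ≤ V)
      (G : Set (Derivation ℤ Γ(X, U) Γ(X, U))), G.Finite ∧
      ∀ (y : X) (hy : y ∈ U), F.stalk y = Submodule.span (X.presheaf.stalk y)
        {E | ∃ D ∈ G, DerivationCompatible (X.presheaf.germ U y hy).hom D E} := by
  obtain ⟨W, hW, hxW, G, hG, hspan⟩ := F.coherent x
  obtain ⟨g, hgV, hxg⟩ := hW.exists_basicOpen_le ⟨x, hxV⟩ hxW
  have hle : X.basicOpen g ≤ W := X.basicOpen_le g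
  let _ : Algebra Γ(X, W) Γ(X, X.basicOpen g) := (X.presheaf.map (homOfLE hle).op).hom.toAlgebra
  have : IsLocalization.Away g Γ(X, X.basicOpen g) := hW.isLocalization_basicOpen g
  choose e he using fun D : Derivation ℤ Γ(X, W) Γ(X, W) ↦
    exists_derivation_of_isLocalization (B := Γ(X, X.basicOpen g)) (Submonoid.powers g) D
  refine ⟨X.basicOpen g, hW.basicOpen g, hxg, hgV, e '' G, hG.image e, fun y hy ↦ ?_⟩
  rw [hspan y (hle hy)]
  congr 1
  ext E
  have hgerm (a : Γ(X, W)) : (X.presheaf.germ _ y hy).hom (algebraMap _ Γ(X, X.basicOpen g) a) =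
      (X.presheaf.germ W y (hle hy)).hom a := X.presheaf.germ_res_apply (homOfLE hle) y hy a
  constructor
  · rintro ⟨D, hD, hDE⟩
    refine ⟨e D, ⟨D, hD, rfl⟩, ?_⟩
    apply derivation_eq_of_isLocalization (A := Γ(X, W)) (Submonoid.powers g)
    intro a
    rw [hgerm, hDE, he, hgerm]
  · rintro ⟨_, ⟨D, hD, rfl⟩, hDE⟩
    refine ⟨D, hD, fun a ↦ ?_⟩
    rw [← hgerm, hDE, he, hgerm]

/-- A derivation over an affine open has germs. -/
lemma exists_germ_derivation {U : X.Opens} (hU : IsAffineOpen U) (y : X) (hy : y ∈ U)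
    (D : Derivation ℤ Γ(X, U) Γ(X, U)) :
    ∃ E : Derivation ℤ (X.presheaf.stalk y) (X.presheaf.stalk y),
      DerivationCompatible (X.presheaf.germ U y hy).hom D E := by
  let _ : Algebra Γ(X, U) (X.presheaf.stalk y) := (X.presheaf.germ U y hy).hom.toAlgebra
  have := hU.isLocalization_stalk ⟨y, hy⟩
  exact exists_derivation_of_isLocalization (hU.primeIdealOf ⟨y, hy⟩).asIdeal.primeCompl D

lemma exists_pow_mul_mem {U : X.Opens} (hU : IsAffineOpen U) {r : Γ(X, U)}
    (hr : r ∈ F.constants U) (b : Γ(X, U))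
    (hb : (X.presheaf.map (homOfLE (X.basicOpen_le r)).op).hom b ∈ F.constants (X.basicOpen r)) :
    ∃ n : ℕ, r ^ n * b ∈ F.constants U := by
  have key (x : U) : ∃ (V : X.Opens) (_ : x.1 ∈ V) (n : ℕ), ∀ m, n ≤ m → ∀ y (hy : y ∈ U), y ∈ V →
      ∀ D ∈ F.stalk y, D ((X.presheaf.germ U y hy).hom (r ^ m * b)) = 0 := by
    obtain ⟨V, hV, hxV, hVU, G, hG, hspan⟩ := F.coherent_of_mem x.1 U x.2
    set ρ := (X.presheaf.map (homOfLE hVU).op).hom with hρ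
    have hgerm (y : X) (hy : y ∈ V) (a : Γ(X, U)) : (X.presheaf.germ V y hy).hom (ρ a) =
      (X.presheaf.germ U y (hVU hy)).hom a := X.presheaf.germ_res_apply (homOfLE hVU) y hy a
    have h1 (D : Derivation ℤ Γ(X, V) Γ(X, V)) (hD : D ∈ G) : ∃ n : ℕ, ρ r ^ n * D (ρ b) = 0 := by
      apply exists_pow_mul_eq_zero_of_res_basicOpen_eq_zero_of_isCompact X hV.isCompact
      apply TopCat.Presheaf.section_ext ⟨X.presheaf, X.IsSheaf⟩
      intro y hy
      have hyV : y ∈ V := X.basicOpen_le _ hy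
      have hyr : y ∈ X.basicOpen r := by
        rw [X.mem_basicOpen r y (hVU hyV), ← hgerm]
        exact (X.mem_basicOpen (ρ r) y hyV).mp hy
      obtain ⟨E, hE⟩ := exists_germ_derivation hV y hyV D
      have hEF : E ∈ F.stalk y := by
        rw [hspan y hyV]
        exact Submodule.subset_span ⟨D, hD, hE⟩
      have h2 := hb y hyr E hEF
      have h3 := X.presheaf.germ_res_apply (homOfLE (X.basicOpen_le r)) y hyr b
      erw [h3] at h2
      have h4 := hE (ρ b)
      rw [hgerm] at h4
      erw [h2] at h4
      have h5 := X.presheaf.germ_res_apply (homOfLE (X.basicOpen_le (ρ r))) y hy (D (ρ b))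
      erw [map_zero]
      erw [h5]
      exact h4.symm
    choose! n hn using h1
    refine ⟨V, hxV, hG.toFinset.sup n, fun m hm y hy hyV D hD ↦ ?_⟩
    rw [hspan y hyV] at hD
    induction hD using Submodule.span_induction with
    | zero => simp
    | add D E _ _ hD hE => rw [Derivation.add_apply, hD, hE, add_zero]
    | smul c D _ hD => rw [Derivation.smul_apply, hD, smul_zero]
    | mem E hE =>
      obtain ⟨D, hD, hDE⟩ := hE
      have hEF : E ∈ F.stalk y := by
        rw [hspan y hyV]
        exact Submodule.subset_span ⟨D, hD, hDE⟩
      have hnm : n D ≤ m := le_trans (Finset.le_sup (f := n) (hG.mem_toFinset.mpr hD)) hm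
      have h6 : ρ r ^ m * D (ρ b) = 0 := by
        rw [← Nat.sub_add_cancel hnm, pow_add, mul_assoc, hn D hD, mul_zero]
      have h7 : E ((X.presheaf.germ U y hy).hom (r ^ m)) = 0 :=
        (F.constants U).pow_mem hr m y hy E hEF
      have h8 := congr_arg (X.presheaf.germ V y hyV).hom h6
      rw [map_mul, ← map_pow, hgerm, map_zero, ← hDE, hgerm] at h8
      simp only [map_mul, Derivation.leibniz, smul_eq_mul]
      rw [h7, h8]
      simp
  choose V hxV n hn using key
  obtain ⟨t, ht⟩ := hU.isCompact.elim_finite_subcover (fun x ↦ (V x : Set X))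
    (fun x ↦ (V x).isOpen) fun x hx ↦ Set.mem_iUnion.mpr ⟨⟨x, hx⟩, hxV ⟨x, hx⟩⟩
  refine ⟨t.sup n, fun y hy D hD ↦ ?_⟩
  obtain ⟨x, hxt, hyx⟩ := Set.mem_iUnion₂.mp (ht hy)
  exact hn x _ (Finset.le_sup hxt) y hy hyx D hD

/-- For an affine open `U`, the ring `𝒪_X^ℱ(U_r)` is the localization of `𝒪_X^ℱ(U)` at `r`. -/
lemma isLocalization_constants {U V : X.Opens} (hU : IsAffineOpen U) (r : F.constants U)
    (hV : V = X.basicOpen r.1) (i : V ⟶ U) :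
    letI : Algebra (F.constants U) (F.constants V) := (F.quotientPresheaf.map i.op).hom.toAlgebra
    IsLocalization.Away r (F.constants V) := by
  subst hV
  let _ : Algebra (F.constants U) (F.constants (X.basicOpen r.1)) :=
    (F.quotientPresheaf.map i.op).hom.toAlgebra
  let _ : Algebra Γ(X, U) Γ(X, X.basicOpen r.1) := (X.presheaf.map i.op).hom.toAlgebra
  have : IsLocalization.Away r.1 Γ(X, X.basicOpen r.1) := hU.isLocalization_basicOpen r.1
  have hval (a : F.constants U) : (algebraMap _ (F.constants (X.basicOpen r.1)) a).1 =
    algebraMap Γ(X, U) Γ(X, X.basicOpen r.1) a.1 := rfl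
  refine ⟨?_, ?_, ?_⟩
  · rintro ⟨_, n, rfl⟩
    apply F.isUnit_of_isUnit_val
    rw [hval]
    exact IsLocalization.map_units (M := Submonoid.powers r.1) _ ⟨r.1 ^ n, n, rfl⟩
  · intro c
    obtain ⟨n, b, hb⟩ := IsLocalization.Away.surj r.1 c.1
    have hrV : algebraMap Γ(X, U) Γ(X, X.basicOpen r.1) r.1 ∈ F.constants (X.basicOpen r.1) :=
      F.res_mem i r.2
    obtain ⟨m, hm⟩ := F.exists_pow_mul_mem hU r.2 b (by
      have : algebraMap Γ(X, U) Γ(X, X.basicOpen r.1) b ∈ F.constants (X.basicOpen r.1) := by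
        rw [← hb]
        exact mul_mem c.2 (pow_mem hrV n)
      exact this)
    refine ⟨⟨⟨_, hm⟩, ⟨r ^ (m + n), m + n, rfl⟩⟩, Subtype.ext ?_⟩
    change c.1 * algebraMap Γ(X, U) Γ(X, X.basicOpen r.1) (r.1 ^ (m + n)) =
      algebraMap Γ(X, U) Γ(X, X.basicOpen r.1) (r.1 ^ m * b)
    rw [map_mul, ← hb, map_pow, map_pow]
    ring
  · intro a b hab
    have h1 : algebraMap Γ(X, U) Γ(X, X.basicOpen r.1) a.1 =
      algebraMap Γ(X, U) Γ(X, X.basicOpen r.1) b.1 := congr_arg Subtype.val hab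
    obtain ⟨⟨_, n, rfl⟩, hc⟩ := IsLocalization.exists_of_eq (M := Submonoid.powers r.1) h1
    exact ⟨⟨r ^ n, n, rfl⟩, Subtype.ext hc⟩

/-- The scheme `X` has characteristic `p`, i.e. `p = 0` in `𝒪_X`. -/
def _root_.AlgebraicGeometry.Scheme.OfChar (p : ℕ) (X : Scheme.{u}) : Prop :=
  (p : Γ(X, ⊤)) = 0

lemma _root_.AlgebraicGeometry.Scheme.OfChar.stalk_eq_zero {p : ℕ} {X : Scheme.{u}}
    (hX : X.OfChar p) (x : X) : (p : X.presheaf.stalk x) = 0 := by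
  have := congr_arg (X.presheaf.germ ⊤ x trivial).hom hX
  rwa [map_natCast, map_zero] at this

lemma _root_.AlgebraicGeometry.Scheme.OfChar.of_hom {p : ℕ} {X Y : Scheme.{u}}
    (hY : Y.OfChar p) (h : X ⟶ Y) : X.OfChar p := by
  have := congr_arg h.appTop.hom hY
  rwa [map_natCast, map_zero] at this

lemma _root_.AlgebraicGeometry.Scheme.OfChar.of_hom_spec {p : ℕ} {X : Scheme.{u}} {k : Type u}
    [Field k] [CharP k p] (h : X ⟶ Spec (.of k)) : X.OfChar p := by
  refine Scheme.OfChar.of_hom ?_ h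
  have : ((p : k) : k) = 0 := CharP.cast_eq_zero k p
  have h2 := congr_arg (Scheme.ΓSpecIso (.of k)).inv.hom this
  rwa [map_natCast, map_zero] at h2

lemma pow_mem_constants {p : ℕ} (hX : X.OfChar p) {U : X.Opens} (a : Γ(X, U)) :
    a ^ p ∈ F.constants U := by
  intro x hx D hD
  rw [map_pow, Derivation.leibniz_pow, ← Nat.cast_smul_eq_nsmul (X.presheaf.stalk x),
    hX.stalk_eq_zero, zero_smul]

lemma isUnit_germ_iff {U : X.Opens} {x : X} (hx : x ∈ U) (a : F.constants U) :
    IsUnit ((F.quotientPresheaf.germ U x hx).hom a) ↔ x ∈ X.basicOpen a.1 := by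
  rw [X.mem_basicOpen a.1 x hx]
  refine ⟨fun h ↦ ?_, F.isUnit_germ hx a⟩
  have := PresheafedSpace.stalkMap_germ_apply F.toQuotientSheafedSpace.hom U x hx a
  have h2 := h.map (F.toQuotientSheafedSpace.hom.stalkMap x).hom
  erw [this] at h2
  exact h2

section local_affine

variable (U : X.Opens)

/-- The restriction of `(|X|, 𝒪_X^ℱ)` to an open subset. -/
abbrev restrictLRS : LocallyRingedSpace.{u} := F.quotientLRS.restrict U.isOpenEmbedding

/-- `U` as an open of itself, regarded as an open of `X`. -/
abbrev topImage : X.Opens := U.isOpenEmbedding.functor.obj ⊤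

lemma topImage_eq : topImage U = U := by
  ext x
  simp

lemma mem_toΓSpecFun (r : F.constants (topImage U)) (x : U) :
    r ∉ ((F.restrictLRS U).toΓSpecFun x).asIdeal ↔ x.1 ∈ X.basicOpen r.1 := by
  have h1 := LocallyRingedSpace.notMem_prime_iff_unit_in_stalk (F.restrictLRS U) r x
  refine h1.trans ?_
  have h2 := F.quotientLRS.restrictStalkIso_hom_eq_germ_apply U.isOpenEmbedding ⊤ x trivial r
  have h3 : x.1 ∈ topImage U := ⟨x, trivial, rfl⟩
  rw [← F.isUnit_germ_iff h3]
  erw [← h2]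
  exact (MulEquiv.isUnit_map
    (F.quotientLRS.restrictStalkIso U.isOpenEmbedding x).commRingCatIsoToRingEquiv).symm

variable {U}

lemma isHomeomorph_toΓSpecFun {p : ℕ} (hp : p ≠ 0) (hX : X.OfChar p) (hU : IsAffineOpen U) :
    IsHomeomorph (F.restrictLRS U).toΓSpecFun := by
  have hU' : IsAffineOpen (topImage U) := by rwa [topImage_eq]
  have hcont := (F.restrictLRS U).toΓSpec_continuous
  have hsurj : Function.Surjective (F.restrictLRS U).toΓSpecFun := by
    intro q
    obtain ⟨P, hP⟩ := (PrimeSpectrum.isHomeomorph_comap (F.constants (topImage U)).subtype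
      (fun a ↦ ⟨p, Nat.pos_of_ne_zero hp, ⟨⟨_, F.pow_mem_constants hX a⟩, rfl⟩⟩)
      (by rw [(RingHom.injective_iff_ker_eq_bot _).mp Subtype.val_injective]
          exact bot_le)).surjective q
    have hx : hU'.fromSpec P ∈ topImage U := by
      have : hU'.fromSpec P ∈ Set.range hU'.fromSpec := ⟨P, rfl⟩
      rwa [hU'.range_fromSpec] at this
    refine ⟨⟨hU'.fromSpec P, (topImage_eq U).le hx⟩, ?_⟩
    rw [← hP]
    ext r
    rw [← not_iff_not]
    refine (F.mem_toΓSpecFun U r _).trans ?_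
    change _ ↔ P ∈ PrimeSpectrum.basicOpen r.1
    have := hU'.fromSpec_preimage_basicOpen r.1
    exact SetLike.ext_iff.mp this P
  have hpow (a : Γ(X, topImage U)) : ∃ r : F.constants (topImage U),
      X.basicOpen r.1 = X.basicOpen a :=
    ⟨⟨_, F.pow_mem_constants hX a⟩, X.basicOpen_pow a (Nat.pos_of_ne_zero hp)⟩
  have hbasis (x : U) (W : Set U) (hW : IsOpen W) (hxW : x ∈ W) :
      ∃ r : F.constants (topImage U), x.1 ∈ X.basicOpen r.1 ∧
        {y : U | y.1 ∈ X.basicOpen r.1} ⊆ W := by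
    let W' : X.Opens := ⟨Subtype.val '' W, U.isOpen.isOpenMap_subtype_val W hW⟩
    obtain ⟨a, ha, hxa⟩ := hU'.exists_basicOpen_le (V := W') ⟨x.1, x, hxW, rfl⟩
      (by rw [topImage_eq]; exact x.2)
    obtain ⟨r, hr⟩ := hpow a
    refine ⟨r, by rwa [hr], fun y hy ↦ ?_⟩
    have hy' : y.1 ∈ X.basicOpen r.1 := hy
    rw [hr] at hy'
    obtain ⟨z, hz, hzy⟩ := ha hy'
    rwa [← Subtype.ext hzy]
  refine ⟨hcont, ?_, ?_, hsurj⟩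
  · intro W hW
    rw [isOpen_iff_mem_nhds]
    rintro _ ⟨x, hx, rfl⟩
    obtain ⟨r, hxr, hrW⟩ := hbasis x W hW hx
    refine Filter.mem_of_superset ((PrimeSpectrum.basicOpen r).isOpen.mem_nhds
      (x := (F.restrictLRS U).toΓSpecFun x) ?_) ?_
    · exact (F.mem_toΓSpecFun U r x).mpr hxr
    · intro z hz
      obtain ⟨y, rfl⟩ := hsurj z
      exact ⟨y, hrW ((F.mem_toΓSpecFun U r y).mp hz), rfl⟩
  · intro x y hxy
    have hT0 : T0Space U := inferInstanceAs (T0Space (U : Scheme))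
    by_contra hne
    have key (x y : U) (hxy : (F.restrictLRS U).toΓSpecFun x = (F.restrictLRS U).toΓSpecFun y)
        (W : Set U) (hW : IsOpen W) (hxW : x ∈ W) : y ∈ W := by
      obtain ⟨r, hxr, hrW⟩ := hbasis x W hW hxW
      apply hrW
      apply (F.mem_toΓSpecFun U r y).mp
      rw [← hxy]
      exact (F.mem_toΓSpecFun U r x).mpr hxr
    obtain ⟨W, hW, hW2⟩ := exists_isOpen_xor_mem (X := U) hne
    rcases hW2 with ⟨h1, h2⟩ | ⟨h1, h2⟩
    · exact h2 (key x y hxy W hW h1)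
    · exact h2 (key y x hxy.symm W hW h1)

lemma isIso_toΓSpecCApp (hU : IsAffineOpen U) (r : F.constants (topImage U)) :
    IsIso ((F.restrictLRS U).toΓSpecCApp r) := by
  have hU' : IsAffineOpen (topImage U) := by rwa [topImage_eq]
  let V : X.Opens := U.isOpenEmbedding.functor.obj ((F.restrictLRS U).toΓSpecMapBasicOpen r)
  have hV : V = X.basicOpen r.1 := by
    ext x
    constructor
    · rintro ⟨y, hy, rfl⟩
      exact (F.mem_toΓSpecFun U r y).mp hy
    · intro hx
      have hxU : x ∈ topImage U := X.basicOpen_le r.1 hx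
      rw [topImage_eq] at hxU
      exact ⟨⟨x, hxU⟩, (F.mem_toΓSpecFun U r ⟨x, hxU⟩).mpr hx, rfl⟩
  let i : V ⟶ topImage U := U.isOpenEmbedding.functor.map (Opens.leTop _)
  let _ : Algebra (F.constants (topImage U)) (F.constants V) :=
    (F.quotientPresheaf.map i.op).hom.toAlgebra
  have hloc : IsLocalization.Away r (F.constants V) := F.isLocalization_constants hU' r hV i
  let R := LocallyRingedSpace.Γ.obj (op (F.restrictLRS U))
  let _ : Algebra R (F.constants V) := (F.quotientPresheaf.map i.op).hom.toAlgebra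
  have : IsLocalization.Away (R := R) r (F.constants V) := hloc
  let _ : Algebra R ((Spec.structureSheaf R).obj.obj (op (PrimeSpectrum.basicOpen r))) :=
    StructureSheaf.openAlgebra R _
  have : IsLocalization.Away (R := R) r
      ((Spec.structureSheaf R).obj.obj (op (PrimeSpectrum.basicOpen r))) :=
    StructureSheaf.IsLocalization.to_basicOpen R r
  exact isIso_of_isLocalization_away (R := R) r
    ((Spec.structureSheaf R).obj.obj (op (PrimeSpectrum.basicOpen r)))
    (CommRingCat.of (F.constants V)) ((F.restrictLRS U).toΓSpecCApp r)
    ((F.restrictLRS U).toΓSpecCApp_spec r)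

lemma isIso_toΓSpec {p : ℕ} (hp : p ≠ 0) (hX : X.OfChar p) (hU : IsAffineOpen U) :
    IsIso (F.restrictLRS U).toΓSpec := by
  set L := F.restrictLRS U with hL
  have h1 : IsIso L.toΓSpecSheafedSpace.hom.base :=
    (TopCat.isIso_iff_isHomeomorph _).mpr (F.isHomeomorph_toΓSpecFun hp hX hU)
  have h2 : IsIso L.toΓSpecSheafedSpace.hom.c := by
    let φ : Spec.structureSheaf (LocallyRingedSpace.Γ.obj (op L)) ⟶
        (TopCat.Sheaf.pushforward _ L.toΓSpecBase).obj L.𝒪 := ⟨L.toΓSpecSheafedSpace.hom.c⟩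
    have h3 : IsIso φ := by
      refine TopCat.Sheaf.isIso_iff_isIso_basis (φ := φ) PrimeSpectrum.isBasis_basic_opens
        (fun r ↦ ?_)
      have := F.isIso_toΓSpecCApp hU r
      have h4 := L.toΓSpecSheafedSpace_app_eq r
      change IsIso (L.toΓSpecSheafedSpace.hom.c.app (op (PrimeSpectrum.basicOpen r)))
      rw [h4]
      exact this
    exact Functor.map_isIso (TopCat.Sheaf.forget _ _) φ
  have h3 : IsIso L.toΓSpecSheafedSpace.hom := PresheafedSpace.isIso_of_components _
  have h4 : IsIso (SheafedSpace.forgetToPresheafedSpace.map L.toΓSpecSheafedSpace) := h3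
  have h5 : IsIso L.toΓSpecSheafedSpace :=
    isIso_of_reflects_iso _ SheafedSpace.forgetToPresheafedSpace
  have h6 : IsIso (LocallyRingedSpace.forgetToSheafedSpace.map L.toΓSpec) := h5
  exact isIso_of_reflects_iso _ LocallyRingedSpace.forgetToSheafedSpace

end local_affine
/-- The quotient `X/ℱ`: the locally ringed space `(|X|, 𝒪_X^ℱ)`, which is a scheme when `X` has
positive characteristic `p`. -/
def quotient {p : ℕ} (hp : p ≠ 0) (hX : X.OfChar p) : Scheme.{u} where
  toLocallyRingedSpace := F.quotientLRS
  local_affine x := by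
    obtain ⟨U, hU, hxU, -⟩ := F.coherent x
    exact ⟨⟨U, hxU⟩, _, ⟨@asIso _ _ _ _ _ (F.isIso_toΓSpec hp hX hU)⟩⟩

/-- The quotient morphism `q : X ⟶ X/ℱ`: the identity on points and the inclusion
`𝒪_X^ℱ ⊆ 𝒪_X` on sections. -/
def toQuotient {p : ℕ} (hp : p ≠ 0) (hX : X.OfChar p) : X ⟶ F.quotient hp hX :=
  ⟨F.toQuotientLRS⟩

section desc

variable {W : Scheme.{u}} (h : X ⟶ W)

/-- A morphism `h : X ⟶ W` is `ℱ`-invariant if `ℱ` annihilates the image of `𝒪_W` in `𝒪_X`. -/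
def Invariant : Prop :=
  ∀ (x : X), ∀ D ∈ F.stalk x, ∀ a : W.presheaf.stalk (h x), D ((h.stalkMap x).hom a) = 0

variable {F h}

lemma Invariant.app_mem (H : F.Invariant h) (V : W.Opens) (a : Γ(W, V)) :
    (h.app V).hom a ∈ F.constants (h ⁻¹ᵁ V) := by
  intro x hx D hD
  have h1 := H x D hD ((W.presheaf.germ V (h x) hx).hom a)
  have h2 := Scheme.Hom.germ_stalkMap_apply h V x hx a
  erw [h2] at h1
  exact h1

/-- The morphism of ringed spaces underlying `Invariant.desc`. -/
def Invariant.descSheafedSpace (H : F.Invariant h) :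
    F.quotientSheafedSpace ⟶ W.toSheafedSpace :=
  InducedCategory.homMk
    { base := h.base
      c :=
      { app := fun V ↦ CommRingCat.ofHom
          ((h.app V.unop).hom.codRestrict (F.constants (h ⁻¹ᵁ V.unop)) (H.app_mem V.unop))
        naturality := fun V V' i ↦ by
          ext a
          apply Subtype.ext
          exact congr($(h.c.naturality i) a) } }

lemma Invariant.toQuotient_descSheafedSpace (H : F.Invariant h) :
    F.toQuotientSheafedSpace ≫ H.descSheafedSpace = h.toLRSHom.toShHom := rfl

lemma Invariant.isLocalHom_stalkMap (H : F.Invariant h) (x : X) :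
    IsLocalHom (H.descSheafedSpace.hom.stalkMap x).hom := by
  have h1 := PresheafedSpace.stalkMap.comp F.toQuotientSheafedSpace.hom H.descSheafedSpace.hom x
  have h2 : IsLocalHom (h.toLRSHom.toShHom.hom.stalkMap x).hom := h.toLRSHom.prop x
  constructor
  intro a ha
  have h3 := ha.map (F.toQuotientSheafedSpace.hom.stalkMap x).hom
  have h4 := congr($h1 a)
  apply h2.map_nonunit
  refine Eq.mp (congr_arg IsUnit h4.symm) h3

/-- An `ℱ`-invariant morphism factors through the quotient `X/ℱ`. -/
def Invariant.desc (H : F.Invariant h) {p : ℕ} (hp : p ≠ 0) (hX : X.OfChar p) :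
    F.quotient hp hX ⟶ W :=
  ⟨LocallyRingedSpace.homMk H.descSheafedSpace H.isLocalHom_stalkMap⟩

lemma Invariant.toQuotient_desc (H : F.Invariant h) {p : ℕ} (hp : p ≠ 0) (hX : X.OfChar p) :
    F.toQuotient hp hX ≫ H.desc hp hX = h := rfl

end desc

lemma invariant_structure : F.Invariant f := fun x _ hD a ↦ F.stalk_le x hD a

/-- The structure morphism `g : X/ℱ ⟶ S`, through which `f` factors. -/
def quotientToBase {p : ℕ} (hp : p ≠ 0) (hX : X.OfChar p) : F.quotient hp hX ⟶ S :=
  F.invariant_structure.desc hp hX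

lemma toQuotient_quotientToBase {p : ℕ} (hp : p ≠ 0) (hX : X.OfChar p) :
    F.toQuotient hp hX ≫ F.quotientToBase hp hX = f :=
  F.invariant_structure.toQuotient_desc hp hX

/-- Sections of `𝒪_{X/ℱ}` are annihilated by `ℱ`. -/
lemma invariant_toQuotient {p : ℕ} (hp : p ≠ 0) (hX : X.OfChar p) :
    F.Invariant (F.toQuotient hp hX) := by
  intro x D hD a
  obtain ⟨U, hx, a, rfl⟩ := (F.quotient hp hX).presheaf.exists_germ_eq a
  have h2 := Scheme.Hom.germ_stalkMap_apply (F.toQuotient hp hX) U x hx a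
  erw [h2]
  exact a.2 x hx D hD

section fiber

variable (s : S)

/-- The `k(s)`-linear derivations of `𝒪_{X_s,x}` induced by the elements of `ℱ`, together with
their `𝒪_{X_s,x}`-linear combinations: the image of `ℱ ⊗ k(s)` in `T_{X_s/k(s)}` at `x`. -/
def fiberStalk (x : f.fiber s) : Submodule ((f.fiber s).presheaf.stalk x)
    (Derivation ℤ ((f.fiber s).presheaf.stalk x) ((f.fiber s).presheaf.stalk x)) :=
  Submodule.span _ {E | E ∈ tangentStalk (f.fiberToSpecResidueField s) x ∧
    ∃ D ∈ F.stalk (f.fiberι s x), DerivationCompatible ((f.fiberι s).stalkMap x).hom D E}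

/-- Derivations that kill the base extend to pushouts. -/
lemma exists_derivation_of_isPushout {A B C P : CommRingCat.{u}} {α : A ⟶ B} {β : A ⟶ C}
    {γ : B ⟶ P} {δ : C ⟶ P} (H : IsPushout α β γ δ) (D : Derivation ℤ B B)
    (hD : ∀ a, D (α.hom a) = 0) :
    ∃ E : Derivation ℤ P P, DerivationCompatible γ.hom D E ∧ ∀ c, E (δ.hom c) = 0 := by
  have hw : α ≫ CommRingCat.ofHom (dualNumberHom γ.hom D) =
      β ≫ δ ≫ CommRingCat.ofHom (TrivSqZeroExt.inlHom P P) := by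
    ext a : 2
    have h1 : γ.hom (α.hom a) = δ.hom (β.hom a) := congr($(H.w) a)
    change TrivSqZeroExt.inl (γ.hom (α.hom a)) + TrivSqZeroExt.inr (γ.hom (D (α.hom a))) =
      TrivSqZeroExt.inl (δ.hom (β.hom a))
    rw [hD, h1]
    simp
  let θ := H.desc (W := CommRingCat.of (DualNumber P))
    (CommRingCat.ofHom (dualNumberHom γ.hom D))
    (δ ≫ CommRingCat.ofHom (TrivSqZeroExt.inlHom P P)) hw
  have hγ (b : B) : θ.hom (γ.hom b) = dualNumberHom γ.hom D b :=
    congr($(H.inl_desc (CommRingCat.ofHom (dualNumberHom γ.hom D)) _ hw) b)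
  have hδ (c : C) : θ.hom (δ.hom c) = TrivSqZeroExt.inl (δ.hom c) :=
    congr($(H.inr_desc (CommRingCat.ofHom (dualNumberHom γ.hom D)) _ hw) c)
  have hid : θ ≫ CommRingCat.ofHom (TrivSqZeroExt.fstHom P P P).toRingHom = 𝟙 P := by
    apply H.hom_ext
    · ext b
      change (θ.hom (γ.hom b)).fst = γ.hom b
      rw [hγ]
      simp [dualNumberHom]
    · ext c
      change (θ.hom (δ.hom c)).fst = δ.hom c
      rw [hδ]
      simp
  refine ⟨derivationOfDualNumberHom θ.hom fun b ↦ congr($hid b), fun b ↦ ?_, fun c ↦ ?_⟩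
  · rw [derivationOfDualNumberHom_apply, hγ]
    simp [dualNumberHom]
  · rw [derivationOfDualNumberHom_apply, hδ]
    simp

lemma derivation_ext_of_surjective {A B : Type*} [CommRing A] [CommRing B] {φ : A →+* B}
    (hφ : Function.Surjective φ) {D : Derivation ℤ A A} {E E' : Derivation ℤ B B}
    (h : DerivationCompatible φ D E) (h' : DerivationCompatible φ D E') : E = E' := by
  ext b
  obtain ⟨a, rfl⟩ := hφ b
  rw [h, h']

lemma coherent_fiberStalk (x : f.fiber s) :
    ∃ (U : (f.fiber s).Opens) (_ : IsAffineOpen U) (_ : x ∈ U)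
      (G : Set (Derivation ℤ Γ(f.fiber s, U) Γ(f.fiber s, U))), G.Finite ∧
      ∀ (y : f.fiber s) (hy : y ∈ U), F.fiberStalk s y =
        Submodule.span ((f.fiber s).presheaf.stalk y)
          {E | ∃ D ∈ G, DerivationCompatible ((f.fiber s).presheaf.germ U y hy).hom D E} := by
  obtain ⟨V, hV, hsV, -⟩ := exists_isAffineOpen_mem_and_subset (X := S) (U := ⊤) (x := s) trivial
  have hfx (y : f.fiber s) : f (f.fiberι s y) = s := by
    have : f.fiberι s y ∈ Set.range (f.fiberι s) := ⟨y, rfl⟩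
    rw [f.range_fiberι] at this
    exact this
  obtain ⟨U, hU, hxU, hUV, G, hG, hspan⟩ :=
    F.coherent_of_mem (f.fiberι s x) (f ⁻¹ᵁ V) (by change f _ ∈ V; rw [hfx]; exact hsV)
  have H : IsPullback (f.fiberι s) (f.fiberToSpecResidueField s) f (S.fromSpecResidueField s) :=
    IsPullback.of_hasPullback _ _
  have hUST : (⊤ : (Spec (S.residueField s)).Opens) ≤ S.fromSpecResidueField s ⁻¹ᵁ V := by
    intro t _
    have : S.fromSpecResidueField s t ∈ Set.range (S.fromSpecResidueField s) := ⟨t, rfl⟩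
    rw [S.range_fromSpecResidueField] at this
    change S.fromSpecResidueField s t ∈ V
    rwa [Set.mem_singleton_iff.mp this]
  set W : (f.fiber s).Opens := f.fiberι s ⁻¹ᵁ U ⊓ f.fiberToSpecResidueField s ⁻¹ᵁ ⊤ with hWdef
  have hW : IsAffineOpen W := by
    have : IsAffine _ := hV
    have : IsAffine _ := hU
    have : IsAffine _ := isAffineOpen_top (Spec (S.residueField s))
    exact .of_isIso (Scheme.Hom.isPullback_resLE H hUST hUV hWdef).isoPullback.hom
  have hWU : W ≤ f.fiberι s ⁻¹ᵁ U := inf_le_left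
  have hWT : W ≤ f.fiberToSpecResidueField s ⁻¹ᵁ ⊤ := inf_le_right
  have HP : IsPushout (f.appLE V U hUV) ((S.fromSpecResidueField s).appLE V ⊤ hUST)
      ((f.fiberι s).appLE U W hWU) ((f.fiberToSpecResidueField s).appLE ⊤ W hWT) :=
    (isIso_pushoutSection_iff H hUST hUV hWdef).mp
      (isIso_pushoutSection_of_isAffineOpen H hUST hUV hWdef hV (isAffineOpen_top _) hU)
  -- Elements of the generating set are linear over the base.
  have hlin (D) (hD : D ∈ G) (a : Γ(S, V)) : D ((f.appLE V U hUV).hom a) = 0 := by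
    apply TopCat.Presheaf.section_ext ⟨X.presheaf, X.IsSheaf⟩
    intro y hy
    obtain ⟨E, hE⟩ := exists_germ_derivation hU y hy D
    have hEF : E ∈ F.stalk y := by
      rw [hspan y hy]
      exact Submodule.subset_span ⟨D, hD, hE⟩
    have h1 := F.stalk_le y hEF ((S.presheaf.germ V (f y) (hUV hy)).hom a)
    have h2 := Scheme.Hom.germ_stalkMap_apply f V y (hUV hy) a
    erw [h2] at h1
    have h3 : (X.presheaf.germ U y hy).hom ((f.appLE V U hUV).hom a) =
        (X.presheaf.germ (f ⁻¹ᵁ V) y (hUV hy)).hom ((f.app V).hom a) :=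
      X.presheaf.germ_res_apply (homOfLE hUV) y hy _
    have h4 := hE ((f.appLE V U hUV).hom a)
    rw [h3] at h4
    erw [h1] at h4
    erw [map_zero]
    exact h4.symm
  have hex (D) (hD : D ∈ G) := exists_derivation_of_isPushout HP D (hlin D hD)
  choose! e he he0 using hex
  refine ⟨W, hW, ⟨hxU, trivial⟩, e '' G, hG.image e, fun y hy ↦ ?_⟩
  set φ := ((f.fiberι s).stalkMap y).hom with hφ
  have hsurj : Function.Surjective φ := (f.fiberι s).stalkMap_surjective y
  have hgerm (a : Γ(X, U)) : φ ((X.presheaf.germ U (f.fiberι s y) (hWU hy)).hom a) =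
      ((f.fiber s).presheaf.germ W y hy).hom (((f.fiberι s).appLE U W hWU).hom a) := by
    have h1 := Scheme.Hom.germ_stalkMap_apply (f.fiberι s) U y (hWU hy) a
    refine h1.trans ?_
    exact ((f.fiber s).presheaf.germ_res_apply (homOfLE hWU) y hy _).symm
  -- The germs of corresponding derivations correspond.
  have hcompat (D) (hD : D ∈ G) (E0 : Derivation ℤ _ _) (E : Derivation ℤ _ _)
      (h0 : DerivationCompatible (X.presheaf.germ U (f.fiberι s y) (hWU hy)).hom D E0)
      (h1 : DerivationCompatible ((f.fiber s).presheaf.germ W y hy).hom (e D) E) :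
      DerivationCompatible φ E0 E := by
    let _ : Algebra Γ(X, U) (X.presheaf.stalk (f.fiberι s y)) :=
      (X.presheaf.germ U _ (hWU hy)).hom.toAlgebra
    have := hU.isLocalization_stalk ⟨f.fiberι s y, hWU hy⟩
    apply derivation_eq_of_isLocalization (A := Γ(X, U))
      (hU.primeIdealOf ⟨f.fiberι s y, hWU hy⟩).asIdeal.primeCompl
    intro a
    change E (φ ((X.presheaf.germ U _ (hWU hy)).hom a)) =
      φ (E0 ((X.presheaf.germ U _ (hWU hy)).hom a))
    rw [hgerm, h1, he D hD, h0, hgerm]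
  have htan (D) (hD : D ∈ G) (E : Derivation ℤ _ _)
      (h1 : DerivationCompatible ((f.fiber s).presheaf.germ W y hy).hom (e D) E) :
      E ∈ tangentStalk (f.fiberToSpecResidueField s) y := by
    intro t
    obtain ⟨T, hT, t, rfl⟩ := (Spec (S.residueField s)).presheaf.exists_germ_eq t
    obtain rfl : T = ⊤ := by
      ext z
      have hz : z = f.fiberToSpecResidueField s y :=
        Subsingleton.elim (α := PrimeSpectrum (S.residueField s)) _ _
      simp [hz, hT]
    have h2 := Scheme.Hom.germ_stalkMap_apply (f.fiberToSpecResidueField s) ⊤ y trivial t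
    erw [h2]
    have h3 := (f.fiber s).presheaf.germ_res_apply (homOfLE hWT) y hy
      (((f.fiberToSpecResidueField s).app ⊤).hom t)
    erw [← h3]
    have h4 := h1 (((f.fiberToSpecResidueField s).appLE ⊤ W hWT).hom t)
    rw [he0 D hD, map_zero] at h4
    exact h4
  apply le_antisymm
  · refine Submodule.span_le.mpr ?_
    rintro E ⟨-, D, hD, hDE⟩
    suffices ∃ E' ∈ Submodule.span ((f.fiber s).presheaf.stalk y)
        {E | ∃ D ∈ e '' G, DerivationCompatible ((f.fiber s).presheaf.germ W y hy).hom D E},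
        DerivationCompatible φ D E' by
      obtain ⟨E', hE', hDE'⟩ := this
      rwa [derivation_ext_of_surjective hsurj hDE hDE']
    clear hDE
    rw [hspan _ (hWU hy)] at hD
    induction hD using Submodule.span_induction with
    | zero => exact ⟨0, zero_mem _, fun a ↦ by simp⟩
    | add D₁ D₂ _ _ h₁ h₂ =>
      obtain ⟨E₁, hE₁, hc₁⟩ := h₁
      obtain ⟨E₂, hE₂, hc₂⟩ := h₂
      exact ⟨E₁ + E₂, add_mem hE₁ hE₂, fun a ↦ by
        rw [Derivation.add_apply, Derivation.add_apply, map_add, hc₁, hc₂]⟩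
    | smul c D _ h =>
      obtain ⟨E', hE', hc⟩ := h
      exact ⟨φ c • E', Submodule.smul_mem _ _ hE', fun a ↦ by
        rw [Derivation.smul_apply, Derivation.smul_apply, smul_eq_mul, smul_eq_mul, map_mul, hc]⟩
    | mem E0 hE0 =>
      obtain ⟨D, hD, h0⟩ := hE0
      obtain ⟨E, hE⟩ := exists_germ_derivation hW y hy (e D)
      exact ⟨E, Submodule.subset_span ⟨e D, ⟨D, hD, rfl⟩, hE⟩, hcompat D hD E0 E h0 hE⟩
  · refine Submodule.span_le.mpr ?_
    rintro E ⟨_, ⟨D, hD, rfl⟩, hE⟩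
    obtain ⟨E0, h0⟩ := exists_germ_derivation hU (f.fiberι s y) (hWU hy) D
    refine Submodule.subset_span ⟨htan D hD E hE, E0, ?_, hcompat D hD E0 E h0 hE⟩
    rw [hspan _ (hWU hy)]
    exact Submodule.subset_span ⟨D, hD, h0⟩

/-- The restriction `ℱ_s ⊆ T_{X_s/k(s)}` of `ℱ` to the fibre `X_s`: the image of `ℱ ⊗ k(s)`. -/
def fiber : TangentSubsheaf (f.fiberToSpecResidueField s) where
  stalk x := F.fiberStalk s x
  stalk_le _ := Submodule.span_le.mpr fun _ hE ↦ hE.1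
  coherent x := F.coherent_fiberStalk s x

end fiber

section comparison

lemma Invariant.of_comp {W W' : Scheme.{u}} (h : X ⟶ W) (j : W ⟶ W') [SurjectiveOnStalks j]
    (H : F.Invariant (h ≫ j)) : F.Invariant h := by
  intro x D hD a
  obtain ⟨b, rfl⟩ := j.stalkMap_surjective (h x) a
  have h1 := H x D hD b
  rw [Scheme.Hom.stalkMap_comp] at h1
  exact h1

lemma Invariant.fiberι_comp {W : Scheme.{u}} {h : X ⟶ W} (H : F.Invariant h) (s : S) :
    (F.fiber s).Invariant (f.fiberι s ≫ h) := by
  intro x D hD a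
  rw [Scheme.Hom.stalkMap_comp]
  change D (((f.fiberι s).stalkMap x).hom ((h.stalkMap (f.fiberι s x)).hom a)) = 0
  change D ∈ F.fiberStalk s x at hD
  induction hD using Submodule.span_induction with
  | zero => rfl
  | add D₁ D₂ _ _ h₁ h₂ => rw [Derivation.add_apply, h₁, h₂, add_zero]
  | smul c D _ h => rw [Derivation.smul_apply, h, smul_zero]
  | mem E hE =>
    obtain ⟨-, D, hD, hDE⟩ := hE
    exact (hDE _).trans ((congr_arg _ (H (f.fiberι s x) D hD a)).trans (map_zero _))

variable {p : ℕ} (hp : p ≠ 0) (hX : X.OfChar p) (s : S)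

/-- The morphism `X_s ⟶ (X/ℱ)_s` induced by `q` on the fibres over `s`. -/
def fiberMap : f.fiber s ⟶ (F.quotientToBase hp hX).fiber s :=
  pullback.lift (f.fiberι s ≫ F.toQuotient hp hX) (f.fiberToSpecResidueField s)
    (by rw [Category.assoc, toQuotient_quotientToBase]; exact f.fiber_fac s)

lemma fiberMap_fiberι : F.fiberMap hp hX s ≫ (F.quotientToBase hp hX).fiberι s =
    f.fiberι s ≫ F.toQuotient hp hX :=
  pullback.lift_fst _ _ _

lemma invariant_fiberMap : (F.fiber s).Invariant (F.fiberMap hp hX s) := by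
  have : SurjectiveOnStalks ((F.quotientToBase hp hX).fiberι s) := inferInstance
  apply Invariant.of_comp _ _ ((F.quotientToBase hp hX).fiberι s)
  rw [fiberMap_fiberι]
  exact Invariant.fiberι_comp F (F.invariant_toQuotient hp hX) s

/-- The quotient `X_s/ℱ_s` of the fibre. -/
abbrev fiberQuotient : Scheme.{u} :=
  (F.fiber s).quotient hp (hX.of_hom (f.fiberι s))

/-- The quotient morphism `q_s : X_s ⟶ X_s/ℱ_s` of the fibre. -/
abbrev toFiberQuotient : f.fiber s ⟶ F.fiberQuotient hp hX s :=
  (F.fiber s).toQuotient hp (hX.of_hom (f.fiberι s))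

/-- The comparison morphism `φ_s : X_s/ℱ_s ⟶ (X/ℱ)_s`, through which `X_s ⟶ (X/ℱ)_s` factors. -/
def comparison : F.fiberQuotient hp hX s ⟶ (F.quotientToBase hp hX).fiber s :=
  (F.invariant_fiberMap hp hX s).desc hp (hX.of_hom (f.fiberι s))

lemma toFiberQuotient_comparison :
    F.toFiberQuotient hp hX s ≫ F.comparison hp hX s = F.fiberMap hp hX s :=
  (F.invariant_fiberMap hp hX s).toQuotient_desc _ _

end comparison

end TangentSubsheaf

/-- A scheme is normal if all its local rings are integrally closed domains. -/
def IsNormalScheme : ObjectProperty Scheme.{u} := fun X ↦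
  ∀ x : X, IsDomain (X.presheaf.stalk x) ∧ IsIntegrallyClosed (X.presheaf.stalk x)

/-- A scheme is regular if all its local rings are regular. -/
def IsRegularScheme (X : Scheme.{u}) : Prop :=
  ∀ x : X, IsRegularLocalRing (X.presheaf.stalk x)

/-- A scheme of characteristic `p` is `F`-finite if its absolute Frobenius is a finite morphism:
the ring of sections over each affine open is a finite module over its subring of `p`-th powers. -/
def IsFFiniteScheme (p : ℕ) (X : Scheme.{u}) : Prop :=
  ∀ U : X.Opens, IsAffineOpen U →
    Module.Finite (Subring.closure (Set.range fun a : Γ(X, U) ↦ a ^ p)) Γ(X, U)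

/-- Flatness of a `B`-module over `R`, along a ring map `R → B`. -/
def FlatAlong {R B : Type*} [CommRing R] [CommRing B] (φ : R →+* B) (M : Type*)
    [AddCommGroup M] [Module B M] : Prop :=
  letI : Module R M := Module.compHom M φ
  Module.Flat R M

/-- Serre's condition `S_k` for a Noetherian ring: `depth R_P ≥ min (k, dim R_P)` for all primes
`P`, where the depth of a local ring is the maximal length of a regular sequence in its maximal
ideal. -/
def SerreCondition (k : ℕ) (R : Type*) [CommRing R] : Prop :=
  ∀ (P : Ideal R) [P.IsPrime], ∀ n : ℕ, n ≤ k →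
    (n : WithBot ℕ∞) ≤ ringKrullDim (Localization.AtPrime P) →
      ∃ l : List (Localization.AtPrime P), l.length = n ∧
        (∀ a ∈ l, a ∈ IsLocalRing.maximalIdeal (Localization.AtPrime P)) ∧
        RingTheory.Sequence.IsRegular (Localization.AtPrime P) l

/-- `φ : Y ⟶ Z` is an isomorphism at `y` if it is an isomorphism over an open neighbourhood of
`φ(y)`. -/
def IsIsoAt {Y Z : Scheme.{u}} (φ : Y ⟶ Z) (y : Y) : Prop :=
  ∃ V : Z.Opens, φ y ∈ V ∧ IsIso (φ ∣_ V)

/-- `φ : Y ⟶ Z` is an isomorphism in codimension one if it is an isomorphism over an open subset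
of `Z` that contains all points of codimension at most one. -/
def IsIsoInCodimensionOne {Y Z : Scheme.{u}} (φ : Y ⟶ Z) : Prop :=
  ∃ V : Z.Opens, (∀ z : Z, ringKrullDim (Z.presheaf.stalk z) ≤ 1 → z ∈ V) ∧ IsIso (φ ∣_ V)

namespace TangentSubsheaf

variable {X S : Scheme.{u}} {f : X ⟶ S} (F : TangentSubsheaf f)

/-- `ℱ ⊆ T_{X/S}` is a `1`-foliation of rank `r` on the normal scheme `X` over `S` (used when `S`
is the spectrum of a field). -/
structure IsOneFoliation (p r : ℕ) : Prop where
  /-- `ℱ` is saturated: `T_{X/S} / ℱ` is torsion-free. -/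
  saturated (x : X) : ∀ a ∈ nonZeroDivisors (X.presheaf.stalk x), ∀ D ∈ tangentStalk f x,
    a • D ∈ F.stalk x → D ∈ F.stalk x
  /-- `ℱ` is closed under Lie brackets. -/
  lie_mem (x : X) : ∀ D ∈ F.stalk x, ∀ E ∈ F.stalk x, ⁅D, E⁆ ∈ F.stalk x
  /-- `ℱ` is closed under `p`-th powers. -/
  pow_mem (x : X) : ∀ D ∈ F.stalk x, ∃ E ∈ F.stalk x, ∀ a, E a = (⇑D)^[p] a
  /-- `ℱ` has rank `r` at the generic point of each component of `X`. -/
  rank (x : X) : ringKrullDim (X.presheaf.stalk x) = 0 →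
    Module.finrank (X.presheaf.stalk x) (F.stalk x) = r

/-- `(f : X ⟶ S, ℱ ⊆ T_{X/S})` is a family of `1`-foliations of rank `r`. -/
structure IsFamilyOfOneFoliations (p r : ℕ) : Prop where
  flat : Flat f
  locallyOfFiniteType : LocallyOfFiniteType f
  quasiCompact : QuasiCompact f
  /-- The fibres of `f` are geometrically normal. -/
  geometricallyNormal : geometrically IsNormalScheme f
  /-- `f_* 𝒪_X = 𝒪_S`. -/
  isIso_app (V : S.Opens) : IsIso (f.app V)
  /-- `T_{X/S}` is flat over `S`. -/
  flat_tangent (x : X) : FlatAlong (f.stalkMap x).hom (tangentStalk f x)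
  /-- The natural map `T_{X/S} ⊗ k(s) ⟶ T_{X_s/k(s)}` is surjective. -/
  tangent_surjective (s : S) (x : f.fiber s) :
    ∀ E ∈ tangentStalk (f.fiberToSpecResidueField s) x, ∃ D ∈ tangentStalk f (f.fiberι s x),
      DerivationCompatible ((f.fiberι s).stalkMap x).hom D E
  /-- The natural map `T_{X/S} ⊗ k(s) ⟶ T_{X_s/k(s)}` is injective. -/
  tangent_injective (s : S) (x : f.fiber s) : ∀ D ∈ tangentStalk f (f.fiberι s x),
    DerivationCompatible ((f.fiberι s).stalkMap x).hom D 0 →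
      D ∈ (IsLocalRing.maximalIdeal (S.presheaf.stalk (f (f.fiberι s x)))).map
        (f.stalkMap (f.fiberι s x)).hom • tangentStalk f (f.fiberι s x)
  /-- `T_{X/S} / ℱ` is flat over `S`. -/
  flat_quotient (x : X) : FlatAlong (f.stalkMap x).hom
    (tangentStalk f x ⧸ (F.stalk x).submoduleOf (tangentStalk f x))
  /-- Each `ℱ_s ⊆ T_{X_s/k(s)}` is a `1`-foliation of rank `r`. -/
  fiber (s : S) : (F.fiber s).IsOneFoliation p r

end TangentSubsheaf

end AlgebraicGeometry

end

open AlgebraicGeometry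

section regular

open IsLocalRing

lemma IsRegularLocalRing.exists_mem_maximalIdeal_avoiding (R : Type*) [CommRing R]
    [IsRegularLocalRing R] (h0 : maximalIdeal R ≠ ⊥) (hdim : ringKrullDim R ≠ 0) :
    ∃ x ∈ maximalIdeal R, x ∉ maximalIdeal R ^ 2 ∧ ∀ P ∈ minimalPrimes R, x ∉ P := by
  classical
  by_contra! H
  have hfin := minimalPrimes.finite_of_isNoetherianRing R
  have hsub : (maximalIdeal R : Set R) ⊆
      ⋃ i ∈ ((insert (maximalIdeal R ^ 2) hfin.toFinset : Finset (Ideal R)) : Set (Ideal R)),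
        ((id i : Ideal R) : Set R) := by
    intro x hx
    by_cases hx2 : x ∈ maximalIdeal R ^ 2
    · exact Set.mem_biUnion (Finset.mem_insert_self _ _) hx2
    · obtain ⟨P, hP, hxP⟩ := H x hx hx2
      exact Set.mem_biUnion (Finset.mem_insert_of_mem (hfin.mem_toFinset.mpr hP)) hxP
  rw [Ideal.subset_union_prime (maximalIdeal R ^ 2) (maximalIdeal R ^ 2)] at hsub
  · obtain ⟨I, hI, hle⟩ := hsub
    rcases Finset.mem_insert.mp hI with rfl | hI
    · apply h0
      apply Submodule.eq_bot_of_le_smul_of_le_jacobson_bot (maximalIdeal R) _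
        (IsNoetherian.noetherian _)
      · rwa [smul_eq_mul, ← pow_two]
      · rw [jacobson_eq_maximalIdeal _ bot_ne_top]
    · have hP := hfin.mem_toFinset.mp hI
      have hPp : I.IsPrime := Ideal.IsMinimalPrime.isPrime hP
      have : I = maximalIdeal R := le_antisymm (le_maximalIdeal hPp.ne_top) hle
      subst this
      apply hdim
      rw [← maximalIdeal_height_eq_ringKrullDim]
      have := Ideal.height_eq_zero_iff.mpr hP
      simp [this]
  · intro i hi h1 _
    rcases Finset.mem_insert.mp hi with rfl | hi
    · exact absurd rfl h1
    · exact Ideal.IsMinimalPrime.isPrime (hfin.mem_toFinset.mp hi)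

lemma IsRegularLocalRing.spanFinrank_maximalIdeal_quotient_le (R : Type*) [CommRing R]
    [IsLocalRing R] [IsNoetherianRing R] {x : R} (hx : x ∈ maximalIdeal R)
    (hx2 : x ∉ maximalIdeal R ^ 2) [IsLocalRing (R ⧸ Ideal.span {x})] :
    (maximalIdeal (R ⧸ Ideal.span {x})).spanFinrank + 1 ≤ (maximalIdeal R).spanFinrank := by
  classical
  obtain ⟨s, hcard, hs⟩ := Submodule.FG.exists_span_finset_card_eq_spanFinrank
    (IsNoetherian.noetherian (maximalIdeal R))
  have hxs := hx
  rw [← hs, Submodule.mem_span_finset] at hxs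
  obtain ⟨a, -, ha⟩ := hxs
  have hsm (i) (hi : i ∈ s) : i ∈ maximalIdeal R := by
    rw [← hs]; exact Submodule.subset_span hi
  obtain ⟨j, hj, hu⟩ : ∃ j ∈ s, IsUnit (a j) := by
    by_contra! H
    apply hx2
    rw [← ha, pow_two]
    exact Ideal.sum_mem _ fun i hi ↦
      Ideal.mul_mem_mul ((mem_maximalIdeal _).mpr (H i hi)) (hsm i hi)
  have hgen : maximalIdeal (R ⧸ Ideal.span {x}) =
      Ideal.span ((s.erase j).image (Ideal.Quotient.mk (Ideal.span {x})) : Set _) := by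
    have h1 : maximalIdeal (R ⧸ Ideal.span {x}) =
        (maximalIdeal R).map (Ideal.Quotient.mk (Ideal.span {x})) :=
      (map_maximalIdeal_of_surjective _ Ideal.Quotient.mk_surjective).symm
    rw [h1]
    apply le_antisymm
    · have hs' : maximalIdeal R = Ideal.span s := hs.symm
      rw [hs', Ideal.map_span, Ideal.span_le]
      rintro _ ⟨i, hi, rfl⟩
      by_cases hij : i = j
      · subst hij
        have h2 : (Ideal.Quotient.mk (Ideal.span {x})) (a i * i) =
            - ∑ l ∈ s.erase i, Ideal.Quotient.mk (Ideal.span {x}) (a l * l) := by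
          have h3 : Ideal.Quotient.mk (Ideal.span {x}) x = 0 :=
            Ideal.Quotient.eq_zero_iff_mem.mpr (Ideal.mem_span_singleton_self x)
          have h4 := congr_arg (Ideal.Quotient.mk (Ideal.span {x})) ha
          rw [← Finset.add_sum_erase _ _ hj, h3] at h4
          simp only [map_add, map_sum, smul_eq_mul] at h4
          exact eq_neg_of_add_eq_zero_left h4
        rw [map_mul] at h2
        refine (Ideal.unit_mul_mem_iff_mem _ (hu.map (Ideal.Quotient.mk (Ideal.span {x})))).mp ?_
        rw [h2]
        refine neg_mem (Ideal.sum_mem _ fun l hl ↦ ?_)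
        rw [map_mul]
        exact Ideal.mul_mem_left _ _
          (Ideal.subset_span (Finset.mem_coe.mpr (Finset.mem_image_of_mem _ hl)))
      · exact Ideal.subset_span (Finset.mem_coe.mpr (Finset.mem_image_of_mem _
          (Finset.mem_erase.mpr ⟨hij, hi⟩)))
    · rw [Ideal.span_le]
      intro y hy
      obtain ⟨i, hi, rfl⟩ := Finset.mem_image.mp (Finset.mem_coe.mp hy)
      exact Ideal.mem_map_of_mem _ (hsm i (Finset.mem_of_mem_erase hi))
  rw [hgen, ← hcard]
  refine (Nat.add_le_add_right (Submodule.spanFinrank_span_le_ncard_of_finite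
    (Finset.finite_toSet _)) 1).trans ?_
  rw [Set.ncard_coe_finset]
  have := Finset.card_image_le (s := s.erase j) (f := Ideal.Quotient.mk (Ideal.span {x}))
  rw [Finset.card_erase_of_mem hj] at this
  have := Finset.card_pos.mpr ⟨j, hj⟩
  omega

/-- A regular local ring is a domain. -/
theorem IsRegularLocalRing.isDomain (R : Type*) [CommRing R] [IsRegularLocalRing R] :
    IsDomain R := by
  obtain ⟨n, hn⟩ : ∃ n, (maximalIdeal R).spanFinrank = n := ⟨_, rfl⟩
  induction n generalizing R with
  | zero =>
    rw [Submodule.spanFinrank_eq_zero_iff_eq_bot (IsNoetherian.noetherian _)] at hn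
    exact (isField_iff_maximalIdeal_eq.mpr hn).isDomain
  | succ n ih =>
    have hdim : ringKrullDim R = (n + 1 : ℕ) := by
      rw [← IsRegularLocalRing.spanFinrank_maximalIdeal, hn]
    obtain ⟨x, hx, hx2, hxP⟩ := exists_mem_maximalIdeal_avoiding R
      (fun h ↦ by simp [h] at hn) (by rw [hdim]; exact_mod_cast n.succ_ne_zero)
    have hne : Ideal.span {x} ≠ ⊤ := fun h ↦ (maximalIdeal.isMaximal R).ne_top
      (top_le_iff.mp (h ▸ (Ideal.span_singleton_le_iff_mem _).mpr hx))
    have : Nontrivial (R ⧸ Ideal.span {x}) := Ideal.Quotient.nontrivial_iff.mpr hne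
    have : IsLocalRing (R ⧸ Ideal.span {x}) :=
      .of_surjective' (Ideal.Quotient.mk (Ideal.span {x})) Ideal.Quotient.mk_surjective
    have h1 := spanFinrank_maximalIdeal_quotient_le R hx hx2
    rw [hn] at h1
    have h2 := ringKrullDim_le_ringKrullDim_quotient_add_encard {x}
      (Set.singleton_subset_iff.mpr (by rwa [IsLocalRing.ringJacobson_eq_maximalIdeal]))
    rw [hdim, Set.encard_singleton] at h2
    have h3 := ringKrullDim_le_spanFinrank_maximalIdeal (R ⧸ Ideal.span {x})
    have hreg : IsRegularLocalRing (R ⧸ Ideal.span {x}) := by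
      apply IsRegularLocalRing.of_spanFinrank_maximalIdeal_le
      generalize ringKrullDim (R ⧸ Ideal.span {x}) = d at h2 h3 ⊢
      refine le_trans (b := (n : WithBot ℕ∞)) (by exact_mod_cast (by omega)) ?_
      cases d with
      | bot => simp at h2
      | coe d =>
        cases d with
        | top => simp
        | coe d => norm_cast at h2 ⊢; omega
    have hn' : (maximalIdeal (R ⧸ Ideal.span {x})).spanFinrank = n := by
      have h4 := IsRegularLocalRing.spanFinrank_maximalIdeal (R := R ⧸ Ideal.span {x})
      rw [← h4] at h2
      norm_cast at h2
      omega
    have hdom := ih (R ⧸ Ideal.span {x}) hn'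
    have hprime : (Ideal.span {x}).IsPrime := Ideal.Quotient.isDomain_iff_prime _ |>.mp hdom
    obtain ⟨P, hP, hPx⟩ := Ideal.exists_minimalPrimes_le (bot_le (a := Ideal.span {x}))
    have hPp : P.IsPrime := hP.isPrime
    have hP0 : P = ⊥ := by
      apply Submodule.eq_bot_of_le_smul_of_le_jacobson_bot (maximalIdeal R) _
        (IsNoetherian.noetherian _)
      · intro y hy
        obtain ⟨z, rfl⟩ := Ideal.mem_span_singleton'.mp (hPx hy)
        have hz : z ∈ P := (hPp.mem_or_mem hy).resolve_right (hxP P hP)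
        rw [mul_comm]
        exact Submodule.smul_mem_smul hx hz
      · rw [jacobson_eq_maximalIdeal _ bot_ne_top]
    subst hP0
    exact IsDomain.of_bot_isPrime R

end regular

section projection

variable {B : Type*} [CommRing B] {p : ℕ}

lemma Derivation.iterate_add (D : Derivation ℤ B B) (n : ℕ) (a b : B) :
    (⇑D)^[n] (a + b) = (⇑D)^[n] a + (⇑D)^[n] b :=
  iterate_map_add D n a b

lemma Derivation.iterate_pow_self (D : Derivation ℤ B B) {t : B} (ht : D t = 1) (n : ℕ) :
    (⇑D)^[n] (t ^ n) = (n.factorial : B) := by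
  induction n with
  | zero => simp
  | succ n ih =>
    rw [Function.iterate_succ_apply, Derivation.leibniz_pow, ht, smul_eq_mul, mul_one,
      Nat.add_sub_cancel, iterate_map_nsmul, ih, Nat.factorial_succ, nsmul_eq_mul, Nat.cast_mul]

/-- If `D b` lies in a `D`-stable ideal `I`, then `b` is a constant for `D` modulo `I`. -/
lemma Derivation.iterate_mul_sub_mem (D : Derivation ℤ B B) (I : Ideal B)
    (hI : ∀ x ∈ I, D x ∈ I) {b : B} (hb : D b ∈ I) (y : B) (n : ℕ) :
    (⇑D)^[n] (y * b) - (⇑D)^[n] y * b ∈ I := by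
  induction n with
  | zero => simp
  | succ n ih =>
    rw [Function.iterate_succ_apply', Function.iterate_succ_apply']
    have h1 := hI _ ih
    rw [map_sub, Derivation.leibniz, smul_eq_mul, smul_eq_mul] at h1
    have h2 := add_mem h1 (I.mul_mem_left ((⇑D)^[n] y) hb)
    convert h2 using 1
    ring

lemma Nat.cast_factorial_pred_eq_neg_one [Fact p.Prime] (h : (p : B) = 0) :
    (((p - 1).factorial : ℕ) : B) = -1 := by
  have h1 : ((((p - 1).factorial + 1 : ℕ)) : ZMod p) = 0 := by
    rw [Nat.cast_add, ZMod.wilsons_lemma]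
    simp
  obtain ⟨c, hc⟩ := (ZMod.natCast_eq_zero_iff _ _).mp h1
  have h2 := congr_arg (Nat.cast : ℕ → B) hc
  rw [Nat.cast_mul, h, zero_mul, Nat.cast_add, Nat.cast_one] at h2
  exact eq_neg_of_add_eq_zero_left h2

/-- The projection `b ↦ -D^{p-1}(t^{p-1} b)` onto the constants of a derivation `D` with
`D^p = 0` and `D t = 1`. -/
def Derivation.constantsProjection (p : ℕ) (D : Derivation ℤ B B) (t : B) : B →+ B where
  toFun b := -(⇑D)^[p - 1] (t ^ (p - 1) * b)
  map_zero' := by simp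
  map_add' a b := by rw [mul_add, D.iterate_add, neg_add]

lemma Derivation.constantsProjection_apply (D : Derivation ℤ B B) (t b : B) :
    D.constantsProjection p t b = -(⇑D)^[p - 1] (t ^ (p - 1) * b) := rfl

lemma Derivation.map_constantsProjection [hp : Fact p.Prime] (D : Derivation ℤ B B)
    (hD : ∀ b, (⇑D)^[p] b = 0)
    (t b : B) : D (D.constantsProjection p t b) = 0 := by
  rw [constantsProjection_apply, map_neg, ← Function.iterate_succ_apply' D,
    Nat.succ_eq_add_one, Nat.sub_add_cancel hp.out.one_le, hD, neg_zero]

lemma Derivation.constantsProjection_sub_mem [Fact p.Prime] (hpB : (p : B) = 0)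
    (D : Derivation ℤ B B) {t : B}
    (ht : D t = 1) (I : Ideal B) (hI : ∀ x ∈ I, D x ∈ I) {b : B} (hb : D b ∈ I) :
    D.constantsProjection p t b - b ∈ I := by
  have h1 := D.iterate_mul_sub_mem I hI hb (t ^ (p - 1)) (p - 1)
  rw [D.iterate_pow_self ht, Nat.cast_factorial_pred_eq_neg_one hpB] at h1
  have h2 := neg_mem h1
  rw [constantsProjection_apply]
  convert h2 using 1
  ring

lemma Derivation.constantsProjection_mul (D : Derivation ℤ B B) (t : B) {a : B} (ha : D a = 0)
    (b : B) : D.constantsProjection p t (a * b) = a * D.constantsProjection p t b := by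
  have h1 := D.iterate_mul_sub_mem ⊥ (fun x hx ↦ by
    rw [(Submodule.mem_bot B).mp hx, map_zero]; exact zero_mem _) (b := a)
    (by rw [ha]; exact zero_mem _) (t ^ (p - 1) * b) (p - 1)
  rw [Submodule.mem_bot, sub_eq_zero] at h1
  rw [constantsProjection_apply, constantsProjection_apply, mul_comm a b, ← mul_assoc, h1]
  ring

lemma Derivation.constantsProjection_comm (D E : Derivation ℤ B B)
    (hc : ∀ b, E (D b) = D (E b)) {t : B} (ht : E t = 0) (b : B) :
    E (D.constantsProjection p t b) = D.constantsProjection p t (E b) := by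
  have h (n : ℕ) (b : B) : E ((⇑D)^[n] b) = (⇑D)^[n] (E b) := by
    induction n with
    | zero => rfl
    | succ n ih => rw [Function.iterate_succ_apply', hc, ih, Function.iterate_succ_apply']
  rw [constantsProjection_apply, constantsProjection_apply, map_neg, h, Derivation.leibniz,
    Derivation.leibniz_pow, ht]
  simp

/-- Projection onto the common constants of finitely many commuting derivations `D i` with
`(D i)^p = 0` that are dual to a system of elements `t j`. -/
lemma Derivation.exists_constantsProjection {ι : Type*} [DecidableEq ι] [Fact p.Prime]
    (hpB : (p : B) = 0)
    (D : ι → Derivation ℤ B B) (t : ι → B) (ht : ∀ i j, D i (t j) = if i = j then 1 else 0)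
    (hc : ∀ i j b, D i (D j b) = D j (D i b)) (hD : ∀ i b, (⇑(D i))^[p] b = 0) (s : Finset ι) :
    ∃ E : B →+ B, (∀ i ∈ s, ∀ b, D i (E b) = 0) ∧
      (∀ a b, (∀ i ∈ s, D i a = 0) → E (a * b) = a * E b) ∧
      (∀ I : Ideal B, (∀ i ∈ s, ∀ x ∈ I, D i x ∈ I) → ∀ b, (∀ i ∈ s, D i b ∈ I) → E b - b ∈ I) ∧
      ∀ j ∉ s, ∀ b, D j (E b) = E (D j b) := by
  induction s using Finset.induction_on with
  | empty => exact ⟨AddMonoidHom.id B, by simp, by simp, by simp, by simp⟩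
  | insert j s hj ih =>
    obtain ⟨E, h1, h2, h3, h4⟩ := ih
    have hij {i} (h : i ≠ j) (b : B) := (D j).constantsProjection_comm (p := p) (D i) (hc i j)
      ((ht i j).trans (if_neg h)) b
    refine ⟨((D j).constantsProjection p (t j)).comp E, ?_, ?_, ?_, ?_⟩
    · intro i hi b
      by_cases h : i = j
      · subst h
        exact (D i).map_constantsProjection (hD i) (t i) (E b)
      · exact (hij h _).trans (by rw [h1 i (Finset.mem_of_mem_insert_of_ne hi h), map_zero])
    · intro a b ha
      change (D j).constantsProjection p (t j) (E (a * b)) = _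
      rw [h2 a b fun i hi ↦ ha i (Finset.mem_insert_of_mem hi),
        (D j).constantsProjection_mul (t j) (ha j (Finset.mem_insert_self _ _))]
      rfl
    · intro I hI b hb
      have hI' := fun i hi ↦ hI i (Finset.mem_insert_of_mem hi)
      have h5 : E (D j b) ∈ I := by
        have hjb := hb j (Finset.mem_insert_self _ _)
        have := h3 I hI' (D j b) fun i hi ↦ hI' i hi _ hjb
        simpa using add_mem this hjb
      have h6 := (D j).constantsProjection_sub_mem hpB ((ht j j).trans (if_pos rfl)) I
        (hI j (Finset.mem_insert_self _ _)) (b := E b) (by rwa [h4 j hj])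
      have h7 := h3 I hI' b fun i hi ↦ hb i (Finset.mem_insert_of_mem hi)
      simpa using add_mem h6 h7
    · intro i hi b
      have h : i ≠ j := fun h ↦ hi (h ▸ Finset.mem_insert_self _ _)
      refine (hij h _).trans ?_
      rw [h4 i fun h ↦ hi (Finset.mem_insert_of_mem h)]
      rfl

end projection

namespace AlgebraicGeometry

section serre

open IsLocalRing

open scoped Pointwise in
lemma isSMulRegular_quotSMulTop_self_iff {R : Type*} [CommRing R] (a b : R) :
    IsSMulRegular (QuotSMulTop a R) b ↔ ∀ y, a ∣ b * y → a ∣ y := by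
  have hmem (y : R) : y ∈ a • (⊤ : Submodule R R) ↔ a ∣ y := by
    rw [Submodule.mem_smul_pointwise_iff_exists]
    exact ⟨fun ⟨z, _, hz⟩ ↦ ⟨z, hz.symm⟩, fun ⟨z, hz⟩ ↦ ⟨z, trivial, hz.symm⟩⟩
  rw [isSMulRegular_iff_right_eq_zero_of_smul]
  constructor
  · intro h y hy
    rw [← hmem, ← Submodule.Quotient.mk_eq_zero]
    apply h
    rwa [← Submodule.Quotient.mk_smul, Submodule.Quotient.mk_eq_zero, hmem, smul_eq_mul]
  · intro h y
    obtain ⟨y, rfl⟩ := Submodule.Quotient.mk_surjective _ y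
    rw [← Submodule.Quotient.mk_smul, Submodule.Quotient.mk_eq_zero,
      Submodule.Quotient.mk_eq_zero, hmem, hmem]
    exact h y

open scoped Pointwise in
/-- In a Noetherian normal local domain of dimension at least two, every nonzero nonunit is the
beginning of a regular sequence of length two. -/
lemma exists_isSMulRegular_quotSMulTop_of_isIntegrallyClosed {R : Type*} [CommRing R] [IsDomain R]
    [IsLocalRing R] [IsNoetherianRing R] [IsIntegrallyClosed R] (hdim : 2 ≤ ringKrullDim R)
    {a : R} (ha : a ∈ maximalIdeal R) (ha0 : a ≠ 0) :
    ∃ b ∈ maximalIdeal R, IsSMulRegular (QuotSMulTop a R) b := by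
  by_contra! H
  -- The maximal ideal is associated to `R / a`.
  have hsub : (maximalIdeal R : Set R) ⊆ ⋃ P ∈ ((associatedPrimes.finite R
      (QuotSMulTop a R)).toFinset : Set (Ideal R)), ((id P : Ideal R) : Set R) := by
    intro b hb
    have h1 := H b hb
    rw [isSMulRegular_iff_right_eq_zero_of_smul] at h1
    push Not at h1
    obtain ⟨y, hy, hy0⟩ := h1
    obtain ⟨P, hP, hle⟩ := exists_le_isAssociatedPrime_of_isNoetherianRing R y hy0
    refine Set.mem_biUnion (x := P) ((Set.Finite.mem_toFinset _).mpr hP) (hle ?_)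
    rwa [Submodule.mem_colon_singleton, Submodule.mem_bot]
  rw [Ideal.subset_union_prime (f := id) ⊥ ⊥ fun P hP _ _ ↦
    ((associatedPrimes.finite R (QuotSMulTop a R)).mem_toFinset.mp hP).isPrime] at hsub
  obtain ⟨P, hP, hle⟩ := hsub
  rw [Set.Finite.mem_toFinset] at hP
  have hPm : P = maximalIdeal R := le_antisymm (le_maximalIdeal hP.isPrime.ne_top) hle
  subst hPm
  obtain ⟨-, y, hy⟩ := isAssociatedPrime_iff.mp hP
  obtain ⟨b, rfl⟩ := Submodule.Quotient.mk_surjective _ y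
  have hmem (y : R) : y ∈ a • (⊤ : Submodule R R) ↔ a ∣ y := by
    rw [Submodule.mem_smul_pointwise_iff_exists]
    exact ⟨fun ⟨z, _, hz⟩ ↦ ⟨z, hz.symm⟩, fun ⟨z, hz⟩ ↦ ⟨z, trivial, hz.symm⟩⟩
  have hann (m : R) : m ∈ maximalIdeal R ↔ a ∣ m * b := by
    rw [hy, Submodule.mem_colon_singleton, Submodule.mem_bot, ← Submodule.Quotient.mk_smul,
      Submodule.Quotient.mk_eq_zero, hmem, smul_eq_mul]
  have hb : ¬ a ∣ b := fun h ↦ by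
    have := (hann 1).mpr (by rwa [one_mul])
    exact (Ideal.ne_top_iff_one _).mp (maximalIdeal.isMaximal R).ne_top this
  let K := FractionRing R
  let x : K := algebraMap R K b / algebraMap R K a
  have ha3 : algebraMap R K a ≠ 0 := IsFractionRing.to_map_eq_zero_iff.not.mpr ha0
  let M := Submodule.map (Algebra.linearMap R K) (maximalIdeal R)
  have hk (m k : R) (h : m * b = a * k) : x * algebraMap R K m = algebraMap R K k := by
    rw [← mul_div_right_comm, ← map_mul, mul_comm, h, map_mul, mul_div_cancel_left₀ _ ha3]
  by_cases hx : ∀ y ∈ M, x * y ∈ M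
  · have hint : _root_.IsIntegral R x := by
      refine isIntegral_of_smul_mem_submodule M ?_ ?_ x hx
      · rw [Submodule.ne_bot_iff]
        exact ⟨_, ⟨a, ha, rfl⟩, ha3⟩
      · exact Submodule.FG.map _ (IsNoetherian.noetherian _)
    obtain ⟨y, e⟩ := IsIntegrallyClosed.algebraMap_eq_of_integral hint
    apply hb
    refine ⟨y, IsFractionRing.injective R K ?_⟩
    rw [map_mul, e, mul_div_cancel₀ _ ha3]
  · push Not at hx
    obtain ⟨_, ⟨t, ht, rfl⟩, hxt⟩ := hx
    obtain ⟨u, hu⟩ := (hann t).mp ht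
    have hunit : IsUnit u := by
      by_contra hnu
      exact hxt ⟨u, (mem_maximalIdeal _).mpr hnu, (hk t u hu).symm⟩
    have hprin : maximalIdeal R = Ideal.span {t} := by
      apply le_antisymm
      · intro m hm
        obtain ⟨k, hk⟩ := (hann m).mp hm
        rw [Ideal.mem_span_singleton]
        obtain ⟨v, hv⟩ := hunit.exists_right_inv
        refine ⟨k * v, ?_⟩
        have h0 : a * (m * u) = a * (t * k) := by
          calc a * (m * u) = m * (t * b) := by rw [hu]; ring
            _ = t * (m * b) := by ring
            _ = a * (t * k) := by rw [hk]; ring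
        have h1 := mul_left_cancel₀ ha0 h0
        calc m = m * (u * v) := by rw [hv, mul_one]
          _ = t * (k * v) := by rw [← mul_assoc, h1]; ring
      · rwa [Ideal.span_singleton_le_iff_mem]
    have h1 : (maximalIdeal R).height ≤ 1 := by
      have : (maximalIdeal R).IsPrincipal := ⟨t, hprin⟩
      exact Ideal.height_le_one_of_isPrincipal_of_mem_minimalPrimes (maximalIdeal R) _
        (by rw [Ideal.minimalPrimes_eq_subsingleton_self]; rfl)
    rw [← maximalIdeal_height_eq_ringKrullDim] at hdim
    have h2 : (2 : ℕ∞) ≤ 1 := le_trans (WithBot.coe_le_coe.mp hdim) h1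
    norm_num at h2

/-- A Noetherian normal domain satisfies `S₂`. -/
theorem SerreCondition.two_of_isIntegrallyClosed (R : Type*) [CommRing R] [IsDomain R]
    [IsNoetherianRing R] [IsIntegrallyClosed R] : SerreCondition 2 R := by
  intro P _ n hn hdim
  have : IsNoetherianRing (Localization.AtPrime P) :=
    IsLocalization.isNoetherianRing P.primeCompl _ inferInstance
  have : IsIntegrallyClosed (Localization.AtPrime P) :=
    isIntegrallyClosed_of_isLocalization _ P.primeCompl P.primeCompl_le_nonZeroDivisors
  have : IsDomain (Localization.AtPrime P) :=
    IsLocalization.isDomain_localization P.primeCompl_le_nonZeroDivisors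
  suffices ∀ (L : Type _) [CommRing L] [IsDomain L] [IsLocalRing L] [IsNoetherianRing L]
      [IsIntegrallyClosed L], (n : WithBot ℕ∞) ≤ ringKrullDim L →
      ∃ l : List L, l.length = n ∧ (∀ a ∈ l, a ∈ IsLocalRing.maximalIdeal L) ∧
        RingTheory.Sequence.IsRegular L l from this _ hdim
  intro L _ _ _ _ _ hdim
  suffices ∃ l : List L, l.length = n ∧ (∀ a ∈ l, a ∈ IsLocalRing.maximalIdeal L) ∧
      RingTheory.Sequence.IsWeaklyRegular L l by
    obtain ⟨l, h1, h2, h3⟩ := this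
    exact ⟨l, h1, h2, .of_isWeaklyRegular_of_mem_maximalIdeal L h2 h3⟩
  have hnz (h1 : 1 ≤ n) : ∃ a ∈ maximalIdeal L, a ≠ 0 := by
    by_contra! h0
    have hfield : IsField L := isField_iff_maximalIdeal_eq.mpr (eq_bot_iff.mpr h0)
    rw [ringKrullDim_eq_zero_of_isField hfield] at hdim
    have : n ≤ 0 := by exact_mod_cast hdim
    omega
  interval_cases n
  · exact ⟨[], rfl, by simp, .nil _ _⟩
  · obtain ⟨a, ha, ha0⟩ := hnz le_rfl
    exact ⟨[a], rfl, by simpa using ha,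
      .cons ((IsRegular.of_ne_zero ha0).left.isSMulRegular) (.nil _ _)⟩
  · obtain ⟨a, ha, ha0⟩ := hnz one_le_two
    obtain ⟨b, hb, hab⟩ := exists_isSMulRegular_quotSMulTop_of_isIntegrallyClosed hdim ha ha0
    exact ⟨[a, b], rfl, by
      rintro x hx
      rcases List.mem_pair.mp hx with rfl | rfl <;> assumption,
      .cons ((IsRegular.of_ne_zero ha0).left.isSMulRegular) (.cons hab (.nil _ _))⟩

/-- Let `ψ : R → R'` be a ring map from a Noetherian ring satisfying `S₂` to a domain. If `ψ` is
bijective after localization at each prime of height at most one, then it is bijective. -/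
theorem SerreCondition.bijective_of_forall_ringKrullDim_le_one {R R' : Type*} [CommRing R]
    [IsNoetherianRing R] [CommRing R'] [IsDomain R'] (hS : SerreCondition 2 R) (ψ : R →+* R')
    (hinj : ∀ (P : Ideal R) [P.IsPrime], ringKrullDim (Localization.AtPrime P) ≤ 1 →
      ∀ a, ψ a = 0 → ∃ u ∉ P, u * a = 0)
    (hsurj : ∀ (P : Ideal R) [P.IsPrime], ringKrullDim (Localization.AtPrime P) ≤ 1 →
      ∀ b, ∃ u ∉ P, ∃ a, ψ u * b = ψ a) :
    Function.Bijective ψ := by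
  have two_le {d : WithBot ℕ∞} (h : ¬ d ≤ 1) : 2 ≤ d := by
    rw [not_le] at h
    cases d with
    | bot => simp at h
    | coe d =>
      have h2 : (1 : ℕ∞) < d := by exact_mod_cast h
      have h3 : (2 : ℕ∞) ≤ d := by
        have := Order.add_one_le_of_lt h2
        rwa [one_add_one_eq_two] at this
      exact WithBot.coe_le_coe.mpr h3
  have hψ : Function.Injective ψ := by
    rw [injective_iff_map_eq_zero]
    by_contra! H
    obtain ⟨a, ha, ha0⟩ := H
    obtain ⟨P, hP, -⟩ := exists_le_isAssociatedPrime_of_isNoetherianRing R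
      (⟨a, ha⟩ : RingHom.ker ψ) (fun h ↦ ha0 (congr_arg Subtype.val h))
    have := hP.isPrime
    obtain ⟨-, ⟨x, hx⟩, hPx⟩ := isAssociatedPrime_iff.mp hP
    have hann (m : R) : m ∈ P ↔ m * x = 0 := by
      rw [hPx, Submodule.mem_colon_singleton, Submodule.mem_bot, ← Subtype.coe_inj]
      rfl
    by_cases hdim : ringKrullDim (Localization.AtPrime P) ≤ 1
    · obtain ⟨u, hu, hux⟩ := hinj P hdim x hx
      exact hu ((hann u).mpr hux)
    · obtain ⟨l, hl, hlm, hreg⟩ := hS P 1 one_le_two (le_trans (by norm_num) (two_le hdim))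
      obtain ⟨c, rfl⟩ := List.length_eq_one_iff.mp hl
      rw [RingTheory.Sequence.isRegular_cons_iff] at hreg
      have hcm := hlm c (by simp)
      rw [← Localization.AtPrime.map_eq_maximalIdeal,
        IsLocalization.mem_map_algebraMap_iff P.primeCompl] at hcm
      obtain ⟨⟨⟨m, hm⟩, v⟩, hcv⟩ := hcm
      have h1 : c • algebraMap R (Localization.AtPrime P) x = 0 := by
        have hv := IsLocalization.map_units (Localization.AtPrime P) v
        rw [← hv.mul_left_inj, zero_mul, smul_eq_mul, mul_right_comm]
        simp only at hcv
        rw [hcv, ← map_mul, (hann m).mp hm, map_zero]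
      have h2 := isSMulRegular_iff_right_eq_zero_of_smul.mp hreg.1 _ h1
      rw [IsLocalization.map_eq_zero_iff P.primeCompl] at h2
      obtain ⟨u, hu⟩ := h2
      exact u.2 ((hann u).mpr hu)
  refine ⟨hψ, ?_⟩
  by_contra H
  let _ : Algebra R R' := ψ.toAlgebra
  let N : Submodule R R' := LinearMap.range (Algebra.linearMap R R')
  have hN (b : R') : b ∈ N ↔ ∃ a, ψ a = b := Iff.rfl
  rw [Function.Surjective] at H
  push Not at H
  obtain ⟨b, hb⟩ := H
  obtain ⟨P, hP, -⟩ := exists_le_isAssociatedPrime_of_isNoetherianRing R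
    (Submodule.Quotient.mk b : R' ⧸ N) (by
      rw [Ne, Submodule.Quotient.mk_eq_zero, hN]
      push Not
      exact hb)
  have := hP.isPrime
  obtain ⟨-, y, hPy⟩ := isAssociatedPrime_iff.mp hP
  obtain ⟨w, rfl⟩ := Submodule.Quotient.mk_surjective _ y
  have hann (m : R) : m ∈ P ↔ ∃ a, ψ a = ψ m * w := by
    rw [hPy, Submodule.mem_colon_singleton, Submodule.mem_bot, ← Submodule.Quotient.mk_smul,
      Submodule.Quotient.mk_eq_zero, hN, Algebra.smul_def]
    rfl
  by_cases hdim : ringKrullDim (Localization.AtPrime P) ≤ 1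
  · obtain ⟨u, hu, a, ha⟩ := hsurj P hdim w
    exact hu ((hann u).mpr ⟨a, ha.symm⟩)
  · obtain ⟨l, hl, hlm, hreg⟩ := hS P 2 le_rfl (two_le hdim)
    obtain ⟨c, d, rfl⟩ := List.length_eq_two.mp hl
    rw [RingTheory.Sequence.isRegular_cons_iff, RingTheory.Sequence.isRegular_cons_iff] at hreg
    have hnum (c : Localization.AtPrime P) (hcm : c ∈ maximalIdeal _) :
        ∃ m ∈ P, ∃ v : P.primeCompl, c * algebraMap _ _ v.1 = algebraMap _ _ m := by
      rw [← Localization.AtPrime.map_eq_maximalIdeal,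
        IsLocalization.mem_map_algebraMap_iff P.primeCompl] at hcm
      obtain ⟨⟨⟨m, hm⟩, v⟩, hcv⟩ := hcm
      exact ⟨m, hm, v, hcv⟩
    obtain ⟨m, hm, v, hmv⟩ := hnum c (hlm c (by simp))
    obtain ⟨n, hn, u, hnu⟩ := hnum d (hlm d (by simp))
    obtain ⟨e, he⟩ := (hann m).mp hm
    obtain ⟨g, hg⟩ := (hann n).mp hn
    have hrel : n * e = m * g := by
      apply hψ
      rw [map_mul, map_mul, he, hg]
      ring
    let α := algebraMap R (Localization.AtPrime P)
    have hvu := IsLocalization.map_units (Localization.AtPrime P) v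
    have huu := IsLocalization.map_units (Localization.AtPrime P) u
    have hce : c ∣ d * α e := by
      have h1 : c ∣ d * α e * α u := by
        refine ⟨α v * α g, ?_⟩
        calc d * α e * α u = (d * α u) * α e := by ring
          _ = α (n * e) := by rw [map_mul]; exact congr_arg (· * α e) hnu
          _ = (c * α v) * α g := by rw [hrel, map_mul]; exact congr_arg (· * α g) hmv.symm
          _ = c * (α v * α g) := by ring
      exact (huu.dvd_mul_right).mp h1
    have hc := (isSMulRegular_quotSMulTop_self_iff c d).mp hreg.2.1 _ hce
    have hm0 : m ≠ 0 := by
      rintro rfl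
      have h0 : c = 0 := by
        rw [map_zero] at hmv
        exact (hvu.mul_left_eq_zero).mp hmv
      have := isSMulRegular_iff_right_eq_zero_of_smul.mp hreg.1 1 (by simp [h0])
      exact one_ne_zero this
    obtain ⟨q, hq⟩ := hc
    obtain ⟨⟨q', t⟩, hqt⟩ := IsLocalization.surj P.primeCompl q
    simp only at hqt
    -- In `R_P`, the element `v t e` agrees with `m q'`.
    have h2 : α (v * t * e) = α (m * q') := by
      rw [map_mul, map_mul, map_mul]
      calc α v * α t * α e = (c * α v) * (q * α t) := by rw [hq]; ring
        _ = α m * α q' := by rw [show q * α t = α q' from hqt, show c * α v = α m from hmv]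
    rw [IsLocalization.eq_iff_exists P.primeCompl] at h2
    obtain ⟨z, hz⟩ := h2
    have h3 : ψ (z * v * t) * w = ψ (z * q') := by
      have hψm : ψ m ≠ 0 := fun h ↦ hm0 (hψ (h.trans (map_zero ψ).symm))
      apply mul_left_cancel₀ hψm
      calc ψ m * (ψ (z * v * t) * w) = ψ (z * v * t) * (ψ m * w) := by ring
        _ = ψ (z * (v * t * e)) := by rw [← he, ← map_mul]; congr 1; ring
        _ = ψ m * ψ (z * q') := by rw [hz, ← map_mul]; congr 1; ring
    exact (z * v * t).2 ((hann _).mpr ⟨_, h3.symm⟩)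

/-- Let `B` be Noetherian and flat over a domain `A`. An element of `B` that vanishes in the
localization of `B` at every prime that contracts to zero in `A` is zero. -/
lemma eq_zero_of_forall_prime_comap_eq_bot {A B : Type*} [CommRing A] [IsDomain A] [CommRing B]
    [IsNoetherianRing B] [Algebra A B] [Module.Flat A B] (c : B)
    (h : ∀ (P : Ideal B) [P.IsPrime], P.comap (algebraMap A B) = ⊥ → ∃ u ∉ P, u * c = 0) :
    c = 0 := by
  by_contra hc
  obtain ⟨P, hP, hle⟩ := exists_le_isAssociatedPrime_of_isNoetherianRing B c hc
  have := hP.isPrime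
  obtain ⟨-, x, hPx⟩ := isAssociatedPrime_iff.mp hP
  have hann (m : B) : m ∈ P ↔ m * x = 0 := by
    rw [hPx, Submodule.mem_colon_singleton, Submodule.mem_bot, smul_eq_mul]
  obtain ⟨u, hu, huc⟩ := h P (by
    rw [eq_bot_iff]
    intro a ha
    have h1 : a • x = 0 := by
      rw [Algebra.smul_def]
      exact (hann _).mp ha
    by_contra ha0
    have h2 := Module.Flat.isSMulRegular_of_nonZeroDivisors (M := B)
      (mem_nonZeroDivisors_of_ne_zero ha0)
    have hx := isSMulRegular_iff_right_eq_zero_of_smul.mp h2 x h1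
    subst hx
    exact this.ne_top ((Ideal.eq_top_iff_one _).mpr ((hann 1).mpr (mul_zero _))))
  exact hu (hle (by rwa [Submodule.mem_colon_singleton, Submodule.mem_bot]))

end serre

section frame
open IsLocalRing

/-- A derivation of a domain with all values divisible by `π` is divisible by `π`. -/
lemma exists_derivation_smul_eq {B : Type*} [CommRing B] [IsDomain B] (π : B)
    (E : Derivation ℤ B B) (h : ∀ b, π ∣ E b) : ∃ E' : Derivation ℤ B B, E = π • E' := by
  by_cases hπ : π = 0
  · refine ⟨0, Derivation.ext fun b ↦ ?_⟩
    have := h b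
    rw [hπ, zero_dvd_iff] at this
    simpa using this
  choose g hg using h
  refine ⟨Derivation.mk' (AddMonoidHom.toIntLinearMap
    { toFun := g
      map_zero' := ?_
      map_add' := fun a b ↦ ?_ }) fun a b ↦ ?_, Derivation.ext fun b ↦ hg b⟩
  · apply mul_left_cancel₀ hπ
    rw [← hg, map_zero, mul_zero]
  · apply mul_left_cancel₀ hπ
    rw [mul_add, ← hg, ← hg, ← hg, map_add]
  · apply mul_left_cancel₀ hπ
    change π * g (a * b) = π * (a * g b + b * g a)
    rw [← hg, Derivation.leibniz, hg, hg, smul_eq_mul, smul_eq_mul]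
    ring

/-- A saturated module of derivations of a local principal ideal domain has a basis `D i` with
`det (D i (t j))` a unit for suitable elements `t j`. -/
lemma exists_span_eq_isUnit_det {B : Type*} [CommRing B] [IsDomain B] [IsLocalRing B]
    [IsPrincipalIdealRing B] (M : Submodule B (Derivation ℤ B B)) (hfg : M.FG)
    (hsat : ∀ a : B, a ≠ 0 → ∀ E, a • E ∈ M → E ∈ M) :
    ∃ (n : ℕ) (D : Fin n → Derivation ℤ B B) (t : Fin n → B), (∀ i, D i ∈ M) ∧
      Submodule.span B (Set.range D) = M ∧ IsUnit (Matrix.of fun i j ↦ D i (t j)).det := by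
  have : Module.Finite B M := Module.Finite.iff_fg.mpr hfg
  have htf : Module.IsTorsionFree B M := by
    refine .of_smul_eq_zero fun a D h ↦ ?_
    by_contra! H
    refine H.2 (Subtype.ext (Derivation.ext fun b ↦ ?_))
    have h1 : a * D.1 b = 0 := congr(($h).1 b)
    exact (mul_eq_zero.mp h1).resolve_left H.1
  obtain ⟨n, ⟨b⟩⟩ : ∃ n, Nonempty (Module.Basis (Fin n) B M) :=
    ⟨_, ⟨Module.finBasis B M⟩⟩
  let v (t : B) (i : Fin n) : ResidueField B := residue B ((b i).1 t)
  have hv : Submodule.span (ResidueField B) (Set.range v) = ⊤ := by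
    by_contra hne
    obtain ⟨f, hf0, hf⟩ := Submodule.exists_le_ker_of_lt_top _ (lt_top_iff_ne_top.mpr hne)
    choose c hc using fun i ↦ residue_surjective (R := B) (f (Pi.single i 1))
    have hE (t : B) : residue B (∑ i, c i * (b i).1 t) = 0 := by
      have h1 : f (v t) = 0 := hf (Submodule.subset_span ⟨t, rfl⟩)
      rw [← h1, LinearMap.pi_apply_eq_sum_univ f (v t), map_sum]
      refine Finset.sum_congr rfl fun i _ ↦ ?_
      rw [map_mul, hc, smul_eq_mul, mul_comm]
      congr 3
      ext j
      simp [Pi.single_apply, eq_comm]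
    obtain ⟨π, hπ⟩ := (IsPrincipalIdealRing.principal (maximalIdeal B)).principal
    obtain ⟨E', hE'⟩ := exists_derivation_smul_eq π (∑ i, c i • (b i).1) fun t ↦ by
      have h2 := (residue_eq_zero_iff _).mp (hE t)
      rw [hπ, Submodule.mem_span_singleton] at h2
      obtain ⟨a, ha⟩ := h2
      refine ⟨a, ?_⟩
      have h3 : (∑ i, c i • (b i).1) t = ∑ i, c i * (b i).1 t := by
        rw [← Derivation.coeFnAddMonoidHom_apply, map_sum, Finset.sum_apply]
        rfl
      rw [h3, ← ha, smul_eq_mul, mul_comm]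
    have hEM : ∑ i, c i • (b i).1 ∈ M := sum_mem fun i _ ↦ M.smul_mem _ (b i).2
    have hex : ∃ E'' ∈ M, ∑ i, c i • (b i).1 = π • E'' := by
      by_cases hπ0 : π = 0
      · exact ⟨0, zero_mem _, by rw [hE', hπ0, zero_smul, zero_smul]⟩
      · exact ⟨E', hsat π hπ0 E' (hE' ▸ hEM), hE'⟩
    obtain ⟨E'', hE'', heq⟩ := hex
    apply hf0
    have hc0 (i : Fin n) : f (Pi.single i 1) = 0 := by
      rw [← hc, residue_eq_zero_iff, hπ]
      have h4 : ∑ i, c i • b i = π • (⟨E'', hE''⟩ : M) := by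
        apply Subtype.ext
        simpa using heq
      have h5 := congr_arg (fun x ↦ b.repr x i) h4
      simp only [map_sum, map_smul, Module.Basis.repr_self, Finsupp.smul_apply,
        Finsupp.coe_finsetSum, Finset.sum_apply] at h5
      rw [Finset.sum_eq_single i (fun j _ hj ↦ by simp [hj]) (by simp)] at h5
      rw [Submodule.mem_span_singleton]
      refine ⟨b.repr ⟨E'', hE''⟩ i, ?_⟩
      rw [smul_eq_mul, mul_comm, ← smul_eq_mul, ← h5]
      simp
    ext i
    simp [hc0]
  have hrank : Module.finrank (ResidueField B)
      (Submodule.span (ResidueField B) (Set.range v)) = n := by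
    rw [hv, finrank_top, Module.finrank_fin_fun]
  obtain ⟨w, hw, -, hli⟩ :=
    Submodule.exists_fun_fin_finrank_span_eq (ResidueField B) (Set.range v)
  choose t ht using hw
  let e := finCongr hrank.symm
  refine ⟨n, fun i ↦ (b i).1, t ∘ e, fun i ↦ (b i).2, ?_, ?_⟩
  · have h1 := congr_arg (Submodule.map M.subtype) b.span_eq
    rw [Submodule.map_span, Submodule.map_top, Submodule.range_subtype, ← Set.range_comp] at h1
    exact h1
  · rw [← isUnit_map_iff (residue B), RingHom.map_det, ← Matrix.isUnit_iff_isUnit_det,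
      ← Matrix.linearIndependent_cols_iff_isUnit]
    have h1 : (Matrix.col ((residue B).mapMatrix
        (Matrix.of fun i j ↦ (b i).1 ((t ∘ e) j)))) = w ∘ e := by
      ext j i
      exact congr_fun (ht (e j)) i
    rw [h1]
    exact hli.comp e e.injective

/-- Lifting of a dual system along a surjection of local rings. -/
lemma exists_span_eq_dual {B B' : Type*} [CommRing B] [IsLocalRing B] [CommRing B'] [IsDomain B']
    [IsLocalRing B'] [IsPrincipalIdealRing B'] (π : B →+* B') [IsLocalHom π]
    (hπ : Function.Surjective π) (M : Submodule B (Derivation ℤ B B))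
    (M' : Submodule B' (Derivation ℤ B' B')) (hfg : M.FG) (hfg' : M'.FG)
    (hsat : ∀ a : B', a ≠ 0 → ∀ E, a • E ∈ M' → E ∈ M')
    (hdesc : ∀ D ∈ M, ∃ E ∈ M', DerivationCompatible π D E)
    (hlift : ∀ E ∈ M', ∃ D ∈ M, DerivationCompatible π D E)
    (hker : ∀ D ∈ M, DerivationCompatible π D 0 → D ∈ maximalIdeal B • M) :
    ∃ (n : ℕ) (D : Fin n → Derivation ℤ B B) (t : Fin n → B), (∀ i, D i ∈ M) ∧
      Submodule.span B (Set.range D) = M ∧ ∀ i j, D i (t j) = if i = j then 1 else 0 := by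
  obtain ⟨n, D', t', hD', hspan', hunit⟩ := exists_span_eq_isUnit_det M' hfg' hsat
  choose D hD hDD' using fun i ↦ hlift (D' i) (hD' i)
  choose t ht using fun j ↦ hπ (t' j)
  have hsum (c : Fin n → B) (D : Fin n → Derivation ℤ B B) (x : B) :
      (∑ i, c i • D i) x = ∑ i, c i * D i x := by
    rw [← Derivation.coeFnAddMonoidHom_apply, map_sum, Finset.sum_apply]
    rfl
  have hsum' (c : Fin n → B') (D : Fin n → Derivation ℤ B' B') (x : B') :
      (∑ i, c i • D i) x = ∑ i, c i * D i x := by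
    rw [← Derivation.coeFnAddMonoidHom_apply, map_sum, Finset.sum_apply]
    rfl
  have hspan : Submodule.span B (Set.range D) = M := by
    apply le_antisymm
    · rw [Submodule.span_le]
      rintro _ ⟨i, rfl⟩
      exact hD i
    · refine Submodule.le_of_le_smul_of_le_jacobson_bot (I := maximalIdeal B) hfg
        (jacobson_eq_maximalIdeal _ bot_ne_top).ge fun E hE ↦ ?_
      obtain ⟨E', hE', hEE'⟩ := hdesc E hE
      rw [← hspan', Submodule.mem_span_range_iff_exists_fun] at hE'
      obtain ⟨c', hc'⟩ := hE'
      choose c hc using fun i ↦ hπ (c' i)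
      have h1 : ∑ i, c i • D i ∈ Submodule.span B (Set.range D) :=
        sum_mem fun i _ ↦ Submodule.smul_mem _ _ (Submodule.subset_span ⟨i, rfl⟩)
      have h2 : ∑ i, c i • D i ∈ M := sum_mem fun i _ ↦ M.smul_mem _ (hD i)
      rw [← add_sub_cancel (∑ i, c i • D i) E]
      refine Submodule.add_mem_sup h1 (hker _ (sub_mem hE h2) fun x ↦ ?_)
      rw [Derivation.sub_apply, map_sub, ← hEE', ← hc', hsum, hsum', map_sum]
      simp only [map_mul, hc, hDD' _ x, Derivation.zero_apply]
      simp only [← hDD' _ x, sub_self]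
  let A : Matrix (Fin n) (Fin n) B := Matrix.of fun i j ↦ D i (t j)
  have hA : IsUnit A.det := by
    rw [← isUnit_map_iff π, RingHom.map_det]
    convert hunit using 2
    ext i j
    simp only [A, RingHom.mapMatrix_apply, Matrix.map_apply, Matrix.of_apply]
    rw [← hDD' i, ht]
  refine ⟨n, fun i ↦ ∑ l, A⁻¹ i l • D l, t, fun i ↦ sum_mem fun l _ ↦ M.smul_mem _ (hD l),
    ?_, fun i j ↦ ?_⟩
  · apply le_antisymm
    · rw [Submodule.span_le]
      rintro _ ⟨i, rfl⟩
      exact sum_mem fun l _ ↦ M.smul_mem _ (hD l)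
    · conv_lhs => rw [← hspan]
      rw [Submodule.span_le]
      rintro _ ⟨i, rfl⟩
      have h1 : D i = ∑ l, A i l • ∑ m, A⁻¹ l m • D m := by
        simp only [Finset.smul_sum, smul_smul]
        rw [Finset.sum_comm]
        simp only [← Finset.sum_smul]
        have h2 (m : Fin n) : ∑ l, A i l * A⁻¹ l m = (1 : Matrix (Fin n) (Fin n) B) i m := by
          rw [← Matrix.mul_nonsing_inv A hA, Matrix.mul_apply]
        simp [h2, Matrix.one_apply]
      rw [h1]
      exact sum_mem fun l _ ↦ Submodule.smul_mem _ _ (Submodule.subset_span ⟨l, rfl⟩)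
  · rw [hsum]
    have h2 : ∑ l, A⁻¹ i l * A l j = (1 : Matrix (Fin n) (Fin n) B) i j := by
      rw [← Matrix.nonsing_inv_mul A hA, Matrix.mul_apply]
    rw [← Matrix.one_apply, ← h2]
    rfl

/-- A Noetherian normal local domain of dimension at most one is a principal ideal domain. -/
lemma isPrincipalIdealRing_of_ringKrullDim_le_one {B : Type*} [CommRing B] [IsDomain B]
    [IsLocalRing B] [IsNoetherianRing B] [IsIntegrallyClosed B] (h : ringKrullDim B ≤ 1) :
    IsPrincipalIdealRing B := by
  have h1 : Ring.KrullDimLE 1 B := Ring.krullDimLE_iff.mpr h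
  have h2 : Ring.DimensionLEOne B := ⟨fun hp hprime ↦ hprime.isMaximal_of_ne_bot hp⟩
  have h3 : IsDedekindDomain B := { }
  exact ((tfae_of_isNoetherianRing_of_isLocalRing_of_isDomain B).out 0 2).mpr h3

open scoped Pointwise in
/-- Let `N ⊆ M` be modules over `B`, an `A`-algebra, such that `M / N` is flat over `A`. Then
`N ∩ I M = I N` for each ideal `I` of `A`. -/
lemma mem_smul_of_flat_quotient {A B V : Type*} [CommRing A] [CommRing B] [AddCommGroup V]
    [Module B V] (φ : A →+* B) (N M : Submodule B V)
    (hflat : FlatAlong φ (M ⧸ N.submoduleOf M)) (I : Ideal A) {x : V} (hxN : x ∈ N)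
    (hx : x ∈ I.map φ • M) : x ∈ I.map φ • N := by
  let _ : Module A (M ⧸ N.submoduleOf M) := Module.compHom _ φ
  have _ : Module.Flat A (M ⧸ N.submoduleOf M) := hflat
  have hsmul (a : A) (q : M ⧸ N.submoduleOf M) : a • q = φ a • q := rfl
  have hspan : I.map φ • M = Submodule.span B ((φ '' (I : Set A)) • (M : Set V)) := by
    rw [← Submodule.span_smul_span, Submodule.span_eq]
    rfl
  rw [hspan, Submodule.mem_span_set'] at hx
  obtain ⟨n, c, g, rfl⟩ := hx
  choose a ha m hm hg using fun i ↦ Set.mem_smul.mp (g i).2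
  choose a' ha' haa' using ha
  let y (i : Fin n) : M := ⟨c i • m i, M.smul_mem _ (hm i)⟩
  have hsum : ∑ i, c i • (g i).1 = ∑ i, φ (a' i) • (y i).1 := by
    refine Finset.sum_congr rfl fun i _ ↦ ?_
    rw [← hg, ← haa', smul_comm]
  rw [hsum] at hxN ⊢
  let q := (N.submoduleOf M).mkQ
  have hq (w : M) : q w = 0 ↔ w.1 ∈ N := (Submodule.Quotient.mk_eq_zero _).trans Iff.rfl
  have hrel : ∑ i, a' i • q (y i) = 0 := by
    simp only [hsmul, ← map_smul]
    rw [← map_sum, hq]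
    simpa using hxN
  obtain ⟨k, r, z, hz, hr⟩ := Module.Flat.isTrivialRelation_of_sum_smul_eq_zero hrel
  choose z' hz' using fun j ↦ Submodule.mkQ_surjective (N.submoduleOf M) (z j)
  have hmem (i : Fin n) : (y i).1 - ∑ j, φ (r i j) • (z' j).1 ∈ N := by
    have h1 : q (y i - ∑ j, φ (r i j) • z' j) = 0 := by
      rw [map_sub, sub_eq_zero, map_sum]
      refine (hz i).trans (Finset.sum_congr rfl fun j _ ↦ ?_)
      rw [map_smul, hsmul, ← hz']
    simpa using (hq _).mp h1
  have hfinal : ∑ i, φ (a' i) • (y i).1 =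
      ∑ i, φ (a' i) • ((y i).1 - ∑ j, φ (r i j) • (z' j).1) := by
    simp only [smul_sub, Finset.sum_sub_distrib, Finset.smul_sum, smul_smul]
    rw [Finset.sum_comm]
    simp only [← Finset.sum_smul, ← map_mul, ← map_sum, hr, map_zero, zero_smul,
      Finset.sum_const_zero, sub_zero]
  rw [hfinal]
  exact sum_mem fun i _ ↦ Submodule.smul_mem_smul (Ideal.mem_map_of_mem _ (ha' i)) (hmem i)
end frame

end AlgebraicGeometry

namespace AlgebraicGeometry

lemma isIntegralElem_of_map_eq_pow {A B : Type*} [CommRing A] [CommRing B] {φ : A →+* B} {p : ℕ}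
    (hp : p ≠ 0) {a : A} {b : B} (h : φ a = b ^ p) : φ.IsIntegralElem b := by
  refine ⟨Polynomial.X ^ p - Polynomial.C a, Polynomial.monic_X_pow_sub_C a hp, ?_⟩
  rw [Polynomial.eval₂_sub, Polynomial.eval₂_pow, Polynomial.eval₂_X, Polynomial.eval₂_C, h,
    sub_self]

namespace TangentSubsheaf

variable {X S : Scheme.{u}} {f : X ⟶ S} (F : TangentSubsheaf f) {p : ℕ} (hp : p ≠ 0)
  (hX : X.OfChar p)

lemma isHomeomorph_toQuotient : IsHomeomorph (F.toQuotient hp hX) :=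
  IsHomeomorph.id (X := X)

instance isAffineHom_toQuotient : IsAffineHom (F.toQuotient hp hX) :=
  isAffineHom_of_isInducing _ (F.isHomeomorph_toQuotient hp hX).isEmbedding.isInducing (by
    rw [(F.isHomeomorph_toQuotient hp hX).surjective.range_eq]
    exact isClosed_univ)

instance surjective_toQuotient : Surjective (F.toQuotient hp hX) :=
  ⟨(F.isHomeomorph_toQuotient hp hX).surjective⟩

lemma toQuotient_app_injective (U : (F.quotient hp hX).Opens) :
    Function.Injective ((F.toQuotient hp hX).app U).hom :=
  Subtype.val_injective (p := fun a ↦ a ∈ F.constants U)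

lemma exists_toQuotient_app_eq_pow (U : (F.quotient hp hX).Opens)
    (a : Γ(X, F.toQuotient hp hX ⁻¹ᵁ U)) : ∃ c, ((F.toQuotient hp hX).app U).hom c = a ^ p :=
  ⟨⟨a ^ p, F.pow_mem_constants hX a⟩, rfl⟩

instance isIntegralHom_toQuotient : IsIntegralHom (F.toQuotient hp hX) where
  isIntegral_app U _ a := by
    obtain ⟨c, hc⟩ := F.exists_toQuotient_app_eq_pow hp hX U a
    exact isIntegralElem_of_map_eq_pow hp hc

/-- Morphisms out of `X/ℱ` are locally of finite type over a locally Noetherian base if they are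
so on `X`. -/
lemma locallyOfFiniteType_of_toQuotient_comp {T : Scheme.{u}} [IsLocallyNoetherian T]
    (h : F.quotient hp hX ⟶ T) [LocallyOfFiniteType (F.toQuotient hp hX ≫ h)] :
    LocallyOfFiniteType h := by
  rw [HasRingHomProperty.iff_appLE (P := @LocallyOfFiniteType)]
  intro V U hUV
  have hU' : IsAffineOpen (F.toQuotient hp hX ⁻¹ᵁ U.1) := U.2.preimage _
  have h1 := (F.toQuotient hp hX ≫ h).finiteType_appLE V.2 hU' (fun x hx ↦ hUV hx)
  have h2 : (F.toQuotient hp hX ≫ h).appLE V.1 (F.toQuotient hp hX ⁻¹ᵁ U.1) (fun x hx ↦ hUV hx) =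
      h.appLE V.1 U.1 hUV ≫ (F.toQuotient hp hX).app U.1 := by
    rw [Scheme.Hom.app_eq_appLE, Scheme.Hom.appLE_comp_appLE]
  rw [h2] at h1
  have := IsLocallyNoetherian.component_noetherian V
  let α := (h.appLE V.1 U.1 hUV).hom
  let β := ((F.toQuotient hp hX).app U.1).hom
  let _ : Algebra Γ(T, V.1) Γ(F.quotient hp hX, U.1) := α.toAlgebra
  let _ : Algebra Γ(F.quotient hp hX, U.1) Γ(X, F.toQuotient hp hX ⁻¹ᵁ U.1) := β.toAlgebra
  let _ : Algebra Γ(T, V.1) Γ(X, F.toQuotient hp hX ⁻¹ᵁ U.1) := (β.comp α).toAlgebra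
  have : IsScalarTower Γ(T, V.1) Γ(F.quotient hp hX, U.1) Γ(X, F.toQuotient hp hX ⁻¹ᵁ U.1) :=
    .of_algebraMap_eq fun _ ↦ rfl
  have hft : Algebra.FiniteType Γ(T, V.1) Γ(X, F.toQuotient hp hX ⁻¹ᵁ U.1) := h1
  have hft' : Algebra.FiniteType Γ(F.quotient hp hX, U.1) Γ(X, F.toQuotient hp hX ⁻¹ᵁ U.1) :=
    .of_restrictScalars_finiteType Γ(T, V.1) _ _
  have hint : Algebra.IsIntegral Γ(F.quotient hp hX, U.1) Γ(X, F.toQuotient hp hX ⁻¹ᵁ U.1) :=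
    ⟨fun a ↦ IsIntegralHom.isIntegral_app (f := F.toQuotient hp hX) U.1 U.2 a⟩
  have hfin : Module.Finite Γ(F.quotient hp hX, U.1) Γ(X, F.toQuotient hp hX ⁻¹ᵁ U.1) :=
    Algebra.IsIntegral.finite
  exact ⟨fg_of_fg_of_fg Γ(T, V.1) Γ(F.quotient hp hX, U.1) Γ(X, F.toQuotient hp hX ⁻¹ᵁ U.1)
    hft.out hfin.fg_top (F.toQuotient_app_injective hp hX U.1)⟩

instance locallyOfFiniteType_quotientToBase [IsLocallyNoetherian S] [LocallyOfFiniteType f] :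
    LocallyOfFiniteType (F.quotientToBase hp hX) := by
  have : LocallyOfFiniteType (F.toQuotient hp hX ≫ F.quotientToBase hp hX) := by
    rwa [F.toQuotient_quotientToBase]
  exact F.locallyOfFiniteType_of_toQuotient_comp hp hX _

instance locallyOfFiniteType_toQuotient [LocallyOfFiniteType f] :
    LocallyOfFiniteType (F.toQuotient hp hX) := by
  have : LocallyOfFiniteType (F.toQuotient hp hX ≫ F.quotientToBase hp hX) := by
    rwa [F.toQuotient_quotientToBase]
  exact locallyOfFiniteType_of_comp _ (F.quotientToBase hp hX)

section stalks

variable (x : X)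

lemma toQuotient_stalkMap_injective :
    Function.Injective ((F.toQuotient hp hX).stalkMap x).hom := by
  rw [injective_iff_map_eq_zero]
  intro c hc
  obtain ⟨U, hxU, c, rfl⟩ := (F.quotient hp hX).presheaf.exists_germ_eq c
  have h1 := Scheme.Hom.germ_stalkMap_apply (F.toQuotient hp hX) U x hxU c
  have h2 : (X.presheaf.germ (F.toQuotient hp hX ⁻¹ᵁ U) x hxU).hom
      (((F.toQuotient hp hX).app U).hom c) = 0 := h1.symm.trans hc
  rw [← map_zero (X.presheaf.germ (F.toQuotient hp hX ⁻¹ᵁ U) x hxU).hom] at h2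
  obtain ⟨W, hxW, i, j, hW⟩ := X.presheaf.germ_eq x hxU hxU _ _ h2
  let i' : (show (F.quotient hp hX).Opens from W) ⟶ U := i
  have h3 : ((F.quotient hp hX).presheaf.map i'.op).hom c = 0 := by
    apply Subtype.ext
    have h4 : (X.presheaf.map j.op).hom 0 = 0 := map_zero _
    exact hW.trans h4
  have h5 := (F.quotient hp hX).presheaf.germ_res_apply i' x hxW c
  exact h5.symm.trans ((congr_arg _ h3).trans (map_zero _))

/-- The stalk of `X/ℱ` consists of the constants in the stalk of `X`. -/
lemma mem_range_toQuotient_stalkMap {b : X.presheaf.stalk x} (hb : ∀ D ∈ F.stalk x, D b = 0) :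
    ∃ c, ((F.toQuotient hp hX).stalkMap x).hom c = b := by
  obtain ⟨V, hxV, b, rfl⟩ := X.presheaf.exists_germ_eq b
  obtain ⟨U, hU, hxU, hUV, G, hG, hspan⟩ := F.coherent_of_mem x V hxV
  let b' : Γ(X, U) := (X.presheaf.map (homOfLE hUV).op).hom b
  have hb' : (X.presheaf.germ U x hxU).hom b' = (X.presheaf.germ V x hxV).hom b :=
    X.presheaf.germ_res_apply (homOfLE hUV) x hxU b
  -- On a smaller neighbourhood all generators kill `b'`.
  have hD (D : Derivation ℤ Γ(X, U) Γ(X, U)) (hD : D ∈ G) :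
      ∃ (W : X.Opens) (_ : x ∈ W), ∀ y (hyU : y ∈ U), y ∈ W →
        (X.presheaf.germ U y hyU).hom (D b') = 0 := by
    obtain ⟨E, hE⟩ := exists_germ_derivation hU x hxU D
    have h1 : (X.presheaf.germ U x hxU).hom (D b') = 0 := by
      rw [← hE, hb']
      refine hb E ?_
      rw [hspan x hxU]
      exact Submodule.subset_span ⟨D, hD, hE⟩
    rw [← map_zero (X.presheaf.germ U x hxU).hom] at h1
    obtain ⟨W, hxW, i, j, hW⟩ := X.presheaf.germ_eq x hxU hxU _ _ h1
    refine ⟨W, hxW, fun y hyU hyW ↦ ?_⟩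
    have h2 := X.presheaf.germ_res_apply i y hyW (D b')
    have h3 : (X.presheaf.map i.op).hom (D b') = 0 := by
      refine Eq.trans hW ?_
      exact map_zero (X.presheaf.map j.op).hom
    exact h2.symm.trans ((congr_arg _ h3).trans (map_zero _))
  choose! W hxW hW using hD
  let N : X.Opens := hG.toFinset.inf W ⊓ U
  have hxN : x ∈ N := by
    refine ⟨?_, hxU⟩
    rw [Opens.coe_finset_inf]
    simpa using fun D hD ↦ hxW D hD
  have hNU : N ≤ U := inf_le_right
  let c : F.constants N := ⟨(X.presheaf.map (homOfLE hNU).op).hom b', by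
    intro y hy D hDy
    have hg : (X.presheaf.germ N y hy).hom ((X.presheaf.map (homOfLE hNU).op).hom b') =
      (X.presheaf.germ U y (hNU hy)).hom b' := X.presheaf.germ_res_apply (homOfLE hNU) y hy b'
    rw [hg]
    rw [hspan y (hNU hy)] at hDy
    induction hDy using Submodule.span_induction with
    | zero => rfl
    | add D₁ D₂ _ _ h₁ h₂ => rw [Derivation.add_apply, h₁, h₂, add_zero]
    | smul c D _ h => rw [Derivation.smul_apply, h, smul_zero]
    | mem E hE =>
      obtain ⟨D, hD, hDE⟩ := hE
      rw [hDE]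
      refine hW D hD y (hNU hy) ?_
      have h1 : N ≤ W D := inf_le_left.trans (Finset.inf_le (hG.mem_toFinset.mpr hD))
      exact h1 hy⟩
  refine ⟨((F.quotient hp hX).presheaf.germ N x hxN).hom c, ?_⟩
  have h1 := Scheme.Hom.germ_stalkMap_apply (F.toQuotient hp hX) N x hxN c
  refine h1.trans ?_
  have h2 := X.presheaf.germ_res_apply (homOfLE hNU) x hxN b'
  exact h2.trans hb'

end stalks

end TangentSubsheaf

end AlgebraicGeometry

namespace AlgebraicGeometry

section fibers

variable {W S : Scheme.{u}} (g : W ⟶ S) (s : S)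

lemma fiberι_mem (w : g.fiber s) : g (g.fiberι s w) = s := by
  have : g.fiberι s w ∈ Set.range (g.fiberι s) := ⟨w, rfl⟩
  rw [g.range_fiberι] at this
  exact this

/-- Germs along equal points vanish simultaneously. -/
lemma germ_eq_zero_of_eq {x y : W} (h : x = y) {U : W.Opens} (hx : x ∈ U) (hy : y ∈ U) (a : Γ(W, U))
    (h0 : (W.presheaf.germ U x hx).hom a = 0) : (W.presheaf.germ U y hy).hom a = 0 := by
  subst h
  exact h0

lemma eq_zero_of_not_isUnit_stalk_spec_field {K : CommRingCat.{u}} (hK : IsField K)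
    (t : PrimeSpectrum K) (a : (Spec K).presheaf.stalk t) (ha : ¬ IsUnit a) : a = 0 := by
  have := hK.isDomain
  let _ := hK.toField
  let _ : Algebra K ((Spec K).presheaf.stalk t) := StructureSheaf.stalkAlgebra K t
  have : IsLocalization.AtPrime ((Spec K).presheaf.stalk t) t.asIdeal :=
    StructureSheaf.IsLocalization.to_stalk K t
  obtain ⟨⟨b, m⟩, hb⟩ := IsLocalization.surj t.asIdeal.primeCompl a
  have hm := IsLocalization.map_units ((Spec K).presheaf.stalk t) m
  by_cases hb0 : b = 0
  · simp only [hb0, map_zero] at hb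
    exact hm.mul_left_eq_zero.mp hb
  · exfalso
    apply ha
    have : IsUnit (a * algebraMap K ((Spec K).presheaf.stalk t) m) := by
      rw [hb]
      exact (IsUnit.mk0 b hb0).map (algebraMap K ((Spec K).presheaf.stalk t))
    exact isUnit_of_mul_isUnit_left this

/-- The maximal ideal of the base vanishes on the fibre. -/
lemma fiberι_stalkMap_stalkMap_eq_zero (w : g.fiber s) {a : S.presheaf.stalk (g (g.fiberι s w))}
    (ha : a ∈ IsLocalRing.maximalIdeal (S.presheaf.stalk (g (g.fiberι s w)))) :
    ((g.fiberι s).stalkMap w).hom ((g.stalkMap (g.fiberι s w)).hom a) = 0 := by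
  obtain ⟨U, hU, a, rfl⟩ := S.presheaf.exists_germ_eq a
  have h1 := Scheme.Hom.germ_stalkMap_apply (g.fiberι s ≫ g) U w hU a
  rw [Scheme.Hom.stalkMap_comp] at h1
  refine h1.trans ?_
  have hfac := g.fiber_fac s
  set k := g.fiberToSpecResidueField s ≫ S.fromSpecResidueField s with hk
  have hUk : k w ∈ U := by rw [← hfac]; exact hU
  have h2 (h h' : g.fiber s ⟶ S) (e : h = h') (hw : h w ∈ U) (hw' : h' w ∈ U) :
      ((g.fiber s).presheaf.germ (h ⁻¹ᵁ U) w hw).hom ((h.app U).hom a) =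
        ((g.fiber s).presheaf.germ (h' ⁻¹ᵁ U) w hw').hom ((h'.app U).hom a) := by
    subst e; rfl
  rw [h2 _ _ hfac hU hUk]
  have h3 := Scheme.Hom.germ_stalkMap_apply k U w hUk a
  refine h3.symm.trans ?_
  refine (congr($(Scheme.Hom.stalkMap_comp (g.fiberToSpecResidueField s)
    (S.fromSpecResidueField s) w).hom _)).trans ?_
  have hloc : IsLocalHom ((S.fromSpecResidueField s).stalkMap
    (g.fiberToSpecResidueField s w)).hom := inferInstance
  have h4 : ((S.fromSpecResidueField s).stalkMap (g.fiberToSpecResidueField s w)).hom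
      ((S.presheaf.germ U (k w) hUk).hom a) = 0 := by
    refine eq_zero_of_not_isUnit_stalk_spec_field (Field.toIsField (S.residueField s)) _ _
      fun hu ↦ ?_
    have h5 := hloc.map_nonunit _ hu
    have h6 := (S.mem_basicOpen a (k w) hUk).mpr h5
    rw [← hfac] at h6
    have h7 := (S.mem_basicOpen a _ hU).mp h6
    exact (IsLocalRing.mem_maximalIdeal _).mp ha h7
  exact (congr_arg ((g.fiberToSpecResidueField s).stalkMap w).hom h4).trans (map_zero _)

/-- A germ that vanishes on the fibre is divisible by the maximal ideal of the base. -/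
lemma mem_map_maximalIdeal_of_fiberι_stalkMap_eq_zero (w : g.fiber s)
    (b : W.presheaf.stalk (g.fiberι s w)) (hb : ((g.fiberι s).stalkMap w).hom b = 0) :
    b ∈ (IsLocalRing.maximalIdeal (S.presheaf.stalk (g (g.fiberι s w)))).map
      (g.stalkMap (g.fiberι s w)).hom := by
  obtain ⟨U, hU, b, rfl⟩ := W.presheaf.exists_germ_eq b
  let x := g.fiberι s w
  let I := (IsLocalRing.maximalIdeal (S.presheaf.stalk (g x))).map (g.stalkMap x).hom
  let Q := CommRingCat.of (W.presheaf.stalk x ⧸ I)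
  let q : W.presheaf.stalk x ⟶ Q := CommRingCat.ofHom (Ideal.Quotient.mk I)
  have hIle : I ≤ IsLocalRing.maximalIdeal (W.presheaf.stalk x) :=
    IsLocalRing.map_maximalIdeal_le (g.stalkMap x).hom
  have : Nontrivial Q := Ideal.Quotient.nontrivial_iff.mpr fun h ↦
    (IsLocalRing.maximalIdeal.isMaximal (W.presheaf.stalk x)).ne_top (top_le_iff.mp (h ▸ hIle))
  have : IsLocalRing Q := .of_surjective' (Ideal.Quotient.mk I) Ideal.Quotient.mk_surjective
  have hqloc : IsLocalHom q.hom := .of_surjective _ Ideal.Quotient.mk_surjective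
  let a : Spec Q ⟶ W := Spec.map q ≫ W.fromSpecStalk x
  let ρ : S.residueField (g x) ⟶ Q := CommRingCat.ofHom (Ideal.Quotient.lift _
    ((Ideal.Quotient.mk I).comp (g.stalkMap x).hom) fun c hc ↦
      Ideal.Quotient.eq_zero_iff_mem.mpr (Ideal.mem_map_of_mem _ hc))
  have hρ : S.residue (g x) ≫ ρ = g.stalkMap x ≫ q := rfl
  have hgx : g x = s := fiberι_mem g s w
  let c : Spec Q ⟶ Spec (S.residueField s) :=
    Spec.map ρ ≫ Spec.map (S.residueFieldCongr hgx.symm).hom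
  have hac : a ≫ g = c ≫ S.fromSpecResidueField s := by
    simp only [a, c, Category.assoc, Scheme.residueFieldCongr_fromSpecResidueField]
    rw [Scheme.fromSpecResidueField, ← Spec.map_comp_assoc, hρ, Spec.map_comp_assoc,
      Scheme.SpecMap_stalkMap_fromSpecStalk]
  let l : Spec Q ⟶ g.fiber s := pullback.lift a c hac
  have hl : l ≫ g.fiberι s = a := pullback.lift_fst _ _ _
  have hacp : a (IsLocalRing.closedPoint Q) = x :=
    (Scheme.Hom.comp_apply _ _ _).trans ((congr_arg (W.fromSpecStalk x)
      (Spec_closedPoint (f := q))).trans Scheme.fromSpecStalk_closedPoint)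
  have hlcp : w = l (IsLocalRing.closedPoint Q) := by
    apply (g.fiberι s).isEmbedding.injective
    exact hacp.symm.trans (congr($hl (IsLocalRing.closedPoint Q))).symm
  have h0 : ((g.fiber s).presheaf.germ (g.fiberι s ⁻¹ᵁ U) w hU).hom
      (((g.fiberι s).app U).hom b) = 0 :=
    (Scheme.Hom.germ_stalkMap_apply (g.fiberι s) U w hU b).symm.trans hb
  have key (a' : Spec Q ⟶ W) (ha' : l ≫ g.fiberι s = a')
      (hU' : a' (IsLocalRing.closedPoint Q) ∈ U) :
      (Scheme.stalkClosedPointTo a').hom ((W.presheaf.germ U _ hU').hom b) = 0 := by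
    subst ha'
    refine (congr($(Scheme.stalkClosedPointTo_comp l (g.fiberι s)).hom _)).trans ?_
    have h1 := Scheme.Hom.germ_stalkMap_apply (g.fiberι s) U
      (l (IsLocalRing.closedPoint Q)) hU' b
    exact (congr_arg (Scheme.stalkClosedPointTo l).hom
      (h1.trans (germ_eq_zero_of_eq hlcp hU hU' _ h0))).trans (map_zero _)
  have hUa : a (IsLocalRing.closedPoint Q) ∈ U := by
    change a (IsLocalRing.closedPoint Q) ∈ (U : Set W)
    exact Set.mem_of_eq_of_mem hacp hU
  have h2 := Scheme.germ_stalkClosedPointTo_Spec_fromSpecStalk q U hUa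
  have h3 : q.hom ((W.presheaf.germ U x hU).hom b) = 0 :=
    (congr($(h2).hom b)).symm.trans (key a hl hUa)
  exact Ideal.Quotient.eq_zero_iff_mem.mp h3

end fibers

end AlgebraicGeometry

namespace AlgebraicGeometry

namespace TangentSubsheaf

variable {X S : Scheme.{u}} {f : X ⟶ S} (F : TangentSubsheaf f)
variable {p : ℕ} (hp : p ≠ 0) (hX : X.OfChar p) (s : S)

lemma isPullback_fiberMap : IsPullback (f.fiberι s) (F.fiberMap hp hX s) (F.toQuotient hp hX)
    ((F.quotientToBase hp hX).fiberι s) := by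
  have h1 : IsPullback ((F.quotientToBase hp hX).fiberι s)
      ((F.quotientToBase hp hX).fiberToSpecResidueField s) (F.quotientToBase hp hX)
      (S.fromSpecResidueField s) := IsPullback.of_hasPullback _ _
  have h2 : IsPullback (f.fiberι s) (f.fiberToSpecResidueField s) f (S.fromSpecResidueField s) :=
    IsPullback.of_hasPullback _ _
  refine IsPullback.of_bot ?_ (F.fiberMap_fiberι hp hX s).symm h1
  convert h2 using 1
  · exact pullback.lift_snd _ _ _
  · exact F.toQuotient_quotientToBase hp hX

lemma fiberι_fiberMap_apply (z : f.fiber s) :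
    (F.quotientToBase hp hX).fiberι s (F.fiberMap hp hX s z) =
      F.toQuotient hp hX (f.fiberι s z) :=
  congr($(F.fiberMap_fiberι hp hX s) z)

instance surjective_fiberMap : Surjective (F.fiberMap hp hX s) :=
  MorphismProperty.of_isPullback (F.isPullback_fiberMap hp hX s) inferInstance

instance isIntegralHom_fiberMap : IsIntegralHom (F.fiberMap hp hX s) :=
  MorphismProperty.of_isPullback (F.isPullback_fiberMap hp hX s) inferInstance

lemma injective_fiberMap : Function.Injective (F.fiberMap hp hX s) := by
  intro a b h
  apply (f.fiberι s).isEmbedding.injective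
  apply (F.isHomeomorph_toQuotient hp hX).injective
  have := congr_arg ((F.quotientToBase hp hX).fiberι s) h
  rwa [fiberι_fiberMap_apply, fiberι_fiberMap_apply] at this

lemma isHomeomorph_fiberMap : IsHomeomorph (F.fiberMap hp hX s) where
  continuous := (F.fiberMap hp hX s).continuous
  isOpenMap := by
    have hcl : IsClosedMap (F.fiberMap hp hX s) := (F.fiberMap hp hX s).isClosedMap
    exact ((Equiv.ofBijective _ ⟨F.injective_fiberMap hp hX s,
      (F.fiberMap hp hX s).surjective⟩).toHomeomorphOfContinuousClosed
        (F.fiberMap hp hX s).continuous hcl).isOpenMap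
  bijective := ⟨F.injective_fiberMap hp hX s, (F.fiberMap hp hX s).surjective⟩

lemma isHomeomorph_comparison : IsHomeomorph (F.comparison hp hX s) := by
  have h : (F.comparison hp hX s : f.fiber s → (F.quotientToBase hp hX).fiber s) =
      F.fiberMap hp hX s :=
    funext fun z ↦ congr($(F.toFiberQuotient_comparison hp hX s) z)
  have h1 := F.isHomeomorph_fiberMap hp hX s
  rw [← h] at h1
  exact h1

instance isAffineHom_comparison : IsAffineHom (F.comparison hp hX s) :=
  isAffineHom_of_isInducing _ (F.isHomeomorph_comparison hp hX s).isInducing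
    ((F.isHomeomorph_comparison hp hX s).isClosedMap.isClosed_range)

instance isIntegralHom_comparison : IsIntegralHom (F.comparison hp hX s) := by
  have : UniversallyClosed (F.toFiberQuotient hp hX s ≫ F.comparison hp hX s) := by
    rw [toFiberQuotient_comparison]
    infer_instance
  rw [IsIntegralHom.iff_universallyClosed_and_isAffineHom]
  exact ⟨.of_comp_surjective (F.toFiberQuotient hp hX s) _, inferInstance⟩

variable [IsLocallyNoetherian S] [LocallyOfFiniteType f]

lemma isLocallyNoetherian_fiber_quotientToBase :
    IsLocallyNoetherian ((F.quotientToBase hp hX).fiber s) := by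
  have := F.locallyOfFiniteType_quotientToBase hp hX
  have : LocallyOfFiniteType ((F.quotientToBase hp hX).fiberToSpecResidueField s) :=
    inferInstanceAs (LocallyOfFiniteType (pullback.snd _ _))
  exact LocallyOfFiniteType.isLocallyNoetherian
    ((F.quotientToBase hp hX).fiberToSpecResidueField s)

lemma isFinite_comparison : IsFinite (F.comparison hp hX s) := by
  have := F.isLocallyNoetherian_fiber_quotientToBase hp hX s
  have := F.locallyOfFiniteType_toQuotient hp hX
  have : LocallyOfFiniteType (F.fiberMap hp hX s) :=
    MorphismProperty.of_isPullback (F.isPullback_fiberMap hp hX s) inferInstance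
  have : LocallyOfFiniteType (F.toFiberQuotient hp hX s ≫ F.comparison hp hX s) := by
    rwa [toFiberQuotient_comparison]
  have : LocallyOfFiniteType (F.comparison hp hX s) :=
    (F.fiber s).locallyOfFiniteType_of_toQuotient_comp hp (hX.of_hom (f.fiberι s)) _
  exact (IsFinite.iff_isIntegralHom_and_locallyOfFiniteType _).mpr ⟨inferInstance, inferInstance⟩

end TangentSubsheaf

section IsIsoAt

variable {Y Z : Scheme.{u}} (φ : Y ⟶ Z)

lemma IsIsoAt.isIso_stalkMap {y : Y} (h : IsIsoAt φ y) : IsIso (φ.stalkMap y) := by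
  obtain ⟨V, hV, h⟩ := h
  let y' : (φ ⁻¹ᵁ V).toScheme := ⟨y, hV⟩
  have h1 := morphismRestrictStalkMap φ V y'
  have h2 : IsIso ((φ ∣_ V).stalkMap y') := inferInstance
  exact ((MorphismProperty.isomorphisms _).arrow_mk_iso_iff h1).mp h2

/-- A homeomorphism locally of finite type between locally Noetherian schemes is an isomorphism
at each point where it induces an isomorphism of local rings. -/
lemma isIsoAt_of_isIso_stalkMap [IsLocallyNoetherian Y] [IsLocallyNoetherian Z]
    [LocallyOfFiniteType φ] (hφ : IsHomeomorph φ) (y : Y) [IsIso (φ.stalkMap y)] :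
    IsIsoAt φ y := by
  obtain ⟨U, hU, g, hg, hgU⟩ := spread_out_of_isGermInjective' (𝟙 Z) φ (x := φ y)
    (Spec.map (inv (φ.stalkMap y)) ≫ Y.fromSpecStalk y) (by
      rw [Category.assoc, ← Scheme.SpecMap_stalkMap_fromSpecStalk, ← Spec.map_comp_assoc]
      simp)
  rw [Category.comp_id] at hgU
  have hyT : y ∈ φ ⁻¹ᵁ U := hU
  let y' : (φ ⁻¹ᵁ U).toScheme := ⟨y, hyT⟩
  have hsec : (φ ⁻¹ᵁ U).fromSpecStalkOfMem y hyT ≫ φ ∣_ U =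
      Spec.map (φ.stalkMap y) ≫ U.fromSpecStalkOfMem (φ y) hU := by
    rw [← cancel_mono U.ι, Category.assoc, morphismRestrict_ι, Category.assoc]
    simp
  have hagree : (φ ⁻¹ᵁ U).toScheme.fromSpecStalk y' ≫ φ ∣_ U ≫ g =
      (φ ⁻¹ᵁ U).toScheme.fromSpecStalk y' ≫ (φ ⁻¹ᵁ U).ι := by
    have h1 : (φ ⁻¹ᵁ U).fromSpecStalkOfMem y hyT ≫ φ ∣_ U ≫ g =
        (φ ⁻¹ᵁ U).fromSpecStalkOfMem y hyT ≫ (φ ⁻¹ᵁ U).ι := by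
      rw [reassoc_of% hsec, ← hg, ← Spec.map_comp_assoc]
      simp
    rw [Scheme.Opens.fromSpecStalkOfMem, Category.assoc, Category.assoc] at h1
    have : IsIso ((φ ⁻¹ᵁ U).ι.stalkMap y') := inferInstance
    exact (cancel_epi (Spec.map (inv ((φ ⁻¹ᵁ U).ι.stalkMap y')))).mp h1
  obtain ⟨W, hyW, hW⟩ := spread_out_unique_of_isGermInjective' _ _ hagree
  let V : Z.Opens := ⟨φ '' ((φ ⁻¹ᵁ U).ι ''ᵁ W), hφ.isOpenMap _ ((φ ⁻¹ᵁ U).ι ''ᵁ W).isOpen⟩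
  have hVU : V ≤ U := by
    rintro _ ⟨_, ⟨t, -, rfl⟩, rfl⟩
    exact t.2
  have hVW : φ ⁻¹ᵁ V = (φ ⁻¹ᵁ U).ι ''ᵁ W := Opens.ext (hφ.injective.preimage_image _)
  refine ⟨V, ⟨y, ⟨⟨y, hyT⟩, hyW, rfl⟩, rfl⟩, ?_⟩
  let r : V.toScheme ⟶ Y := Z.homOfLE hVU ≫ g
  have hr : r ≫ φ = V.ι := by simp [r, hgU]
  have hrange : Set.range r ⊆ Set.range (φ ⁻¹ᵁ V).ι := by
    rintro _ ⟨v, rfl⟩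
    rw [Scheme.Opens.range_ι]
    change φ (r v) ∈ V
    rw [← Scheme.Hom.comp_apply, hr]
    exact v.2
  let r' : V.toScheme ⟶ φ ⁻¹ᵁ V := IsOpenImmersion.lift (φ ⁻¹ᵁ V).ι r hrange
  have hr' : r' ≫ (φ ⁻¹ᵁ V).ι = r := IsOpenImmersion.lift_fac _ _ _
  refine ⟨r', ?_, ?_⟩
  · have hTV : φ ⁻¹ᵁ V ≤ φ ⁻¹ᵁ U := (Opens.map φ.base).monotone hVU
    let h := Y.homOfLE hTV
    have hh : Set.range h ⊆ Set.range W.ι := by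
      rintro _ ⟨v, rfl⟩
      rw [Scheme.Opens.range_ι]
      have hv : v.1 ∈ (φ ⁻¹ᵁ U).ι ''ᵁ W := hVW ▸ v.2
      obtain ⟨t, ht, htv⟩ := hv
      have : h v = t := by
        apply (φ ⁻¹ᵁ U).ι.isOpenEmbedding.injective
        exact congr($(Scheme.homOfLE_ι Y hTV) v).trans htv.symm
      rw [this]
      exact ht
    have h1 : φ ∣_ V ≫ Z.homOfLE hVU = h ≫ φ ∣_ U := by
      rw [← cancel_mono U.ι]
      simp [h]
    have h2 : h ≫ φ ∣_ U ≫ g = h ≫ (φ ⁻¹ᵁ U).ι := by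
      rw [← IsOpenImmersion.lift_fac W.ι h hh, Category.assoc, hW, Category.assoc]
    rw [← cancel_mono (φ ⁻¹ᵁ V).ι, Category.assoc, hr', Category.id_comp]
    change φ ∣_ V ≫ Z.homOfLE hVU ≫ g = _
    rw [reassoc_of% h1, h2]
    exact Scheme.homOfLE_ι _ _
  · rw [← cancel_mono V.ι, Category.assoc, morphismRestrict_ι, reassoc_of% hr', hr,
      Category.id_comp]

/-- An injective morphism that is an isomorphism at all points over the points of codimension at
most one is an isomorphism in codimension one. -/
lemma isIsoInCodimensionOne_of_isIsoAt (hφ : Function.Surjective φ)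
    (h : ∀ y, ringKrullDim (Z.presheaf.stalk (φ y)) ≤ 1 → IsIsoAt φ y) :
    IsIsoInCodimensionOne φ := by
  let V : Z.Opens := sSup {V : Z.Opens | IsIso (φ ∣_ V)}
  refine ⟨V, fun z hz ↦ ?_, ?_⟩
  · obtain ⟨y, rfl⟩ := hφ z
    obtain ⟨W, hW, hiso⟩ := h y hz
    exact Opens.mem_sSup.mpr ⟨W, hiso, hW⟩
  · let U (i : {V : Z.Opens | IsIso (φ ∣_ V)}) : V.toScheme.Opens := V.ι ⁻¹ᵁ i.1
    change MorphismProperty.isomorphisms _ (φ ∣_ V)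
    rw [IsZariskiLocalAtTarget.iff_of_iSup_eq_top (P := MorphismProperty.isomorphisms _) U]
    · intro i
      rw [(MorphismProperty.isomorphisms _).arrow_mk_iso_iff (morphismRestrictRestrict φ V (U i))]
      have : V.ι ''ᵁ U i = i.1 := by
        rw [Scheme.Hom.image_preimage_eq_opensRange_inf, Scheme.Opens.opensRange_ι]
        exact inf_eq_right.mpr (le_sSup i.2)
      rw [this]
      exact i.2
    · rw [← Scheme.Hom.preimage_iSup, ← sSup_eq_iSup']
      exact V.ι_preimage_self

end IsIsoAt
end AlgebraicGeometry

namespace AlgebraicGeometry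

lemma DerivationCompatible.iterate {A B : Type*} [CommRing A] [CommRing B] {φ : A →+* B}
    {D : Derivation ℤ A A} {E : Derivation ℤ B B} (h : DerivationCompatible φ D E) (n : ℕ) (a : A) :
    (⇑E)^[n] (φ a) = φ ((⇑D)^[n] a) := by
  induction n generalizing a with
  | zero => rfl
  | succ n ih => rw [Function.iterate_succ_apply, Function.iterate_succ_apply, h a, ih]

/-- A derivation that preserves the kernel of a surjection descends. -/
lemma exists_derivation_of_surjective {A B : Type*} [CommRing A] [CommRing B] {φ : A →+* B}
    (hφ : Function.Surjective φ) (D : Derivation ℤ A A) (hD : ∀ a, φ a = 0 → φ (D a) = 0) :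
    ∃ E : Derivation ℤ B B, DerivationCompatible φ D E := by
  let e : B → B := fun b ↦ φ (D (Function.surjInv hφ b))
  have he (a : A) : e (φ a) = φ (D a) := by
    rw [← sub_eq_zero, ← map_sub, ← map_sub]
    apply hD
    rw [map_sub, Function.surjInv_eq hφ, sub_self]
  refine ⟨Derivation.mk' (AddMonoidHom.toIntLinearMap (AddMonoidHom.mk' e ?_)) ?_, he⟩
  · intro a b
    obtain ⟨a, rfl⟩ := hφ a
    obtain ⟨b, rfl⟩ := hφ b
    rw [← map_add, he, he, he, map_add, map_add]
  · intro a b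
    obtain ⟨a, rfl⟩ := hφ a
    obtain ⟨b, rfl⟩ := hφ b
    change e (φ a * φ b) = φ a • e (φ b) + φ b • e (φ a)
    rw [← map_mul, he, he, he, Derivation.leibniz]
    simp

/-- Brackets and `p`-th powers of a dual frame vanish wherever they stay in its span. -/
lemma map_iterate_eq_zero_and_map_commutator_eq_zero {B C : Type*} [CommRing B] [CommRing C]
    {p n : ℕ} (hp : 2 ≤ p) (ρ : B →+* C) (D : Fin n → Derivation ℤ B B) (t : Fin n → B)
    (ht : ∀ i j, D i (t j) = if i = j then 1 else 0) (N : Submodule C (Derivation ℤ C C))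
    (hD : ∀ i, ∃ E ∈ N, DerivationCompatible ρ (D i) E)
    (hN : ∀ E ∈ N, ∃ c : Fin n → C, ∀ b, E (ρ b) = ∑ i, c i * ρ (D i b))
    (hlie : ∀ E ∈ N, ∀ E' ∈ N, ⁅E, E'⁆ ∈ N)
    (hpow : ∀ E ∈ N, ∃ E' ∈ N, ∀ a, E' a = (⇑E)^[p] a) :
    (∀ i b, ρ ((⇑(D i))^[p] b) = 0) ∧ ∀ i j b, ρ (D i (D j b) - D j (D i b)) = 0 := by
  choose E hE hDE using hD
  have key (E' : Derivation ℤ C C) (hE' : E' ∈ N) (h0 : ∀ l, E' (ρ (t l)) = 0) (b : B) :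
      E' (ρ b) = 0 := by
    obtain ⟨c, hc⟩ := hN E' hE'
    rw [hc]
    refine Finset.sum_eq_zero fun l _ ↦ ?_
    have h1 := hc (t l)
    simp only [h0, ht, apply_ite ρ, map_one, map_zero, mul_ite, mul_one, mul_zero,
      Finset.sum_ite_eq', Finset.mem_univ, if_true] at h1
    rw [← h1, zero_mul]
  have hDt (i j l : Fin n) : D i (D j (t l)) = 0 := by
    rw [ht]
    split_ifs <;> simp
  refine ⟨fun i b ↦ ?_, fun i j b ↦ ?_⟩
  · obtain ⟨E', hE', hpE'⟩ := hpow (E i) (hE i)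
    rw [← (hDE i).iterate, ← hpE']
    refine key E' hE' (fun l ↦ ?_) b
    rw [hpE', (hDE i).iterate]
    obtain ⟨q, rfl⟩ := Nat.exists_eq_add_of_le' hp
    have h2 (m : ℕ) : (⇑(D i))^[m] 0 = 0 := by
      induction m with
      | zero => rfl
      | succ m ih => rw [Function.iterate_succ_apply, map_zero, ih]
    rw [Function.iterate_add_apply]
    change ρ ((⇑(D i))^[q] (D i (D i (t l)))) = 0
    rw [hDt, h2, map_zero]
  · have h3 (b : B) : ⁅E i, E j⁆ (ρ b) = ρ (D i (D j b) - D j (D i b)) := by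
      rw [Derivation.commutator_apply, hDE, hDE, hDE, hDE, map_sub]
    rw [← h3]
    refine key _ (hlie _ (hE i) _ (hE j)) (fun l ↦ ?_) b
    rw [h3, hDt, hDt, sub_zero, map_zero]

/-- A stalk at a generization is a localization. -/
lemma isLocalization_stalkSpecializes {X : Scheme.{u}} {x y : X} (h : y ⤳ x) :
    letI := (X.presheaf.stalkSpecializes h).hom.toAlgebra
    IsLocalization ((IsLocalRing.maximalIdeal (X.presheaf.stalk y)).comap
      (X.presheaf.stalkSpecializes h).hom).primeCompl (X.presheaf.stalk y) := by
  let _ := (X.presheaf.stalkSpecializes h).hom.toAlgebra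
  obtain ⟨_, ⟨U, hU, rfl⟩, hxU, -⟩ :=
    X.isBasis_affineOpens.exists_subset_of_mem_open (Set.mem_univ x) isOpen_univ
  have hyU : y ∈ U := h.mem_open U.2 hxU
  let _ : Algebra Γ(X, U) (X.presheaf.stalk x) := (X.presheaf.germ U x hxU).hom.toAlgebra
  let _ : Algebra Γ(X, U) (X.presheaf.stalk y) := (X.presheaf.germ U y hyU).hom.toAlgebra
  have h1 := hU.isLocalization_stalk ⟨x, hxU⟩
  have h2 := hU.isLocalization_stalk ⟨y, hyU⟩
  have hsp : X.presheaf.germ U x hxU ≫ X.presheaf.stalkSpecializes h = X.presheaf.germ U y hyU :=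
    X.presheaf.germ_stalkSpecializes hxU h
  have : IsScalarTower Γ(X, U) (X.presheaf.stalk x) (X.presheaf.stalk y) :=
    .of_algebraMap_eq fun a ↦ (congr($(hsp).hom a)).symm
  set M := (hU.primeIdealOf ⟨x, hxU⟩).asIdeal.primeCompl
  set N := (hU.primeIdealOf ⟨y, hyU⟩).asIdeal.primeCompl
  have hMN : M ≤ N := by
    intro a ha
    have h3 : IsUnit (algebraMap Γ(X, U) (X.presheaf.stalk x) a) :=
      IsLocalization.map_units (X.presheaf.stalk x) (⟨a, ha⟩ : M)
    have h4 := h3.map (algebraMap (X.presheaf.stalk x) (X.presheaf.stalk y))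
    rw [← IsScalarTower.algebraMap_apply] at h4
    exact (IsLocalization.AtPrime.isUnit_to_map_iff (X.presheaf.stalk y)
      (hU.primeIdealOf ⟨y, hyU⟩).asIdeal a).mp h4
  have h5 := IsLocalization.isLocalization_of_submonoid_le (X.presheaf.stalk x)
    (X.presheaf.stalk y) M N hMN
  refine IsLocalization.of_le (N.map (algebraMap Γ(X, U) (X.presheaf.stalk x))) _ ?_ ?_
  · rintro _ ⟨a, ha, rfl⟩
    have h6 : IsUnit (algebraMap Γ(X, U) (X.presheaf.stalk y) a) :=
      IsLocalization.map_units (X.presheaf.stalk y) (⟨a, ha⟩ : N)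
    rw [IsScalarTower.algebraMap_apply Γ(X, U) (X.presheaf.stalk x)] at h6
    exact fun h7 ↦ (IsLocalRing.mem_maximalIdeal _).mp h7 h6
  · intro a ha
    exact not_not.mp ha

/-- Primes of the local ring at `x` are kernels of specialization maps. -/
lemma exists_comap_stalkSpecializes_eq {X : Scheme.{u}} (x : X)
    (P : Ideal (X.presheaf.stalk x)) [hP : P.IsPrime] : ∃ (y : X) (h : y ⤳ x),
      (IsLocalRing.maximalIdeal (X.presheaf.stalk y)).comap
        (X.presheaf.stalkSpecializes h).hom = P := by
  let P' : PrimeSpectrum (X.presheaf.stalk x) := ⟨P, hP⟩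
  let y := X.fromSpecStalk x P'
  have h : y ⤳ x := by
    have : y ∈ Set.range (X.fromSpecStalk x) := ⟨P', rfl⟩
    rwa [X.range_fromSpecStalk] at this
  refine ⟨y, h, ?_⟩
  have h1 := congr($(X.SpecMap_stalkSpecializes_fromSpecStalk h)
    (IsLocalRing.closedPoint (X.presheaf.stalk y)))
  have h2 : Spec.map (X.presheaf.stalkSpecializes h)
      (IsLocalRing.closedPoint (X.presheaf.stalk y)) = P' := by
    apply (X.fromSpecStalk x).isEmbedding.injective
    exact h1.trans Scheme.fromSpecStalk_closedPoint
  exact congr_arg PrimeSpectrum.asIdeal h2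

/-- If the contraction to the base of a prime of a stalk is zero, then the base is a field at the
corresponding generization. -/
lemma maximalIdeal_stalk_eq_bot_of_comap_eq_bot {X S : Scheme.{u}} (f : X ⟶ S) {x y : X} (h : y ⤳ x)
    (h0 : ∀ a, (X.presheaf.stalkSpecializes h).hom ((f.stalkMap x).hom a) ∈
      IsLocalRing.maximalIdeal (X.presheaf.stalk y) → a = 0) :
    IsLocalRing.maximalIdeal (S.presheaf.stalk (f y)) = ⊥ := by
  have hf : f y ⤳ f x := h.map f.continuous
  let _ := (S.presheaf.stalkSpecializes hf).hom.toAlgebra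
  have hloc := isLocalization_stalkSpecializes hf
  rw [eq_bot_iff]
  intro c hc
  obtain ⟨⟨a, m⟩, ham⟩ := IsLocalization.surj ((IsLocalRing.maximalIdeal
    (S.presheaf.stalk (f y))).comap (S.presheaf.stalkSpecializes hf).hom).primeCompl c
  have hnat (a) : (f.stalkMap y).hom ((S.presheaf.stalkSpecializes hf).hom a) =
      (X.presheaf.stalkSpecializes h).hom ((f.stalkMap x).hom a) :=
    congr($(f.stalkSpecializes_stalkMap y x h).hom a)
  have h1 : (S.presheaf.stalkSpecializes hf).hom a ∈
      IsLocalRing.maximalIdeal (S.presheaf.stalk (f y)) := by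
    have : (S.presheaf.stalkSpecializes hf).hom a = c * _ := ham.symm
    rw [this]
    exact Ideal.mul_mem_right _ _ hc
  have h2 : a = 0 := by
    apply h0
    rw [← hnat]
    exact IsLocalRing.map_maximalIdeal_le (f.stalkMap y).hom (Ideal.mem_map_of_mem _ h1)
  have hm := IsLocalization.map_units (S.presheaf.stalk (f y)) m
  simp only [h2, map_zero] at ham
  exact hm.mul_left_eq_zero.mp ham

namespace TangentSubsheaf

variable {X S : Scheme.{u}} {f : X ⟶ S} (F : TangentSubsheaf f)

lemma fg_stalk (x : X) : (F.stalk x).FG := by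
  obtain ⟨U, hU, hxU, G, hG, hspan⟩ := F.coherent x
  choose e he using exists_germ_derivation hU x hxU
  rw [hspan x hxU]
  refine ⟨(hG.image e).toFinset, ?_⟩
  rw [Set.Finite.coe_toFinset]
  congr 1
  let _ : Algebra Γ(X, U) (X.presheaf.stalk x) := (X.presheaf.germ U x hxU).hom.toAlgebra
  have hloc := hU.isLocalization_stalk ⟨x, hxU⟩
  ext E
  constructor
  · rintro ⟨D, hD, rfl⟩
    exact ⟨D, hD, he D⟩
  · rintro ⟨D, hD, hDE⟩
    refine ⟨D, hD, ?_⟩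
    ext b
    exact (derivation_eq_of_isLocalization (A := Γ(X, U))
      (hU.primeIdealOf ⟨x, hxU⟩).asIdeal.primeCompl (RingHom.id _) (e D) E
      (fun a ↦ (hDE a).trans (he D a).symm) b).symm

lemma germ_derivation_compatible {U : X.Opens} (hU : IsAffineOpen U) {x y : X} (h : y ⤳ x)
    (hx : x ∈ U) (hy : y ∈ U) {D : Derivation ℤ Γ(X, U) Γ(X, U)} {E E'}
    (hE : DerivationCompatible (X.presheaf.germ U x hx).hom D E)
    (hE' : DerivationCompatible (X.presheaf.germ U y hy).hom D E') :
    DerivationCompatible (X.presheaf.stalkSpecializes h).hom E E' := by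
  let _ : Algebra Γ(X, U) (X.presheaf.stalk x) := (X.presheaf.germ U x hx).hom.toAlgebra
  have hloc := hU.isLocalization_stalk ⟨x, hx⟩
  have hsp (a : Γ(X, U)) : (X.presheaf.stalkSpecializes h).hom ((X.presheaf.germ U x hx).hom a) =
      (X.presheaf.germ U y hy).hom a := congr($(X.presheaf.germ_stalkSpecializes hx h).hom a)
  refine derivation_eq_of_isLocalization (A := Γ(X, U))
      (hU.primeIdealOf ⟨x, hx⟩).asIdeal.primeCompl _ _ _ fun a ↦ ?_
  change E' ((X.presheaf.stalkSpecializes h).hom ((X.presheaf.germ U x hx).hom a)) =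
    (X.presheaf.stalkSpecializes h).hom (E ((X.presheaf.germ U x hx).hom a))
  rw [hE, hsp, hsp, hE']

lemma exists_stalkSpecializes_compatible {x y : X} (h : y ⤳ x) {D} (hD : D ∈ F.stalk x) :
    ∃ D' ∈ F.stalk y, DerivationCompatible (X.presheaf.stalkSpecializes h).hom D D' := by
  obtain ⟨U, hU, hx, G, hG, hspan⟩ := F.coherent x
  have hy : y ∈ U := h.mem_open U.2 hx
  rw [hspan x hx] at hD
  induction hD using Submodule.span_induction with
  | zero => exact ⟨0, zero_mem _, fun a ↦ by simp⟩
  | add D₁ D₂ _ _ h₁ h₂ =>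
    obtain ⟨E₁, hE₁, hc₁⟩ := h₁
    obtain ⟨E₂, hE₂, hc₂⟩ := h₂
    exact ⟨E₁ + E₂, add_mem hE₁ hE₂, fun a ↦ by
      rw [Derivation.add_apply, Derivation.add_apply, map_add, hc₁, hc₂]⟩
  | smul c D _ h' =>
    obtain ⟨E', hE', hc⟩ := h'
    exact ⟨(X.presheaf.stalkSpecializes h).hom c • E', Submodule.smul_mem _ _ hE', fun a ↦ by
      rw [Derivation.smul_apply, Derivation.smul_apply, smul_eq_mul, smul_eq_mul, map_mul, hc]⟩
  | mem E hE =>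
    obtain ⟨D, hD, hDE⟩ := hE
    obtain ⟨E', hE'⟩ := exists_germ_derivation hU y hy D
    refine ⟨E', ?_, germ_derivation_compatible hU h hx hy hDE hE'⟩
    rw [hspan y hy]
    exact Submodule.subset_span ⟨D, hD, hE'⟩

lemma exists_stalkSpecializes_eq_sum {x y : X} (h : y ⤳ x) {n : ℕ}
    (D : Fin n → Derivation ℤ (X.presheaf.stalk x) (X.presheaf.stalk x))
    (hD : Submodule.span (X.presheaf.stalk x) (Set.range D) = F.stalk x) {E}
    (hE : E ∈ F.stalk y) : ∃ c : Fin n → X.presheaf.stalk y, ∀ b,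
      E ((X.presheaf.stalkSpecializes h).hom b) =
        ∑ i, c i * (X.presheaf.stalkSpecializes h).hom (D i b) := by
  obtain ⟨U, hU, hx, G, hG, hspan⟩ := F.coherent x
  have hy : y ∈ U := h.mem_open U.2 hx
  rw [hspan y hy] at hE
  induction hE using Submodule.span_induction with
  | zero => exact ⟨0, fun b ↦ by simp⟩
  | add D₁ D₂ _ _ h₁ h₂ =>
    obtain ⟨c₁, hc₁⟩ := h₁
    obtain ⟨c₂, hc₂⟩ := h₂
    exact ⟨c₁ + c₂, fun b ↦ by
      simp only [Derivation.add_apply, hc₁, hc₂, Pi.add_apply, add_mul, Finset.sum_add_distrib]⟩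
  | smul a D _ h' =>
    obtain ⟨c, hc⟩ := h'
    exact ⟨a • c, fun b ↦ by
      simp only [Derivation.smul_apply, hc, Pi.smul_apply, smul_eq_mul, Finset.mul_sum, mul_assoc]⟩
  | mem E' hE' =>
    obtain ⟨D₀, hD₀, hDE⟩ := hE'
    obtain ⟨E₀, hE₀⟩ := exists_germ_derivation hU x hx D₀
    have hE₀F : E₀ ∈ Submodule.span (X.presheaf.stalk x) (Set.range D) := by
      rw [hD, hspan x hx]
      exact Submodule.subset_span ⟨D₀, hD₀, hE₀⟩
    obtain ⟨c, hc⟩ := (Submodule.mem_span_range_iff_exists_fun _).mp hE₀F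
    refine ⟨fun i ↦ (X.presheaf.stalkSpecializes h).hom (c i), fun b ↦ ?_⟩
    rw [germ_derivation_compatible hU h hx hy hE₀ hDE, ← hc,
      ← Derivation.coeFnAddMonoidHom_apply, map_sum, Finset.sum_apply, map_sum]
    simp

variable (s : S)

/-- Elements of `ℱ` descend to the fibres. -/
lemma exists_fiber_compatible (x : f.fiber s) {D} (hD : D ∈ F.stalk (f.fiberι s x)) :
    ∃ E ∈ (F.fiber s).stalk x, DerivationCompatible ((f.fiberι s).stalkMap x).hom D E := by
  have hsurj : Function.Surjective ((f.fiberι s).stalkMap x).hom :=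
    (f.fiberι s).stalkMap_surjective x
  obtain ⟨E, hE⟩ := exists_derivation_of_surjective hsurj D fun b hb ↦ by
    have h1 := mem_map_maximalIdeal_of_fiberι_stalkMap_eq_zero f s x b hb
    clear hb
    have h0 (b) (hb : b ∈ (IsLocalRing.maximalIdeal (S.presheaf.stalk (f (f.fiberι s x)))).map
        (f.stalkMap (f.fiberι s x)).hom) : ((f.fiberι s).stalkMap x).hom b = 0 := by
      refine (Ideal.map_le_iff_le_comap (K := RingHom.ker ((f.fiberι s).stalkMap x).hom)).mpr ?_ hb
      exact fun a ha ↦ fiberι_stalkMap_stalkMap_eq_zero f s x ha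
    induction h1 using Submodule.span_induction with
    | zero => simp
    | add a b _ _ ha hb => rw [map_add, map_add, ha, hb, add_zero]
    | smul a b hb' hb =>
      rw [smul_eq_mul, Derivation.leibniz, map_add, smul_eq_mul, smul_eq_mul, map_mul, map_mul, hb,
        h0 b hb', mul_zero, zero_mul, add_zero]
    | mem b hb =>
      obtain ⟨a, -, rfl⟩ := hb
      rw [F.stalk_le _ hD a, map_zero]
  refine ⟨E, Submodule.subset_span ⟨?_, D, hD, hE⟩, hE⟩
  have key (h h' : f.fiber s ⟶ S) (hh : h = h') (H : ∀ a, E ((h.stalkMap x).hom a) = 0) (a) :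
      E ((h'.stalkMap x).hom a) = 0 := by
    subst hh
    exact H a
  intro a
  obtain ⟨a, rfl⟩ := (S.fromSpecResidueField s).stalkMap_surjective
    (f.fiberToSpecResidueField s x) a
  refine Eq.trans ?_ (key _ _ (f.fiber_fac s) ?_ a)
  · exact congr_arg E (congr($(Scheme.Hom.stalkMap_comp (f.fiberToSpecResidueField s)
      (S.fromSpecResidueField s) x).hom a)).symm
  · intro a
    refine (congr_arg E (congr($(Scheme.Hom.stalkMap_comp (f.fiberι s) f x).hom a))).trans ?_
    refine (hE _).trans ?_
    exact (congr_arg _ (F.stalk_le _ hD a)).trans (map_zero _)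

/-- Elements of `ℱ_s` lift to `ℱ`. -/
lemma exists_lift_compatible (x : f.fiber s) {E} (hE : E ∈ (F.fiber s).stalk x) :
    ∃ D ∈ F.stalk (f.fiberι s x), DerivationCompatible ((f.fiberι s).stalkMap x).hom D E := by
  have hsurj : Function.Surjective ((f.fiberι s).stalkMap x).hom :=
    (f.fiberι s).stalkMap_surjective x
  change E ∈ F.fiberStalk s x at hE
  induction hE using Submodule.span_induction with
  | zero => exact ⟨0, zero_mem _, fun a ↦ by simp⟩
  | add E₁ E₂ _ _ h₁ h₂ =>
    obtain ⟨D₁, hD₁, hc₁⟩ := h₁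
    obtain ⟨D₂, hD₂, hc₂⟩ := h₂
    exact ⟨D₁ + D₂, add_mem hD₁ hD₂, fun a ↦ by
      rw [Derivation.add_apply, Derivation.add_apply, map_add, hc₁, hc₂]⟩
  | smul c E _ h =>
    obtain ⟨D, hD, hc⟩ := h
    obtain ⟨c, rfl⟩ := hsurj c
    exact ⟨c • D, Submodule.smul_mem _ _ hD, fun a ↦ by
      rw [Derivation.smul_apply, Derivation.smul_apply, smul_eq_mul, smul_eq_mul, map_mul, hc]⟩
  | mem E hE =>
    obtain ⟨-, D, hD, hDE⟩ := hE
    exact ⟨D, hD, hDE⟩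

/-- If `𝒪_S` is a field below a point of a fibre, then that fibre has the same local ring. -/
lemma fiberι_stalkMap_injective (w : f.fiber s)
    (hw : IsLocalRing.maximalIdeal (S.presheaf.stalk (f (f.fiberι s w))) = ⊥) :
    Function.Injective ((f.fiberι s).stalkMap w).hom := by
  rw [injective_iff_map_eq_zero]
  intro b hb
  have := mem_map_maximalIdeal_of_fiberι_stalkMap_eq_zero f s w b hb
  rwa [hw, Ideal.map_bot] at this

variable {F}

/-- A dual frame of `ℱ` commutes and its members have vanishing `p`-th powers, if the base is
integral and the fibres of `ℱ` are `1`-foliations. -/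
lemma iterate_eq_zero_and_comm_of_dual [Flat f] {p r : ℕ} (hp : 2 ≤ p)
    (hF : ∀ s, (F.fiber s).IsOneFoliation p r) (x : X) [IsNoetherianRing (X.presheaf.stalk x)]
    [IsDomain (S.presheaf.stalk (f x))] {n : ℕ}
    (D : Fin n → Derivation ℤ (X.presheaf.stalk x) (X.presheaf.stalk x))
    (hD : Submodule.span (X.presheaf.stalk x) (Set.range D) = F.stalk x)
    (t : Fin n → X.presheaf.stalk x) (ht : ∀ i j, D i (t j) = if i = j then 1 else 0) :
    (∀ i b, (⇑(D i))^[p] b = 0) ∧ ∀ i j b, D i (D j b) = D j (D i b) := by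
  let _ : Algebra (S.presheaf.stalk (f x)) (X.presheaf.stalk x) := (f.stalkMap x).hom.toAlgebra
  have hflat : Module.Flat (S.presheaf.stalk (f x)) (X.presheaf.stalk x) := Flat.stalkMap f x
  have hDn (i) : D i ∈ F.stalk x := hD ▸ Submodule.subset_span ⟨i, rfl⟩
  have key (P : Ideal (X.presheaf.stalk x)) [P.IsPrime]
      (hP : P.comap (algebraMap (S.presheaf.stalk (f x)) (X.presheaf.stalk x)) = ⊥) :
      (∀ i b, ∃ u ∉ P, u * (⇑(D i))^[p] b = 0) ∧
        ∀ i j b, ∃ u ∉ P, u * (D i (D j b) - D j (D i b)) = 0 := by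
    obtain ⟨y, h, hyP⟩ := exists_comap_stalkSpecializes_eq x P
    obtain ⟨η, w, rfl⟩ : ∃ (η : S) (w : f.fiber η), f.fiberι η w = y := by
      have : y ∈ Set.range (f.fiberι (f y)) := by rw [f.range_fiberι]; rfl
      exact ⟨f y, this⟩
    have hbot : IsLocalRing.maximalIdeal (S.presheaf.stalk (f (f.fiberι η w))) = ⊥ := by
      refine maximalIdeal_stalk_eq_bot_of_comap_eq_bot f h fun a ha ↦ ?_
      have h1 : a ∈ P.comap (algebraMap (S.presheaf.stalk (f x)) (X.presheaf.stalk x)) := by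
        rw [← hyP]
        exact ha
      rwa [hP] at h1
    have hinj := fiberι_stalkMap_injective η w hbot
    set ρ := ((f.fiberι η).stalkMap w).hom.comp (X.presheaf.stalkSpecializes h).hom
    have hρ (c) (hc : ρ c = 0) : ∃ u ∉ P, u * c = 0 := by
      have h1 : (X.presheaf.stalkSpecializes h).hom c = 0 := by
        apply hinj
        rw [map_zero]
        exact hc
      let _ := (X.presheaf.stalkSpecializes h).hom.toAlgebra
      have hloc := isLocalization_stalkSpecializes h
      obtain ⟨u, hu⟩ := hloc.exists_of_eq (x := c) (y := 0) (h1.trans (map_zero _).symm)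
      exact ⟨u, fun hP ↦ u.2 (hyP ▸ hP), hu.trans (mul_zero _)⟩
    have := map_iterate_eq_zero_and_map_commutator_eq_zero hp ρ D t ht ((F.fiber η).stalk w)
      (fun i ↦ by
        obtain ⟨D', hD', hc⟩ := F.exists_stalkSpecializes_compatible h (hDn i)
        obtain ⟨E, hE, hc'⟩ := F.exists_fiber_compatible η w hD'
        exact ⟨E, hE, fun a ↦ (hc' _).trans (congr_arg _ (hc a))⟩)
      (fun E hE ↦ by
        obtain ⟨D', hD', hc⟩ := F.exists_lift_compatible η w hE
        obtain ⟨c, hc'⟩ := F.exists_stalkSpecializes_eq_sum h D hD hD'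
        refine ⟨fun i ↦ ((f.fiberι η).stalkMap w).hom (c i), fun b ↦ ?_⟩
        refine (hc _).trans ?_
        rw [hc', map_sum]
        simp [ρ])
      ((hF η).lie_mem w) ((hF η).pow_mem w)
    exact ⟨fun i b ↦ hρ _ (this.1 i b), fun i j b ↦ hρ _ (this.2 i j b)⟩
  refine ⟨fun i b ↦ ?_, fun i j b ↦ sub_eq_zero.mp ?_⟩
  · exact eq_zero_of_forall_prime_comap_eq_bot (A := S.presheaf.stalk (f x)) _
      fun P _ hP ↦ (key P hP).1 i b
  · exact eq_zero_of_forall_prime_comap_eq_bot (A := S.presheaf.stalk (f x)) _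
      fun P _ hP ↦ (key P hP).2 i j b

end TangentSubsheaf
end AlgebraicGeometry

namespace AlgebraicGeometry

lemma ringKrullDim_le_of_forall_pow_mem_range {A B : Type*} [CommRing A] [CommRing B] (θ : A →+* B)
    (n : ℕ) (h : ∀ b, ∃ a, θ a = b ^ n) (hn : n ≠ 0) : ringKrullDim B ≤ ringKrullDim A := by
  refine Order.krullDim_le_of_strictMono (PrimeSpectrum.comap θ)
    (Monotone.strictMono_of_injective (fun P Q hPQ ↦ Ideal.comap_mono hPQ) fun P Q hPQ ↦ ?_)
  ext b
  obtain ⟨a, ha⟩ := h b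
  have h1 (P : PrimeSpectrum B) : b ∈ P.asIdeal ↔ a ∈ (PrimeSpectrum.comap θ P).asIdeal := by
    rw [PrimeSpectrum.comap_asIdeal, Ideal.mem_comap, ha]
    exact (P.isPrime.pow_mem_iff_mem _ (Nat.pos_of_ne_zero hn)).symm
  rw [h1, h1, hPQ]

/-- If there is a `C`-linear projection `B → C`, then `I B ∩ C = I C`. -/
lemma mem_map_of_mem_map_comp {A B C : Type*} [CommRing A] [CommRing B] [CommRing C] (g : A →+* C)
    (q : C →+* B) (hq : Function.Injective q) (E : B →+ B) (hE : ∀ b, ∃ c, q c = E b)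
    (hlin : ∀ c b, E (q c * b) = q c * E b) (hid : ∀ c, E (q c) = q c) (I : Ideal A) {c : C}
    (h : q c ∈ I.map (q.comp g)) : c ∈ I.map g := by
  have key (b : B) (hb : b ∈ I.map (q.comp g)) (a : B) : ∃ c ∈ I.map g, q c = E (a * b) := by
    induction hb using Submodule.span_induction generalizing a with
    | zero => exact ⟨0, zero_mem _, by simp⟩
    | add b b' _ _ hb hb' =>
      obtain ⟨c, hc, hcb⟩ := hb a
      obtain ⟨c', hc', hcb'⟩ := hb' a
      exact ⟨c + c', add_mem hc hc', by rw [map_add, hcb, hcb', mul_add, map_add]⟩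
    | smul a' b _ hb =>
      obtain ⟨c, hc, hcb⟩ := hb (a * a')
      exact ⟨c, hc, by rw [hcb, smul_eq_mul, mul_assoc]⟩
    | mem b hb =>
      obtain ⟨i, hi, rfl⟩ := hb
      obtain ⟨c, hc⟩ := hE a
      exact ⟨g i * c, Ideal.mul_mem_right _ _ (Ideal.mem_map_of_mem g hi), by
        rw [map_mul, hc, mul_comm a, RingHom.comp_apply, hlin]⟩
  obtain ⟨c', hc', hcc'⟩ := key _ h 1
  rw [one_mul, hid] at hcc'
  rwa [← hq hcc']

section square

variable {V₁ V₂ V₃ V₄ W : Scheme.{u}} {a : V₁ ⟶ V₂} {b : V₂ ⟶ V₃} {c : V₃ ⟶ W} {a' : V₁ ⟶ V₄}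
  {b' : V₄ ⟶ W}

lemma exists_stalkMap_stalkMap_eq (e : (a ≫ b) ≫ c = a' ≫ b') (v : V₁)
    (d : W.presheaf.stalk (b' (a' v))) : ∃ d' : V₃.presheaf.stalk (b (a v)),
      (a.stalkMap v).hom ((b.stalkMap (a v)).hom d') =
        (a'.stalkMap v).hom ((b'.stalkMap (a' v)).hom d) := by
  have key (h h' : V₁ ⟶ W) (e : h = h') (d : W.presheaf.stalk (h' v)) :
      ∃ d' : W.presheaf.stalk (h v), (h.stalkMap v).hom d' = (h'.stalkMap v).hom d := by
    subst e
    exact ⟨d, rfl⟩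
  obtain ⟨d', hd'⟩ := key _ _ e d
  refine ⟨(c.stalkMap (b (a v))).hom d', ?_⟩
  rw [Scheme.Hom.stalkMap_comp (a ≫ b) c, Scheme.Hom.stalkMap_comp a b,
    Scheme.Hom.stalkMap_comp a' b'] at hd'
  exact hd'

lemma mem_of_stalkMap_eq_zero (e : (a ≫ b) ≫ c = a' ≫ b') (v : V₁)
    (J : ∀ w : W, Ideal (W.presheaf.stalk w))
    (h : ∀ d : W.presheaf.stalk (b' (a' v)),
      (a'.stalkMap v).hom ((b'.stalkMap (a' v)).hom d) = 0 → d ∈ J _)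
    {d : W.presheaf.stalk (c (b (a v)))}
    (hd : (a.stalkMap v).hom ((b.stalkMap (a v)).hom ((c.stalkMap (b (a v))).hom d)) = 0) :
    d ∈ J _ := by
  have key (h h' : V₁ ⟶ W) (e : h = h')
      (H : ∀ d : W.presheaf.stalk (h' v), (h'.stalkMap v).hom d = 0 → d ∈ J _)
      (d : W.presheaf.stalk (h v)) (hd : (h.stalkMap v).hom d = 0) : d ∈ J _ := by
    subst e
    exact H d hd
  refine key _ _ e (fun d hd ↦ h d ?_) d ?_
  · rw [Scheme.Hom.stalkMap_comp a' b'] at hd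
    exact hd
  · rw [Scheme.Hom.stalkMap_comp (a ≫ b) c, Scheme.Hom.stalkMap_comp a b]
    exact hd

lemma map_maximalIdeal_stalkMap_of_comp_eq {a' : V₁ ⟶ V₄} {b' : V₄ ⟶ W} {h : V₁ ⟶ W}
    (e : a' ≫ b' = h) (v : V₁) :
    (IsLocalRing.maximalIdeal (W.presheaf.stalk (h v))).map (h.stalkMap v).hom =
      (IsLocalRing.maximalIdeal (W.presheaf.stalk (b' (a' v)))).map
        ((a'.stalkMap v).hom.comp (b'.stalkMap (a' v)).hom) := by
  subst e
  rw [Scheme.Hom.stalkMap_comp]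
  rfl

end square

namespace TangentSubsheaf

variable {X S : Scheme.{u}} {f : X ⟶ S} {F : TangentSubsheaf f}

namespace IsFamilyOfOneFoliations

variable {p r : ℕ} {s : S}

lemma mem_maximalIdeal_smul_stalk (hF : F.IsFamilyOfOneFoliations p r) (x : f.fiber s) {D}
    (hD : D ∈ F.stalk (f.fiberι s x)) (h0 : DerivationCompatible ((f.fiberι s).stalkMap x).hom D 0) :
    D ∈ IsLocalRing.maximalIdeal (X.presheaf.stalk (f.fiberι s x)) • F.stalk (f.fiberι s x) := by
  have h1 := mem_smul_of_flat_quotient _ _ _ (hF.flat_quotient (f.fiberι s x)) _ hD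
    (hF.tangent_injective s x D (F.stalk_le _ hD) h0)
  exact Submodule.smul_mono_left (IsLocalRing.map_maximalIdeal_le _) h1

/-- In codimension at most one, `ℱ` has a basis that is dual to a system of elements. -/
lemma exists_dual (hF : F.IsFamilyOfOneFoliations p r) (x : f.fiber s)
    [IsNoetherianRing ((f.fiber s).presheaf.stalk x)]
    (hx : ringKrullDim ((f.fiber s).presheaf.stalk x) ≤ 1) :
    ∃ (n : ℕ) (D : Fin n → Derivation ℤ (X.presheaf.stalk (f.fiberι s x))
        (X.presheaf.stalk (f.fiberι s x))) (t : Fin n → X.presheaf.stalk (f.fiberι s x)),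
      Submodule.span (X.presheaf.stalk (f.fiberι s x)) (Set.range D) = F.stalk (f.fiberι s x) ∧
        ∀ i j, D i (t j) = if i = j then 1 else 0 := by
  obtain ⟨_, _⟩ := fiber_of_geometrically hF.geometricallyNormal s x
  have := isPrincipalIdealRing_of_ringKrullDim_le_one hx
  obtain ⟨n, D, t, -, hD, ht⟩ := exists_span_eq_dual ((f.fiberι s).stalkMap x).hom
    ((f.fiberι s).stalkMap_surjective x) (F.stalk (f.fiberι s x)) ((F.fiber s).stalk x)
    (F.fg_stalk _) ((F.fiber s).fg_stalk _)
    (fun a ha E hE ↦ (hF.fiber s).saturated x a (mem_nonZeroDivisors_of_ne_zero ha) E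
      (fun c ↦ by
        have h1 := (F.fiber s).stalk_le x hE c
        rw [Derivation.smul_apply, smul_eq_mul] at h1
        exact (mul_eq_zero.mp h1).resolve_left ha) hE)
    (fun D hD ↦ F.exists_fiber_compatible s x hD) (fun E hE ↦ F.exists_lift_compatible s x hE)
    (fun D hD h0 ↦ hF.mem_maximalIdeal_smul_stalk x hD h0)
  exact ⟨n, D, t, hD, ht⟩

/-- In codimension at most one, there is a projection onto the sections annihilated by `ℱ` which is
compatible with restriction to the fibre. -/
lemma exists_constantsProjection [hp : Fact p.Prime] (hX : X.OfChar p) [IsLocallyNoetherian S]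
    (hF : F.IsFamilyOfOneFoliations p r) (hreg : IsRegularScheme S) (x : f.fiber s)
    (hx : ringKrullDim ((f.fiber s).presheaf.stalk x) ≤ 1) :
    ∃ E : X.presheaf.stalk (f.fiberι s x) →+ X.presheaf.stalk (f.fiberι s x),
      (∀ b, ∀ D ∈ F.stalk (f.fiberι s x), D (E b) = 0) ∧
      (∀ a b, (∀ D ∈ F.stalk (f.fiberι s x), D a = 0) → E (a * b) = a * E b) ∧
      (∀ b, (∀ D ∈ F.stalk (f.fiberι s x), D b = 0) → E b = b) ∧
      ∀ b, (∀ D ∈ F.stalk (f.fiberι s x), ((f.fiberι s).stalkMap x).hom (D b) = 0) →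
        ((f.fiberι s).stalkMap x).hom (E b) = ((f.fiberι s).stalkMap x).hom b := by
  have := hF.flat
  have := hF.locallyOfFiniteType
  have : IsLocallyNoetherian X := LocallyOfFiniteType.isLocallyNoetherian f
  have : LocallyOfFiniteType (f.fiberToSpecResidueField s) :=
    inferInstanceAs (LocallyOfFiniteType (pullback.snd _ _))
  have : IsLocallyNoetherian (f.fiber s) :=
    LocallyOfFiniteType.isLocallyNoetherian (f.fiberToSpecResidueField s)
  have := hreg (f (f.fiberι s x))
  have := IsRegularLocalRing.isDomain (S.presheaf.stalk (f (f.fiberι s x)))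
  obtain ⟨n, D, t, hD, ht⟩ := hF.exists_dual x hx
  have hDn (i) : D i ∈ F.stalk (f.fiberι s x) := hD ▸ Submodule.subset_span ⟨i, rfl⟩
  have hDspan (b) (hb : ∀ i ∈ Finset.univ, D i b = 0) (E) (hE : E ∈ F.stalk (f.fiberι s x)) :
      E b = 0 := by
    rw [← hD] at hE
    induction hE using Submodule.span_induction with
    | zero => rfl
    | add D₁ D₂ _ _ h₁ h₂ => rw [Derivation.add_apply, h₁, h₂, add_zero]
    | smul c D _ h => rw [Derivation.smul_apply, h, smul_zero]
    | mem E hE =>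
      obtain ⟨i, rfl⟩ := hE
      exact hb i (Finset.mem_univ i)
  obtain ⟨hpow, hcomm⟩ :=
    iterate_eq_zero_and_comm_of_dual hp.out.two_le hF.fiber (f.fiberι s x) D hD t ht
  obtain ⟨E, h1, h2, h3, -⟩ := Derivation.exists_constantsProjection
    (hX.stalk_eq_zero (f.fiberι s x)) D t ht hcomm hpow Finset.univ
  refine ⟨E, fun b ↦ hDspan _ fun i hi ↦ h1 i hi b, fun a b ha ↦ h2 a b fun i _ ↦ ha _ (hDn i),
    fun b hb ↦ ?_, fun b hb ↦ ?_⟩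
  · exact sub_eq_zero.mp (h3 ⊥ (fun i _ y hy ↦ by
      rw [Ideal.mem_bot.mp hy, map_zero]
      exact zero_mem _) b fun i _ ↦ Ideal.mem_bot.mpr (hb _ (hDn i)))
  · rw [← sub_eq_zero, ← map_sub]
    refine RingHom.mem_ker.mp (h3 (RingHom.ker ((f.fiberι s).stalkMap x).hom) (fun i _ y hy ↦ ?_) b
      fun i _ ↦ RingHom.mem_ker.mpr (hb _ (hDn i)))
    obtain ⟨D', -, hc⟩ := F.exists_fiber_compatible s x (hDn i)
    rw [RingHom.mem_ker, ← hc, RingHom.mem_ker.mp hy, map_zero]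

end IsFamilyOfOneFoliations

section stalkMap

variable (F) {p : ℕ} (hp : p ≠ 0) (hX : X.OfChar p) {s : S} (z : f.fiber s)

lemma toFiberQuotient_comparison_fiberι :
    (F.toFiberQuotient hp hX s ≫ F.comparison hp hX s) ≫ (F.quotientToBase hp hX).fiberι s =
      f.fiberι s ≫ F.toQuotient hp hX := by
  rw [toFiberQuotient_comparison, fiberMap_fiberι]

/-- An element of the stalk of `X_s` comes from `(X/ℱ)_s` if it is the restriction of a section
annihilated by `ℱ`. -/
lemma exists_comparison_stalkMap_eq {b : X.presheaf.stalk (f.fiberι s z)}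
    (hb : ∀ D ∈ F.stalk (f.fiberι s z), D b = 0) : ∃ c,
      ((F.toFiberQuotient hp hX s).stalkMap z).hom
        (((F.comparison hp hX s).stalkMap (F.toFiberQuotient hp hX s z)).hom c) =
      ((f.fiberι s).stalkMap z).hom b := by
  obtain ⟨c, rfl⟩ := F.mem_range_toQuotient_stalkMap hp hX _ hb
  exact exists_stalkMap_stalkMap_eq (F.toFiberQuotient_comparison_fiberι hp hX) z c

lemma ringKrullDim_stalk_fiber_le :
    ringKrullDim ((f.fiber s).presheaf.stalk z) ≤ ringKrullDim
      (((F.quotientToBase hp hX).fiber s).presheaf.stalk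
        (F.comparison hp hX s (F.toFiberQuotient hp hX s z))) := by
  refine ringKrullDim_le_of_forall_pow_mem_range
    (((F.toFiberQuotient hp hX s).stalkMap z).hom.comp
      ((F.comparison hp hX s).stalkMap (F.toFiberQuotient hp hX s z)).hom) p (fun b ↦ ?_) hp
  obtain ⟨b, rfl⟩ := (f.fiberι s).stalkMap_surjective z b
  obtain ⟨c, hc⟩ := F.exists_comparison_stalkMap_eq hp hX z (b := b ^ p) fun D _ ↦ by
    rw [Derivation.leibniz_pow, ← Nat.cast_smul_eq_nsmul (X.presheaf.stalk (f.fiberι s z)),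
      hX.stalk_eq_zero, zero_smul]
  exact ⟨c, hc.trans (map_pow _ _ _)⟩

lemma comparison_stalkMap_surjective
    (h : ∀ b, (∀ D ∈ F.stalk (f.fiberι s z), ((f.fiberι s).stalkMap z).hom (D b) = 0) →
      ∃ b', (∀ D ∈ F.stalk (f.fiberι s z), D b' = 0) ∧
        ((f.fiberι s).stalkMap z).hom b' = ((f.fiberι s).stalkMap z).hom b) :
    Function.Surjective
      ((F.comparison hp hX s).stalkMap (F.toFiberQuotient hp hX s z)).hom := by
  intro c
  obtain ⟨b, hb⟩ := (f.fiberι s).stalkMap_surjective z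
    (((F.toFiberQuotient hp hX s).stalkMap z).hom c)
  obtain ⟨b', hb', hbb'⟩ := h b fun D hD ↦ by
    obtain ⟨E, hE, hc⟩ := F.exists_fiber_compatible s z hD
    rw [← hc]
    refine (congr_arg E hb).trans ?_
    exact (F.fiber s).invariant_toQuotient hp (hX.of_hom (f.fiberι s)) z E hE c
  obtain ⟨c', hc'⟩ := F.exists_comparison_stalkMap_eq hp hX z hb'
  refine ⟨c', (F.fiber s).toQuotient_stalkMap_injective hp (hX.of_hom (f.fiberι s)) z ?_⟩
  exact hc'.trans (hbb'.trans hb)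

lemma comparison_stalkMap_injective
    (E : X.presheaf.stalk (f.fiberι s z) →+ X.presheaf.stalk (f.fiberι s z))
    (hE : ∀ b, ∀ D ∈ F.stalk (f.fiberι s z), D (E b) = 0)
    (hlin : ∀ a b, (∀ D ∈ F.stalk (f.fiberι s z), D a = 0) → E (a * b) = a * E b)
    (hid : ∀ b, (∀ D ∈ F.stalk (f.fiberι s z), D b = 0) → E b = b) :
    Function.Injective
      ((F.comparison hp hX s).stalkMap (F.toFiberQuotient hp hX s z)).hom := by
  rw [injective_iff_map_eq_zero]
  intro c hc
  obtain ⟨c, rfl⟩ := ((F.quotientToBase hp hX).fiberι s).stalkMap_surjective _ c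
  have key := mem_of_stalkMap_eq_zero (F.toFiberQuotient_comparison_fiberι hp hX) z
    (fun w ↦ (IsLocalRing.maximalIdeal (S.presheaf.stalk (F.quotientToBase hp hX w))).map
      ((F.quotientToBase hp hX).stalkMap w).hom) (fun d hd ↦ by
      have h1 := mem_map_maximalIdeal_of_fiberι_stalkMap_eq_zero f s z _ hd
      rw [map_maximalIdeal_stalkMap_of_comp_eq (F.toQuotient_quotientToBase hp hX)] at h1
      refine mem_map_of_mem_map_comp _ _ (F.toQuotient_stalkMap_injective hp hX _) E
        (fun b ↦ F.mem_range_toQuotient_stalkMap hp hX _ (hE b)) (fun c b ↦ hlin _ _ ?_)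
        (fun c ↦ hid _ ?_) _ h1
      all_goals exact fun D hD ↦ F.invariant_toQuotient hp hX _ D hD c)
    ((congr_arg ((F.toFiberQuotient hp hX s).stalkMap z).hom hc).trans (map_zero _))
  have h0 : (IsLocalRing.maximalIdeal (S.presheaf.stalk (F.quotientToBase hp hX
      ((F.quotientToBase hp hX).fiberι s (F.comparison hp hX s
        (F.toFiberQuotient hp hX s z)))))).map ((F.quotientToBase hp hX).stalkMap _).hom ≤
      RingHom.ker (((F.quotientToBase hp hX).fiberι s).stalkMap (F.comparison hp hX s
        (F.toFiberQuotient hp hX s z))).hom :=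
    Ideal.map_le_iff_le_comap.mpr fun a ha ↦
      fiberι_stalkMap_stalkMap_eq_zero (F.quotientToBase hp hX) s _ ha
  exact RingHom.mem_ker.mp (h0 key)

end stalkMap

/-- The comparison morphism is an isomorphism on local rings of dimension at most one. -/
lemma IsFamilyOfOneFoliations.isIso_comparison_stalkMap {p r : ℕ} [hp : Fact p.Prime]
    (hX : X.OfChar p) [IsLocallyNoetherian S] (hF : F.IsFamilyOfOneFoliations p r)
    (hreg : IsRegularScheme S) {s : S} (z : f.fiber s)
    (hz : ringKrullDim (((F.quotientToBase hp.out.ne_zero hX).fiber s).presheaf.stalk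
      (F.comparison hp.out.ne_zero hX s (F.toFiberQuotient hp.out.ne_zero hX s z))) ≤ 1) :
    IsIso ((F.comparison hp.out.ne_zero hX s).stalkMap
      (F.toFiberQuotient hp.out.ne_zero hX s z)) := by
  obtain ⟨E, h1, h2, h3, h4⟩ := hF.exists_constantsProjection hX hreg z
    ((F.ringKrullDim_stalk_fiber_le hp.out.ne_zero hX z).trans hz)
  exact (ConcreteCategory.isIso_iff_bijective _).mpr
    ⟨F.comparison_stalkMap_injective hp.out.ne_zero hX z E h1 h2 h3,
      F.comparison_stalkMap_surjective hp.out.ne_zero hX z fun b hb ↦ ⟨E b, h1 b, h4 b hb⟩⟩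

end TangentSubsheaf
end AlgebraicGeometry

namespace AlgebraicGeometry

lemma isIntegrallyClosed_of_injective {A B : Type*} [CommRing A] [CommRing B] [IsDomain A]
    [IsDomain B] [IsIntegrallyClosed B] (θ : A →+* B) (hθ : Function.Injective θ)
    (h : ∀ a a' b, a ≠ 0 → θ a * b = θ a' → ∃ c, θ c = b) : IsIntegrallyClosed A := by
  rw [isIntegrallyClosed_iff (FractionRing A)]
  intro x hx
  obtain ⟨a', a, ha, rfl⟩ := IsFractionRing.div_surjective (A := A) x
  have ha0 : a ≠ 0 := nonZeroDivisors.ne_zero ha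
  let j : FractionRing A →+* FractionRing B :=
    IsFractionRing.lift (A := A) (g := (algebraMap B (FractionRing B)).comp θ)
      ((IsFractionRing.injective B (FractionRing B)).comp hθ)
  have hj (a : A) : j (algebraMap A (FractionRing A) a) = algebraMap B (FractionRing B) (θ a) :=
    IsFractionRing.lift_algebraMap _ _
  have hx' : _root_.IsIntegral B (j (algebraMap A (FractionRing A) a' /
      algebraMap A (FractionRing A) a)) := by
    obtain ⟨P, hP, hP0⟩ := hx
    refine ⟨P.map θ, hP.map θ, ?_⟩
    rw [Polynomial.eval₂_map]
    have h1 : (algebraMap B (FractionRing B)).comp θ = j.comp (algebraMap A (FractionRing A)) :=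
      RingHom.ext fun a ↦ (hj a).symm
    rw [h1, ← Polynomial.hom_eval₂, hP0, map_zero]
  obtain ⟨b, hb⟩ := IsIntegrallyClosed.isIntegral_iff.mp hx'
  have ha1 : algebraMap A (FractionRing A) a ≠ 0 :=
    IsFractionRing.to_map_ne_zero_of_mem_nonZeroDivisors ha
  have h2 : θ a * b = θ a' := by
    apply IsFractionRing.injective B (FractionRing B)
    rw [map_mul, hb, ← hj, ← hj, ← map_mul, mul_div_cancel₀ _ ha1]
  obtain ⟨c, rfl⟩ := h a a' b ha0 h2
  refine ⟨c, ?_⟩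
  rw [← map_mul] at h2
  rw [eq_div_iff ha1, ← map_mul, mul_comm, hθ h2]

/-- A homeomorphism from a scheme with an integral local ring that is an isomorphism in codimension
one is an isomorphism on local rings where the target is `S₂`. -/
lemma bijective_stalkMap_of_serreCondition {Y Z : Scheme.{u}} {φ : Y ⟶ Z} (hφ : IsHomeomorph φ)
    (y : Y) [IsLocallyNoetherian Z] [IsDomain (Y.presheaf.stalk y)]
    (h : ∀ y', ringKrullDim (Z.presheaf.stalk (φ y')) ≤ 1 → IsIso (φ.stalkMap y'))
    (hS : SerreCondition 2 (Z.presheaf.stalk (φ y))) : Function.Bijective (φ.stalkMap y).hom := by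
  have key (P : Ideal (Z.presheaf.stalk (φ y))) [P.IsPrime]
      (hP : ringKrullDim (Localization.AtPrime P) ≤ 1) :
      (∀ a, (φ.stalkMap y).hom a = 0 → ∃ u ∉ P, u * a = 0) ∧
        ∀ b, ∃ u ∉ P, ∃ a, (φ.stalkMap y).hom u * b = (φ.stalkMap y).hom a := by
    obtain ⟨z', hz', hP'⟩ := exists_comap_stalkSpecializes_eq (φ y) P
    obtain ⟨y', rfl⟩ := hφ.surjective z'
    have hy' : y' ⤳ y := hφ.isInducing.specializes_iff.mp hz'
    let _ := (Z.presheaf.stalkSpecializes hz').hom.toAlgebra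
    have hloc := isLocalization_stalkSpecializes hz'
    subst hP'
    rw [ringKrullDim_eq_of_ringEquiv (IsLocalization.algEquiv
      ((IsLocalRing.maximalIdeal (Z.presheaf.stalk (φ y'))).comap
        (Z.presheaf.stalkSpecializes hz').hom).primeCompl
      (Localization.AtPrime _) (Z.presheaf.stalk (φ y'))).toRingEquiv] at hP
    have hbij := (ConcreteCategory.isIso_iff_bijective _).mp (h y' hP)
    have hnat (a) : (φ.stalkMap y').hom ((Z.presheaf.stalkSpecializes hz').hom a) =
        (Y.presheaf.stalkSpecializes hy').hom ((φ.stalkMap y).hom a) :=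
      congr($(φ.stalkSpecializes_stalkMap y' y hy').hom a)
    refine ⟨fun a ha ↦ ?_, fun b ↦ ?_⟩
    · have h1 : (Z.presheaf.stalkSpecializes hz').hom a = 0 := by
        apply hbij.1
        refine (hnat a).trans ?_
        rw [ha, map_zero]
        exact (map_zero _).symm
      obtain ⟨u, hu⟩ := hloc.exists_of_eq (x := a) (y := 0) (h1.trans (map_zero _).symm)
      exact ⟨u, u.2, hu.trans (mul_zero _)⟩
    · obtain ⟨c, hc⟩ := hbij.2 ((Y.presheaf.stalkSpecializes hy').hom b)
      obtain ⟨⟨a, u⟩, hau⟩ := IsLocalization.surj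
        ((IsLocalRing.maximalIdeal (Z.presheaf.stalk (φ y'))).comap
          (Z.presheaf.stalkSpecializes hz').hom).primeCompl c
      refine ⟨u, u.2, a, ?_⟩
      let _ := (Y.presheaf.stalkSpecializes hy').hom.toAlgebra
      have hloc' := isLocalization_stalkSpecializes hy'
      obtain ⟨m, hm⟩ := hloc'.exists_of_eq (x := (φ.stalkMap y).hom u * b)
        (y := (φ.stalkMap y).hom a) (by
          change (Y.presheaf.stalkSpecializes hy').hom _ = (Y.presheaf.stalkSpecializes hy').hom _
          rw [map_mul, ← hnat, ← hnat, ← hc]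
          change (φ.stalkMap y').hom _ * (φ.stalkMap y').hom c = _
          rw [← map_mul, mul_comm]
          exact congr_arg _ hau)
      refine mul_left_cancel₀ (fun h0 ↦ m.2 ?_) hm
      rw [h0]
      exact zero_mem _
  exact hS.bijective_of_forall_ringKrullDim_le_one _ (fun P _ hP ↦ (key P hP).1)
    fun P _ hP ↦ (key P hP).2

namespace TangentSubsheaf

variable {X S : Scheme.{u}} {f : X ⟶ S} (F : TangentSubsheaf f) {p : ℕ} (hp : p ≠ 0)
  (hX : X.OfChar p)

lemma isDomain_quotient_stalk (x : X) [IsDomain (X.presheaf.stalk x)] :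
    IsDomain ((F.quotient hp hX).presheaf.stalk (F.toQuotient hp hX x)) :=
  (F.toQuotient_stalkMap_injective hp hX x).isDomain _

/-- The quotient of a normal scheme by `ℱ` is normal. -/
lemma isIntegrallyClosed_quotient_stalk (x : X) [IsDomain (X.presheaf.stalk x)]
    [IsIntegrallyClosed (X.presheaf.stalk x)] :
    IsIntegrallyClosed ((F.quotient hp hX).presheaf.stalk (F.toQuotient hp hX x)) := by
  have := F.isDomain_quotient_stalk hp hX x
  have hinj := F.toQuotient_stalkMap_injective hp hX x
  refine isIntegrallyClosed_of_injective _ hinj fun a a' b ha h ↦ ?_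
  refine F.mem_range_toQuotient_stalkMap hp hX x fun D hD ↦ ?_
  have h1 := congr_arg D h
  rw [Derivation.leibniz, F.invariant_toQuotient hp hX x D hD,
    F.invariant_toQuotient hp hX x D hD, smul_zero, add_zero, smul_eq_mul] at h1
  exact (mul_eq_zero.mp h1).resolve_left ((map_ne_zero_iff _ hinj).mpr ha)

variable {F}

/-- The comparison morphism is an isomorphism at a point if and only if its target is `S₂`. -/
lemma IsFamilyOfOneFoliations.isIsoAt_comparison_iff {p r : ℕ} [hp : Fact p.Prime]
    (hX : X.OfChar p) [IsLocallyNoetherian S] (hF : F.IsFamilyOfOneFoliations p r)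
    (hreg : IsRegularScheme S) {s : S} (z : f.fiber s) :
    IsIsoAt (F.comparison hp.out.ne_zero hX s) (F.toFiberQuotient hp.out.ne_zero hX s z) ↔
      SerreCondition 2 (((F.quotientToBase hp.out.ne_zero hX).fiber s).presheaf.stalk
        (F.comparison hp.out.ne_zero hX s (F.toFiberQuotient hp.out.ne_zero hX s z))) := by
  have := hF.locallyOfFiniteType
  have := F.isLocallyNoetherian_fiber_quotientToBase hp.out.ne_zero hX s
  have := F.isFinite_comparison hp.out.ne_zero hX s
  have : IsLocallyNoetherian (F.fiberQuotient hp.out.ne_zero hX s) :=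
    LocallyOfFiniteType.isLocallyNoetherian (F.comparison hp.out.ne_zero hX s)
  obtain ⟨_, _⟩ := fiber_of_geometrically hF.geometricallyNormal s z
  have := (F.fiber s).isDomain_quotient_stalk hp.out.ne_zero (hX.of_hom (f.fiberι s)) z
  have := (F.fiber s).isIntegrallyClosed_quotient_stalk hp.out.ne_zero (hX.of_hom (f.fiberι s)) z
  constructor
  · intro h
    have := h.isIso_stalkMap
    let e := (asIso ((F.comparison hp.out.ne_zero hX s).stalkMap
      (F.toFiberQuotient hp.out.ne_zero hX s z))).commRingCatIsoToRingEquiv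
    have := e.injective.isDomain
    have := IsIntegrallyClosed.of_equiv e.symm
    exact SerreCondition.two_of_isIntegrallyClosed _
  · intro h
    have : IsIso ((F.comparison hp.out.ne_zero hX s).stalkMap
        (F.toFiberQuotient hp.out.ne_zero hX s z)) :=
      (ConcreteCategory.isIso_iff_bijective _).mpr
        (bijective_stalkMap_of_serreCondition (F.isHomeomorph_comparison hp.out.ne_zero hX s) _
          (fun z' hz' ↦ hF.isIso_comparison_stalkMap hX hreg z' hz') h)
    exact isIsoAt_of_isIso_stalkMap _ (F.isHomeomorph_comparison hp.out.ne_zero hX s) _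

/-- The comparison morphism is an isomorphism in codimension one. -/
lemma IsFamilyOfOneFoliations.isIsoInCodimensionOne_comparison {p r : ℕ} [hp : Fact p.Prime]
    (hX : X.OfChar p) [IsLocallyNoetherian S] (hF : F.IsFamilyOfOneFoliations p r)
    (hreg : IsRegularScheme S) (s : S) :
    IsIsoInCodimensionOne (F.comparison hp.out.ne_zero hX s) := by
  have := hF.locallyOfFiniteType
  have := F.isLocallyNoetherian_fiber_quotientToBase hp.out.ne_zero hX s
  have := F.isFinite_comparison hp.out.ne_zero hX s
  have : IsLocallyNoetherian (F.fiberQuotient hp.out.ne_zero hX s) :=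
    LocallyOfFiniteType.isLocallyNoetherian (F.comparison hp.out.ne_zero hX s)
  refine isIsoInCodimensionOne_of_isIsoAt _
    (F.isHomeomorph_comparison hp.out.ne_zero hX s).surjective fun z hz ↦ ?_
  have : IsIso ((F.comparison hp.out.ne_zero hX s).stalkMap z) :=
    hF.isIso_comparison_stalkMap hX hreg z hz
  exact isIsoAt_of_isIso_stalkMap _ (F.isHomeomorph_comparison hp.out.ne_zero hX s) _

end TangentSubsheaf
end AlgebraicGeometry

theorem mainTheorem8 {p : ℕ} [hp : Fact p.Prime] {k : Type u} [Field k] [CharP k p]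
    [PerfectField k] {X S : Scheme.{u}} (σ : S ⟶ Spec (.of k)) [IsLocallyNoetherian S]
    (hS : IsFFiniteScheme p S) (f : X ⟶ S) (F : TangentSubsheaf f) (r : ℕ)
    (hF : F.IsFamilyOfOneFoliations p r) (hreg : IsRegularScheme S) (s : S) :
    IsFinite (F.comparison hp.out.ne_zero (Scheme.OfChar.of_hom_spec (f ≫ σ)) s) ∧
    IsIsoInCodimensionOne (F.comparison hp.out.ne_zero (Scheme.OfChar.of_hom_spec (f ≫ σ)) s) ∧
    ∀ z : f.fiber s,
      IsIsoAt (F.comparison hp.out.ne_zero (Scheme.OfChar.of_hom_spec (f ≫ σ)) s)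
          (F.toFiberQuotient hp.out.ne_zero (Scheme.OfChar.of_hom_spec (f ≫ σ)) s z) ↔
        SerreCondition 2
          (((F.quotientToBase hp.out.ne_zero (Scheme.OfChar.of_hom_spec (f ≫ σ))).fiber
              s).presheaf.stalk
            (F.comparison hp.out.ne_zero (Scheme.OfChar.of_hom_spec (f ≫ σ)) s
              (F.toFiberQuotient hp.out.ne_zero (Scheme.OfChar.of_hom_spec (f ≫ σ)) s z))) := by
  have hX := Scheme.OfChar.of_hom_spec (p := p) (f ≫ σ)
  have := hF.locallyOfFiniteType
  exact ⟨F.isFinite_comparison _ hX s, hF.isIsoInCodimensionOne_comparison hX hreg s,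
    fun z ↦ hF.isIsoAt_comparison_iff hX hreg z⟩
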